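/- An instance of \textsc{Gerrymandering over Graphs} consists of an undirected connected graph $G=(V,E)$, a weight function $w\colon V\to\mathbb N$, a set $C$ of colors, a target color $p\in C$, a coloring $\mathrm{col}\colon V\to C$, and an integer $k$. For a part $A\subseteq V$ and a color $q$ let $w_q(A)$ be the sum of $w(v)$ over all $v\in A$ with $\mathrm{col}(v)=q$. The part $A$ is $q$-colored if $w_q(A)\ge w_r(A)$ for every $r\in C$, and uniquely $q$-colored if $w_q(A)>w_r(A)$ for every $r\in C\setminus\{q\}$. The question is whether $V$ can be partitioned into exactly $k$ nonempty parts, each inducing a connected subgraph of $G$, such that for each $r\in C\setminus\{p\}$ the number of uniquely $p$-colored parts exceeds the number of $r$-colored parts. Proposition. For $|C|=2$, \textsc{Gerrymandering over Graphs} restricted to trees can be solved in $O(n^3)$ time, where $n=|V|$. Here time is the number of steps of a random access machine which adds, subtracts, compares with zero, loads and stores integers in unit time, and whose words have $O(\log(n+|k|+\sum_{v\in V} w(v)+2))$ bits; the graph is given by a list of its edges. -/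

import Mathlib

/-! ### The problem Gerrymandering over Graphs -/

namespace Gerrymandering

/-- `w_q(A)`: the total weight of the vertices of color `q` in `A`. -/
def colorWeight {V C : Type*} [DecidableEq C] (w : V → ℕ) (col : V → C) (q : C)
    (A : Finset V) : ℕ :=
  ∑ v ∈ A with col v = q, w v

/-- The part `A` is `q`-colored: no color has larger total weight in `A` than `q`. -/
def IsColored {V C : Type*} [DecidableEq C] (w : V → ℕ) (col : V → C) (q : C)
    (A : Finset V) : Prop :=
  ∀ r : C, colorWeight w col r A ≤ colorWeight w col q A

/-- The part `A` is uniquely `q`-colored: every other color has smaller total weight in `A`. -/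
def IsUniquelyColored {V C : Type*} [DecidableEq C] (w : V → ℕ) (col : V → C) (q : C)
    (A : Finset V) : Prop :=
  ∀ r : C, r ≠ q → colorWeight w col r A < colorWeight w col q A

/-- An input of Gerrymandering over Graphs. The vertices are `0, …, n - 1` and the set of
colors is `{0, …, numColors - 1}`. -/
structure Instance where
  n : ℕ
  numColors : ℕ
  graph : SimpleGraph (Fin n)
  connected : graph.Connected
  weight : Fin n → ℕ
  target : Fin numColors
  color : Fin n → Fin numColors
  k : ℤ

open Classical in
/-- The question: is there a partition of the vertex set into exactly `k` (nonempty) parts, each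
inducing a connected subgraph, such that the number of uniquely `p`-colored parts exceeds the
number of `r`-colored parts for each color `r ≠ p`, where `p` is the target color? -/
def Instance.IsYes (I : Instance) : Prop :=
  ∃ P : Finpartition (Finset.univ : Finset (Fin I.n)),
    (P.parts.card : ℤ) = I.k ∧
    (∀ A ∈ P.parts, (I.graph.induce (A : Set (Fin I.n))).Connected) ∧
    ∀ r : Fin I.numColors, r ≠ I.target →
      (P.parts.filter (fun A => IsColored I.weight I.color r A)).card <
        (P.parts.filter (fun A => IsUniquelyColored I.weight I.color I.target A)).card

/-- `es` lists every edge of the graph exactly once, in any order, each edge being given by its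
two endpoints in either order. -/
def Instance.IsEdgeListing (I : Instance) (es : List (Fin I.n × Fin I.n)) : Prop :=
  (es.map (fun e => s(e.1, e.2))).Nodup ∧
    ∀ e : Sym2 (Fin I.n), e ∈ es.map (fun e => s(e.1, e.2)) ↔ e ∈ I.graph.edgeSet

/-- The input as a sequence of numbers: the number of vertices, the number of colors, the target
color, `k`, then the weights, then the colors of the vertices, then the endpoints of the edges. -/
def Instance.encode (I : Instance) (es : List (Fin I.n × Fin I.n)) : List ℤ :=
  [(I.n : ℤ), (I.numColors : ℤ), ((I.target : ℕ) : ℤ), I.k]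
    ++ List.ofFn (fun v : Fin I.n => (I.weight v : ℤ))
    ++ List.ofFn (fun v : Fin I.n => ((I.color v : ℕ) : ℤ))
    ++ es.flatMap (fun e => [((e.1 : ℕ) : ℤ), ((e.2 : ℕ) : ℤ)])

end Gerrymandering

/-! ### A random access machine

The machine has registers and a memory, both holding integers. Every instruction takes one unit of
time; the only arithmetic is addition and subtraction, and the only test is a comparison
with zero. -/

namespace RAM

/-- The instructions; `i`, `j`, `l` name registers and `t` is a position in the program. -/
inductive Instr where
  /-- `R[i] := z` -/
  | const (i : ℕ) (z : ℤ)
  /-- `R[i] := R[j] + R[l]` -/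
  | add (i j l : ℕ)
  /-- `R[i] := R[j] - R[l]` -/
  | sub (i j l : ℕ)
  /-- `R[i] := M[R[j]]` -/
  | load (i j : ℕ)
  /-- `M[R[i]] := R[j]` -/
  | store (i j : ℕ)
  /-- go to `t` -/
  | jump (t : ℕ)
  /-- if `R[i] > 0`, go to `t` -/
  | jumpPos (i t : ℕ)

/-- A program is a finite list of instructions. -/
abbrev Program := List Instr

/-- A configuration: the position in the program, the registers and the memory. -/
structure Config where
  pc : ℕ
  reg : ℕ → ℤ
  mem : ℕ → ℤ

/-- Execution of one instruction. (A negative address is read as the address `0`.) -/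
def Instr.exec (s : Config) : Instr → Config
  | .const i z => { s with pc := s.pc + 1, reg := Function.update s.reg i z }
  | .add i j l => { s with pc := s.pc + 1, reg := Function.update s.reg i (s.reg j + s.reg l) }
  | .sub i j l => { s with pc := s.pc + 1, reg := Function.update s.reg i (s.reg j - s.reg l) }
  | .load i j =>
      { s with pc := s.pc + 1, reg := Function.update s.reg i (s.mem (s.reg j).toNat) }
  | .store i j =>
      { s with pc := s.pc + 1, mem := Function.update s.mem (s.reg i).toNat (s.reg j) }
  | .jump t => { s with pc := t }
  | .jumpPos i t => { s with pc := if 0 < s.reg i then t else s.pc + 1 }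

/-- One step of the program `P`. A configuration whose position lies outside the program has
halted and does not change any more. -/
def step (P : Program) (s : Config) : Config :=
  match P[s.pc]? with
  | some ins => ins.exec s
  | none => s

/-- The initial configuration: the input is in the memory cells `0, 1, 2, …`, and all other cells
and all registers are `0`. -/
def init (x : List ℤ) : Config where
  pc := 0
  reg := fun _ => 0
  mem := fun a => x.getD a 0

/-- The configuration after `t` steps on input `x`. -/
def run (P : Program) (x : List ℤ) (t : ℕ) : Config :=
  (step P)^[t] (init x)

/-- On input `x` the program `P` halts after at most `T` steps, with the correct answer to the
question `Q` in register `0` (`1` for yes, `0` for no), and no number of absolute value larger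
than `B` ever occurs in a register or a memory cell. -/
def DecidesWithin (P : Program) (x : List ℤ) (Q : Prop) (T B : ℕ) : Prop :=
  ∃ t ≤ T,
    P.length ≤ (run P x t).pc ∧
    (Q → (run P x t).reg 0 = 1) ∧
    (¬ Q → (run P x t).reg 0 = 0) ∧
    ∀ u ≤ t, ∀ a : ℕ, |(run P x u).reg a| ≤ (B : ℤ) ∧ |(run P x u).mem a| ≤ (B : ℤ)

end RAM

/-! Count weight positively on the target color and negatively on the other one. With two colors, a
part is uniquely target-colored iff its signed sum is positive, and otherwise it is colored by the
other color. So the question is whether some partition into `k` connected parts has more than `k /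
2` parts of positive sum (`Instance.isYes_iff`).

Consider a bag `X` of vertices with a distinguished vertex `v`. A partition of `X` has an open part,
containing `v`, of sum `s`, and `j` closed parts, `w` of them with positive sum. These data are
packed into one number `x = M * (w + 1) + s`, where `M` exceeds the absolute value of every signed
sum. When the bag is attached to a neighbor of `v`, there are two choices. Extending the open part
adds the values of the two bags, up to the common offset `M`. Closing it replaces `x` by `M * ⌈x /
M⌉`, because `⌈x / M⌉` is `w + 1`, increased by one exactly if `s > 0` (`ceilDiv_value`). Both
operations are monotone in `x`, so for each `j` only the largest value matters. Values of actual
partitions are positive, which leaves `0` free to mean that there is none. Every partition of two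
bags joined by a single edge arises in one of the two ways (`IsJoin.isValue_union_iff`), so the
table of the union is a max-plus convolution (`IsJoin.represents_convTab`).

The tree is contracted edge by edge. A leaf other than the root is merged into its neighbor until
only the root is left; such a leaf exists by `IsContraction.exists_isLeafEdge`, and the tables stay
correct by `IsProgress.merge`. There are `n - 1` rounds. Each scans the edge list, rounds up at most
`n` table entries, and convolves two tables. The machine cannot divide, but the quotients are at
most `n + 1`, so repeated addition rounds one entry in linear time. A round thus takes quadratic
time and the whole run cubic time.

The program is written in a small structured language whose big-step semantics carries a clock and a
bound on all computed numbers. `Exec.reaches` transfers both to the compiled code, so running time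
and word size are proved together with correctness. -/

set_option linter.unusedSectionVars false
set_option linter.unusedSimpArgs false

namespace RAM

/-! ### Structured programs and their compilation -/

/-- Structured programs over the instructions of the machine. -/
inductive Cmd where
  | const (i : ℕ) (z : ℤ)
  | add (i j l : ℕ)
  | sub (i j l : ℕ)
  | load (i j : ℕ)
  | store (i j : ℕ)
  | skip
  | seq (c₁ c₂ : Cmd)
  /-- if `R[i] > 0` then `c₁` else `c₂` -/
  | ite (i : ℕ) (c₁ c₂ : Cmd)
  /-- while `R[i] > 0` do `c` -/
  | loop (i : ℕ) (c : Cmd)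

namespace Cmd

/-- Sequential execution of a list of commands. -/
def block : List Cmd → Cmd
  | [] => skip
  | c :: cs => seq c (block cs)

/-- The number of instructions that a command is compiled to. -/
def size : Cmd → ℕ
  | skip => 0
  | seq c₁ c₂ => size c₁ + size c₂
  | ite _ c₁ c₂ => size c₁ + size c₂ + 2
  | loop _ c => size c + 3
  | _ => 1

/-- The code of a command, placed at position `p`. -/
def code : Cmd → ℕ → Program
  | const i z, _ => [.const i z]
  | add i j l, _ => [.add i j l]
  | sub i j l, _ => [.sub i j l]
  | load i j, _ => [.load i j]
  | store i j, _ => [.store i j]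
  | skip, _ => []
  | seq c₁ c₂, p => code c₁ p ++ code c₂ (p + size c₁)
  | ite i c₁ c₂, p =>
      [.jumpPos i (p + size c₂ + 2)] ++ (code c₂ (p + 1) ++
        ([.jump (p + size c₂ + 2 + size c₁)] ++ code c₁ (p + size c₂ + 2)))
  | loop i c, p =>
      [.jumpPos i (p + 2)] ++ ([.jump (p + size c + 3)] ++ (code c (p + 2) ++ [.jump p]))

/-- The registers that a command may write. -/
def writes : Cmd → List ℕ
  | const i _ => [i]
  | add i _ _ => [i]
  | sub i _ _ => [i]
  | load i _ => [i]
  | store _ _ => []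
  | skip => []
  | seq c₁ c₂ => writes c₁ ++ writes c₂
  | ite _ c₁ c₂ => writes c₁ ++ writes c₂
  | loop _ c => writes c

/-- Jump targets are computed from `size`, so `size` has to be the true length of the code. -/
theorem length_code (c : Cmd) (p : ℕ) : (c.code p).length = c.size := by
  induction c generalizing p with
  | seq c₁ c₂ h₁ h₂ => simp [code, size, h₁, h₂]
  | ite i c₁ c₂ h₁ h₂ => simp [code, size, h₁, h₂]; omega
  | loop i c h => simp [code, size, h]
  | _ => rfl

end Cmd

/-- Registers, memory, and the number of steps made so far. -/
structure State where
  reg : ℕ → ℤ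
  mem : ℕ → ℤ
  clock : ℕ

/-- The configuration with program position `p` and the registers and memory of `s`. -/
def State.at (s : State) (p : ℕ) : Config := ⟨p, s.reg, s.mem⟩

/-- All numbers in registers and memory have absolute value at most `B`. -/
def Bounded (B : ℤ) (reg mem : ℕ → ℤ) : Prop :=
  ∀ a, |reg a| ≤ B ∧ |mem a| ≤ B

/-- Big-step semantics; every computed number has absolute value at most `B`. -/
inductive Exec (B : ℤ) : Cmd → State → State → Prop
  | const (i : ℕ) (z : ℤ) (s : State) (h : |z| ≤ B) :
      Exec B (.const i z) s ⟨Function.update s.reg i z, s.mem, s.clock + 1⟩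
  | add (i j l : ℕ) (s : State) (h : |s.reg j + s.reg l| ≤ B) :
      Exec B (.add i j l) s
        ⟨Function.update s.reg i (s.reg j + s.reg l), s.mem, s.clock + 1⟩
  | sub (i j l : ℕ) (s : State) (h : |s.reg j - s.reg l| ≤ B) :
      Exec B (.sub i j l) s
        ⟨Function.update s.reg i (s.reg j - s.reg l), s.mem, s.clock + 1⟩
  | load (i j : ℕ) (s : State) :
      Exec B (.load i j) s
        ⟨Function.update s.reg i (s.mem (s.reg j).toNat), s.mem, s.clock + 1⟩
  | store (i j : ℕ) (s : State) :
      Exec B (.store i j) s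
        ⟨s.reg, Function.update s.mem (s.reg i).toNat (s.reg j), s.clock + 1⟩
  | skip (s : State) : Exec B .skip s s
  | seq {c₁ c₂ : Cmd} {s s₁ s₂ : State} :
      Exec B c₁ s s₁ → Exec B c₂ s₁ s₂ → Exec B (.seq c₁ c₂) s s₂
  | ite_pos {i : ℕ} {c₁ c₂ : Cmd} {s s' : State} (h : 0 < s.reg i) :
      Exec B c₁ ⟨s.reg, s.mem, s.clock + 1⟩ s' → Exec B (.ite i c₁ c₂) s s'
  | ite_neg {i : ℕ} {c₁ c₂ : Cmd} {s s' : State} (h : ¬ 0 < s.reg i) :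
      Exec B c₂ ⟨s.reg, s.mem, s.clock + 2⟩ s' → Exec B (.ite i c₁ c₂) s s'
  | loop_pos {i : ℕ} {c : Cmd} {s s₁ s₂ : State} (h : 0 < s.reg i) :
      Exec B c ⟨s.reg, s.mem, s.clock + 2⟩ s₁ → Exec B (.loop i c) s₁ s₂ →
      Exec B (.loop i c) s s₂
  | loop_neg {i : ℕ} {c : Cmd} {s : State} (h : ¬ 0 < s.reg i) :
      Exec B (.loop i c) s ⟨s.reg, s.mem, s.clock + 2⟩

/-- Since `writes` is a concrete list, preservation of a given register across a whole block is
settled by `decide`. -/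
theorem Exec.frame {B : ℤ} {c : Cmd} {s s' : State} (h : Exec B c s s') :
    ∀ r ∉ c.writes, s'.reg r = s.reg r := by
  induction h with
  | seq _ _ h₁ h₂ =>
    intro r hr
    simp only [Cmd.writes, List.mem_append, not_or] at hr
    rw [h₂ r hr.2, h₁ r hr.1]
  | ite_pos _ _ h => intro r hr; exact h r (by simp_all [Cmd.writes])
  | ite_neg _ _ h => intro r hr; exact h r (by simp_all [Cmd.writes])
  | loop_pos _ _ _ h₁ h₂ => intro r hr; rw [h₂ r hr, h₁ r hr]
  | _ =>
    intro r hr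
    try rw [Cmd.writes, List.mem_singleton] at hr
    simp [*]

/-! ### Correctness of the compilation -/

/-- The list `l` of instructions occurs in `P` at position `p`. -/
def CodeAt (P : Program) (p : ℕ) (l : Program) : Prop :=
  ∃ l₁ l₂, P = l₁ ++ l ++ l₂ ∧ l₁.length = p

theorem CodeAt.append {P l l' : Program} {p : ℕ} (h : CodeAt P p (l ++ l')) :
    CodeAt P p l ∧ CodeAt P (p + l.length) l' := by
  obtain ⟨l₁, l₂, rfl, rfl⟩ := h
  exact ⟨⟨l₁, l' ++ l₂, by simp, rfl⟩, ⟨l₁ ++ l, l₂, by simp, by simp⟩⟩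

theorem CodeAt.step {P : Program} {p : ℕ} {ins : Instr} (h : CodeAt P p [ins]) (s : State) :
    RAM.step P (s.at p) = ins.exec (s.at p) := by
  obtain ⟨l₁, l₂, rfl, rfl⟩ := h
  simp [RAM.step, State.at]

/-- In `t` steps `P` goes from `x` to `y`, and all configurations on the way are bounded. -/
def Reaches (P : Program) (B : ℤ) (x y : Config) (t : ℕ) : Prop :=
  (step P)^[t] x = y ∧
    ∀ u ≤ t, Bounded B ((step P)^[u] x).reg ((step P)^[u] x).mem

theorem Reaches.trans {P : Program} {B : ℤ} {x y z : Config} {t u : ℕ}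
    (h : Reaches P B x y t) (h' : Reaches P B y z u) : Reaches P B x z (t + u) := by
  obtain ⟨rfl, h⟩ := h
  obtain ⟨rfl, h'⟩ := h'
  refine ⟨by rw [add_comm, Function.iterate_add_apply], fun m hm => ?_⟩
  by_cases hmt : m ≤ t
  · exact h m hmt
  · obtain ⟨k, rfl⟩ := Nat.exists_eq_add_of_le (le_of_not_ge hmt)
    rw [add_comm, Function.iterate_add_apply]
    exact h' k (by omega)

theorem Reaches.refl {P : Program} {B : ℤ} {x : Config} (h : Bounded B x.reg x.mem) :
    Reaches P B x x 0 :=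
  ⟨rfl, fun u hu => by simpa [Nat.le_zero.1 hu] using h⟩

theorem CodeAt.reaches {P : Program} {B : ℤ} {p : ℕ} {ins : Instr} (h : CodeAt P p [ins])
    {s : State} {y : Config} (hs : Bounded B s.reg s.mem) (hy : Bounded B y.reg y.mem)
    (he : ins.exec (s.at p) = y) : Reaches P B (s.at p) y 1 := by
  refine ⟨by rw [Function.iterate_one, h.step, he], fun u hu => ?_⟩
  interval_cases u
  · exact hs
  · rw [Function.iterate_one, h.step, he]; exact hy

theorem Bounded.update_reg {B : ℤ} {reg mem : ℕ → ℤ} (h : Bounded B reg mem) (i : ℕ) {z : ℤ}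
    (hz : |z| ≤ B) : Bounded B (Function.update reg i z) mem := by
  intro a
  refine ⟨?_, (h a).2⟩
  by_cases ha : a = i
  · subst ha; simpa using hz
  · simpa [ha] using (h a).1

theorem Bounded.update_mem {B : ℤ} {reg mem : ℕ → ℤ} (h : Bounded B reg mem) (i : ℕ) {z : ℤ}
    (hz : |z| ≤ B) : Bounded B reg (Function.update mem i z) := by
  intro a
  refine ⟨(h a).1, ?_⟩
  by_cases ha : a = i
  · subst ha; simpa using hz
  · simpa [ha] using (h a).2

/-- Induction on the execution, not on the command: the remaining iterations of a loop are an
execution of the same loop at the same position. The clock advances by exactly the number of machine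
steps. -/
theorem Exec.reaches {B : ℤ} {c : Cmd} {s s' : State} (h : Exec B c s s') (P : Program) :
    ∀ p, CodeAt P p (c.code p) → Bounded B s.reg s.mem →
      ∃ t, s'.clock = s.clock + t ∧ Bounded B s'.reg s'.mem ∧
        Reaches P B (s.at p) (s'.at (p + c.size)) t := by
  induction h with
  | const i z s h =>
    intro p hp hs
    exact ⟨1, rfl, hs.update_reg i h, hp.reaches hs (hs.update_reg i h) rfl⟩
  | add i j l s h =>
    intro p hp hs
    exact ⟨1, rfl, hs.update_reg i h, hp.reaches hs (hs.update_reg i h) rfl⟩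
  | sub i j l s h =>
    intro p hp hs
    exact ⟨1, rfl, hs.update_reg i h, hp.reaches hs (hs.update_reg i h) rfl⟩
  | load i j s =>
    intro p hp hs
    have hb := hs.update_reg i (hs (s.reg j).toNat).2
    exact ⟨1, rfl, hb, hp.reaches hs hb rfl⟩
  | store i j s =>
    intro p hp hs
    have hb := hs.update_mem (s.reg i).toNat (hs j).1
    exact ⟨1, rfl, hb, hp.reaches hs hb rfl⟩
  | skip s =>
    intro p hp hs
    exact ⟨0, rfl, hs, Reaches.refl hs⟩
  | @seq c₁ c₂ s s₁ s₂ _ _ ih₁ ih₂ =>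
    intro p hp hs
    obtain ⟨hp₁, hp₂⟩ := CodeAt.append hp
    rw [Cmd.length_code] at hp₂
    obtain ⟨t₁, ht₁, hs₁, hr₁⟩ := ih₁ p hp₁ hs
    obtain ⟨t₂, ht₂, hs₂, hr₂⟩ := ih₂ _ hp₂ hs₁
    refine ⟨t₁ + t₂, by omega, hs₂, ?_⟩
    rw [Cmd.size, ← add_assoc]
    exact hr₁.trans hr₂
  | @ite_pos i c₁ c₂ s s' hi _ ih =>
    intro p hp hs
    obtain ⟨h₁, h₂⟩ := CodeAt.append hp
    obtain ⟨h₂, h₃⟩ := CodeAt.append h₂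
    obtain ⟨h₃, h₄⟩ := CodeAt.append h₃
    simp only [Cmd.length_code, List.length_singleton] at h₂ h₃ h₄
    have e : p + 1 + c₂.size + 1 = p + c₂.size + 2 := by omega
    rw [e] at h₄
    obtain ⟨t, ht, hs', hr⟩ := ih _ h₄ hs
    refine ⟨1 + t, by simp only at ht; omega, hs', ?_⟩
    have := h₁.reaches (y := State.at ⟨s.reg, s.mem, s.clock + 1⟩ (p + c₂.size + 2)) hs hs
      (by simp [Instr.exec, State.at, hi])
    have e' : p + (Cmd.ite i c₁ c₂).size = p + c₂.size + 2 + c₁.size := by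
      simp only [Cmd.size]; omega
    rw [e']
    exact this.trans hr
  | @ite_neg i c₁ c₂ s s' hi _ ih =>
    intro p hp hs
    obtain ⟨h₁, h₂⟩ := CodeAt.append hp
    obtain ⟨h₂, h₃⟩ := CodeAt.append h₂
    obtain ⟨h₃, h₄⟩ := CodeAt.append h₃
    simp only [Cmd.length_code, List.length_singleton] at h₂ h₃ h₄
    obtain ⟨t, ht, hs', hr⟩ := ih _ h₂ hs
    -- The semantics charges both units in advance; they pay for the failed test and for the jump
    -- over the other branch.
    refine ⟨1 + t + 1, by simp only at ht; omega, hs', ?_⟩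
    have a₁ := h₁.reaches (y := State.at ⟨s.reg, s.mem, s.clock + 2⟩ (p + 1)) hs hs
      (by simp [Instr.exec, State.at, hi])
    have e' : p + (Cmd.ite i c₁ c₂).size = p + c₂.size + 2 + c₁.size := by
      simp only [Cmd.size]; omega
    rw [e']
    have a₂ := h₃.reaches (s := s') (y := s'.at (p + c₂.size + 2 + c₁.size)) hs' hs' rfl
    exact (a₁.trans hr).trans a₂
  | @loop_pos i c s s₁ s₂ hi _ _ ih₁ ih₂ =>
    intro p hp hs
    have hp' := hp
    obtain ⟨h₁, h₂⟩ := CodeAt.append hp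
    obtain ⟨h₂, h₃⟩ := CodeAt.append h₂
    obtain ⟨h₃, h₄⟩ := CodeAt.append h₃
    simp only [Cmd.length_code, List.length_singleton] at h₂ h₃ h₄
    obtain ⟨t₁, ht₁, hs₁, hr₁⟩ := ih₁ _ h₃ hs
    obtain ⟨t₂, ht₂, hs₂, hr₂⟩ := ih₂ p hp' hs₁
    -- One step for the test and one for the jump back after the body.
    refine ⟨1 + t₁ + 1 + t₂, by simp only at ht₁; omega, hs₂, ?_⟩
    have a₁ := h₁.reaches (y := State.at ⟨s.reg, s.mem, s.clock + 2⟩ (p + 2)) hs hs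
      (by simp [Instr.exec, State.at, hi])
    have a₂ := h₄.reaches (s := s₁) (y := s₁.at p) hs₁ hs₁ rfl
    exact ((a₁.trans hr₁).trans a₂).trans hr₂
  | @loop_neg i c s hi =>
    intro p hp hs
    obtain ⟨h₁, h₂⟩ := CodeAt.append hp
    obtain ⟨h₂, h₃⟩ := CodeAt.append h₂
    simp only [List.length_singleton] at h₂
    refine ⟨2, rfl, hs, ?_⟩
    have a₁ := h₁.reaches (y := s.at (p + 1)) hs hs
      (by simp [Instr.exec, State.at, hi])
    have a₂ := h₂.reaches (s := s) (y := s.at (p + c.size + 3)) hs hs rfl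
    exact a₁.trans a₂

/-! ### Rules of inference for structured programs -/

/-- Started in `s`, the command `c` terminates in a state that satisfies `Q`, and every number
computed has absolute value at most `B`. -/
def Ensures (B : ℤ) (c : Cmd) (s : State) (Q : State → Prop) : Prop :=
  ∃ s', Exec B c s s' ∧ Q s'

section rules

variable {B : ℤ} {s : State} {Q : State → Prop}

/-- These rules are equivalences so that `simp` can use them to execute a block symbolically,
leaving only overflow bounds and the postcondition. -/
theorem ensures_const {i : ℕ} {z : ℤ} : Ensures B (.const i z) s Q ↔
    |z| ≤ B ∧ Q ⟨Function.update s.reg i z, s.mem, s.clock + 1⟩ :=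
  ⟨fun ⟨_, h, hQ⟩ => by cases h with | const _ _ _ h => exact ⟨h, hQ⟩,
    fun h => ⟨_, .const i z s h.1, h.2⟩⟩

theorem ensures_add {i j l : ℕ} : Ensures B (.add i j l) s Q ↔
    |s.reg j + s.reg l| ≤ B ∧
      Q ⟨Function.update s.reg i (s.reg j + s.reg l), s.mem, s.clock + 1⟩ :=
  ⟨fun ⟨_, h, hQ⟩ => by cases h with | add _ _ _ _ h => exact ⟨h, hQ⟩,
    fun h => ⟨_, .add i j l s h.1, h.2⟩⟩

theorem ensures_sub {i j l : ℕ} : Ensures B (.sub i j l) s Q ↔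
    |s.reg j - s.reg l| ≤ B ∧
      Q ⟨Function.update s.reg i (s.reg j - s.reg l), s.mem, s.clock + 1⟩ :=
  ⟨fun ⟨_, h, hQ⟩ => by cases h with | sub _ _ _ _ h => exact ⟨h, hQ⟩,
    fun h => ⟨_, .sub i j l s h.1, h.2⟩⟩

theorem ensures_load {i j : ℕ} : Ensures B (.load i j) s Q ↔
    Q ⟨Function.update s.reg i (s.mem (s.reg j).toNat), s.mem, s.clock + 1⟩ :=
  ⟨fun ⟨_, h, hQ⟩ => by cases h; exact hQ, fun h => ⟨_, .load i j s, h⟩⟩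

theorem ensures_store {i j : ℕ} : Ensures B (.store i j) s Q ↔
    Q ⟨s.reg, Function.update s.mem (s.reg i).toNat (s.reg j), s.clock + 1⟩ :=
  ⟨fun ⟨_, h, hQ⟩ => by cases h; exact hQ, fun h => ⟨_, .store i j s, h⟩⟩

theorem ensures_skip : Ensures B .skip s Q ↔ Q s :=
  ⟨fun ⟨_, h, hQ⟩ => by cases h; exact hQ, fun h => ⟨_, .skip s, h⟩⟩

theorem ensures_seq {c₁ c₂ : Cmd} : Ensures B (.seq c₁ c₂) s Q ↔
    Ensures B c₁ s (fun s' => Ensures B c₂ s' Q) := by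
  constructor
  · rintro ⟨s', h, hQ⟩
    cases h with | seq h₁ h₂ => exact ⟨_, h₁, _, h₂, hQ⟩
  · rintro ⟨s₁, h₁, s₂, h₂, hQ⟩
    exact ⟨s₂, .seq h₁ h₂, hQ⟩

theorem ensures_block_nil : Ensures B (.block []) s Q ↔ Q s := ensures_skip

theorem ensures_block_cons {c : Cmd} {cs : List Cmd} : Ensures B (.block (c :: cs)) s Q ↔
    Ensures B c s (fun s' => Ensures B (.block cs) s' Q) := ensures_seq

theorem ensures_ite {i : ℕ} {c₁ c₂ : Cmd} : Ensures B (.ite i c₁ c₂) s Q ↔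
    (0 < s.reg i → Ensures B c₁ ⟨s.reg, s.mem, s.clock + 1⟩ Q) ∧
    (¬ 0 < s.reg i → Ensures B c₂ ⟨s.reg, s.mem, s.clock + 2⟩ Q) := by
  constructor
  · rintro ⟨s', h, hQ⟩
    cases h with
    | ite_pos hi h => exact ⟨fun _ => ⟨s', h, hQ⟩, fun hi' => absurd hi hi'⟩
    | ite_neg hi h => exact ⟨fun hi' => absurd hi' hi, fun _ => ⟨s', h, hQ⟩⟩
  · rintro ⟨h₁, h₂⟩
    by_cases hi : 0 < s.reg i
    · obtain ⟨s', h, hQ⟩ := h₁ hi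
      exact ⟨s', .ite_pos hi h, hQ⟩
    · obtain ⟨s', h, hQ⟩ := h₂ hi
      exact ⟨s', .ite_neg hi h, hQ⟩

/-- Besides weakening, this hands the frame condition to the continuation, so specifications need
not mention untouched registers. -/
theorem Ensures.mono {c : Cmd} {Q' : State → Prop} (h : Ensures B c s Q)
    (hQ : ∀ s', (∀ r ∉ c.writes, s'.reg r = s.reg r) → Q s' → Q' s') : Ensures B c s Q' := by
  obtain ⟨s', h, h'⟩ := h
  exact ⟨s', h, hQ s' h.frame h'⟩

/-- The rule for a loop that is executed exactly `m` times. -/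
theorem ensures_loop {i : ℕ} {c : Cmd} (Inv : ℕ → State → Prop) (m : ℕ)
    (hpos : ∀ k s', (∀ r ∉ c.writes, s'.reg r = s.reg r) → Inv (k + 1) s' →
      0 < s'.reg i ∧ Ensures B c ⟨s'.reg, s'.mem, s'.clock + 2⟩ (Inv k))
    (hzero : ∀ s', (∀ r ∉ c.writes, s'.reg r = s.reg r) → Inv 0 s' →
      ¬ 0 < s'.reg i ∧ Q ⟨s'.reg, s'.mem, s'.clock + 2⟩)
    (hs : Inv m s) : Ensures B (.loop i c) s Q := by
  have key : ∀ m s', (∀ r ∉ c.writes, s'.reg r = s.reg r) → Inv m s' →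
      Ensures B (.loop i c) s' Q := by
    intro m
    induction m with
    | zero =>
      intro s' hf h
      exact ⟨_, .loop_neg (hzero s' hf h).1, (hzero s' hf h).2⟩
    | succ k ih =>
      intro s' hf h
      obtain ⟨hi, s₁, h₁, hk⟩ := hpos k s' hf h
      obtain ⟨s₂, h₂, hQ⟩ := ih s₁ (fun r hr => by rw [h₁.frame r hr]; exact hf r hr) hk
      exact ⟨s₂, .loop_pos hi h₁ h₂, hQ⟩
  exact key m s (fun _ _ => rfl) hs

end rules

/-- A structured program, compiled and run on `x`, decides `A`. -/
theorem DecidesWithin.of_ensures {c : Cmd} {x : List ℤ} {A : Prop} {T B : ℕ}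
    (hx : ∀ a, |x.getD a 0| ≤ (B : ℤ))
    (h : Ensures B c ⟨fun _ => 0, fun a => x.getD a 0, 0⟩ fun s =>
      s.clock ≤ T ∧ (A → s.reg 0 = 1) ∧ (¬ A → s.reg 0 = 0)) :
    DecidesWithin (c.code 0) x A T B := by
  obtain ⟨s, h, hT, h₁, h₂⟩ := h
  have hb : Bounded B (fun _ => 0) (fun a => x.getD a 0) := fun a => ⟨by simp, hx a⟩
  obtain ⟨t, ht, -, hr, hbd⟩ := h.reaches (c.code 0) 0 ⟨[], [], by simp, rfl⟩ hb
  simp only [zero_add] at ht hr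
  have e : run (c.code 0) x t = s.at c.size := hr
  refine ⟨t, by omega, ?_, ?_, ?_, hbd⟩
  · rw [e, Cmd.length_code]; exact le_rfl
  · rw [e]; exact h₁
  · rw [e]; exact h₂

end RAM

namespace Gerrymandering

/-! ### Partitions with a distinguished part -/

section Splits

variable {V : Type*} [DecidableEq V] {G : SimpleGraph V} {b : V → ℤ} {M : ℤ}

/-- `O` and the members of `Q` are the parts of a partition of `X` into connected parts. -/
structure IsSplit (G : SimpleGraph V) (X O : Finset V) (Q : Finset (Finset V)) : Prop where
  conn_open : (G.induce (O : Set V)).Connected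
  conn : ∀ A ∈ Q, (G.induce (A : Set V)).Connected
  disj_open : ∀ A ∈ Q, Disjoint O A
  disj : ∀ A ∈ Q, ∀ A' ∈ Q, A ≠ A' → Disjoint A A'
  cover : ∀ a, a ∈ X ↔ a ∈ O ∨ ∃ A ∈ Q, a ∈ A

/-- The number of members of `Q` with positive sum. -/
def wins (b : V → ℤ) (Q : Finset (Finset V)) : ℕ :=
  (Q.filter fun A => 0 < ∑ v ∈ A, b v).card

/-- `x = M * (w + 1) + s` for some partition of `X` into connected parts, where `s` is the sum
over the part that contains `v`, there are `j` other parts, and `w` of them have positive sum. -/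
def IsValue (G : SimpleGraph V) (b : V → ℤ) (M : ℤ) (X : Finset V) (v : V) (j : ℕ) (x : ℤ) :
    Prop :=
  ∃ O Q, IsSplit G X O Q ∧ v ∈ O ∧ Q.card = j ∧ x = M * (wins b Q + 1) + ∑ v ∈ O, b v

/-! ### Rounding up, and the encoding of values -/

/-- The quotient `x / M`, rounded up. -/
def ceilDiv (M x : ℤ) : ℤ := -((-x) / M)

/-- The Galois connection between rounding up and multiplication by `M`; the other properties of
`ceilDiv` follow from it. -/
theorem ceilDiv_le_iff (hM : 0 < M) {x c : ℤ} : ceilDiv M x ≤ c ↔ x ≤ M * c := by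
  unfold ceilDiv
  rw [neg_le, Int.le_ediv_iff_mul_le hM]
  constructor <;> intro h <;> linarith

theorem le_mul_ceilDiv (hM : 0 < M) (x : ℤ) : x ≤ M * ceilDiv M x :=
  (ceilDiv_le_iff hM).1 le_rfl

theorem ceilDiv_mono (hM : 0 < M) {x y : ℤ} (h : x ≤ y) : ceilDiv M x ≤ ceilDiv M y :=
  (ceilDiv_le_iff hM).2 (h.trans (le_mul_ceilDiv hM y))

theorem ceilDiv_zero : ceilDiv M 0 = 0 := by simp [ceilDiv]

theorem ceilDiv_eq (hM : 0 < M) {x c : ℤ} (h₁ : M * (c - 1) < x) (h₂ : x ≤ M * c) :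
    ceilDiv M x = c := by
  refine le_antisymm ((ceilDiv_le_iff hM).2 h₂) ?_
  by_contra! h
  have := (ceilDiv_le_iff hM).1 (Int.le_sub_one_of_lt h)
  linarith

/-- The value lies strictly between `M * w` and `M * (w + 2)`, so rounding up only detects the sign
of `s`. This is the number of winning parts after the open part is closed, plus one. -/
theorem ceilDiv_value {s : ℤ} (hs : |s| < M) (w : ℤ) :
    ceilDiv M (M * (w + 1) + s) = w + 1 + if 0 < s then 1 else 0 := by
  obtain ⟨h₁, h₂⟩ := abs_lt.1 hs
  split_ifs with h
  · exact ceilDiv_eq (by linarith) (by linarith) (by linarith)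
  · exact ceilDiv_eq (by linarith) (by linarith) (by linarith)

theorem wins_le_card (Q : Finset (Finset V)) : wins b Q ≤ Q.card := Finset.card_filter_le _ _

theorem wins_union {Q Q' : Finset (Finset V)} (h : Disjoint Q Q') :
    wins b (Q ∪ Q') = wins b Q + wins b Q' := by
  rw [wins, Finset.filter_union, Finset.card_union_of_disjoint (Finset.disjoint_filter_filter h)]
  rfl

theorem wins_insert {Q : Finset (Finset V)} {A : Finset V} (h : A ∉ Q) :
    wins b (insert A Q) = wins b Q + if 0 < ∑ v ∈ A, b v then 1 else 0 := by
  rw [wins, Finset.filter_insert]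
  split_ifs
  · rw [Finset.card_insert_of_notMem (by simp [h])]; rfl
  · rfl

/-- The offset `+ 1` in the encoding serves this purpose: `0` is never a value and can stand for a
missing one. -/
theorem IsValue.pos (hM : ∀ A : Finset V, |∑ v ∈ A, b v| < M) {X : Finset V} {v : V} {j : ℕ}
    {x : ℤ} (h : IsValue G b M X v j x) : 0 < x := by
  obtain ⟨O, Q, -, -, -, rfl⟩ := h
  have h₁ := abs_lt.1 (hM O)
  have : 0 ≤ M * (wins b Q : ℤ) := mul_nonneg (by linarith) (by positivity)
  linarith

/-- Controls both the size of the table entries and the number of additions needed to round them. -/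
theorem IsValue.le (hM : ∀ A : Finset V, |∑ v ∈ A, b v| < M) {X : Finset V} {v : V} {j : ℕ}
    {x : ℤ} (h : IsValue G b M X v j x) : x ≤ M * (j + 2) := by
  obtain ⟨O, Q, -, -, rfl, rfl⟩ := h
  have h₁ := abs_lt.1 (hM O)
  have : M * (wins b Q : ℤ) ≤ M * (Q.card : ℤ) :=
    mul_le_mul_of_nonneg_left (by exact_mod_cast wins_le_card Q) (by linarith)
  linarith

theorem IsSplit.nonempty {X O : Finset V} {Q : Finset (Finset V)} (h : IsSplit G X O Q)
    {A : Finset V} (hA : A ∈ Q) : A.Nonempty := by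
  obtain ⟨⟨a, ha⟩⟩ := (h.conn A hA).nonempty
  exact ⟨a, ha⟩

theorem IsSplit.open_subset {X O : Finset V} {Q : Finset (Finset V)} (h : IsSplit G X O Q) :
    O ⊆ X := fun a ha => (h.cover a).2 (.inl ha)

theorem IsSplit.subset {X O : Finset V} {Q : Finset (Finset V)} (h : IsSplit G X O Q)
    {A : Finset V} (hA : A ∈ Q) : A ⊆ X := fun a ha => (h.cover a).2 (.inr ⟨A, hA, ha⟩)

theorem IsSplit.open_notMem {X O : Finset V} {Q : Finset (Finset V)} (h : IsSplit G X O Q) :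
    O ∉ Q := by
  intro hO
  obtain ⟨a, ha⟩ := h.nonempty hO
  exact Finset.disjoint_left.1 (h.disj_open O hO) ha ha

/-- A bag with a single vertex has exactly one split. -/
theorem isValue_singleton_iff {v : V} {j : ℕ} {x : ℤ} :
    IsValue G b M {v} v j x ↔ j = 0 ∧ x = M + b v := by
  constructor
  · rintro ⟨O, Q, h, hv, rfl, rfl⟩
    have hO : O = {v} := Finset.Subset.antisymm h.open_subset (by simpa using hv)
    have hQ : Q = ∅ := by
      refine Finset.eq_empty_of_forall_notMem fun A hA => ?_
      obtain ⟨a, ha⟩ := h.nonempty hA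
      have := Finset.mem_singleton.1 (h.subset hA ha)
      subst this
      exact Finset.disjoint_left.1 (h.disj_open A hA) hv ha
    subst hO hQ
    simp [wins]
  · rintro ⟨rfl, rfl⟩
    refine ⟨{v}, ∅, ⟨?_, by simp, by simp, by simp, by simp⟩, by simp, rfl, by simp [wins]⟩
    rw [Finset.coe_singleton, SimpleGraph.induce_singleton_eq_top]
    exact SimpleGraph.connected_top

/-! ### Two bags joined by one edge -/

/-- `X` and `Y` are disjoint, and `u v` is the only edge from `X` to `Y`. -/
structure IsJoin (G : SimpleGraph V) (X Y : Finset V) (u v : V) : Prop where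
  disj : Disjoint X Y
  left : u ∈ X
  right : v ∈ Y
  adj : G.Adj u v
  cross : ∀ x ∈ X, ∀ y ∈ Y, G.Adj x y → x = u ∧ y = v

theorem IsJoin.symm {X Y : Finset V} {u v : V} (h : IsJoin G X Y u v) : IsJoin G Y X v u :=
  ⟨h.disj.symm, h.right, h.left, h.adj.symm,
    fun x hx y hy hxy => (h.cross y hy x hx hxy.symm).symm⟩

/-- A connected set meeting both sides contains a walk from one to the other, and such a walk can
only cross along `u v`. -/
theorem IsJoin.subset_or_subset {X Y A : Finset V} {u v : V} (h : IsJoin G X Y u v)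
    (hA : (G.induce (A : Set V)).Connected) (hAXY : A ⊆ X ∪ Y) (hn : ¬ (u ∈ A ∧ v ∈ A)) :
    A ⊆ X ∨ A ⊆ Y := by
  by_contra! hc
  obtain ⟨⟨y, hyA, hyX⟩, ⟨x, hxA, hxY⟩⟩ :=
    And.intro (Finset.not_subset.1 hc.1) (Finset.not_subset.1 hc.2)
  have hxX : x ∈ X := (Finset.mem_union.1 (hAXY hxA)).resolve_right hxY
  obtain ⟨p⟩ := hA.preconnected ⟨x, hxA⟩ ⟨y, hyA⟩
  obtain ⟨d, -, h₁, h₂⟩ := p.exists_boundary_dart {a | a.1 ∈ X} hxX hyX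
  have h₃ : d.snd.1 ∈ Y := (Finset.mem_union.1 (hAXY d.snd.2)).resolve_left h₂
  obtain ⟨hu, hv⟩ := h.cross _ h₁ _ h₃ d.adj
  exact hn ⟨hu ▸ d.fst.2, hv ▸ d.snd.2⟩

/-- Follow a walk in `A` towards `u`: before it can leave `X` it has to be at `u` already. -/
theorem IsJoin.connected_inter {X Y A : Finset V} {u v : V} (h : IsJoin G X Y u v)
    (hA : (G.induce (A : Set V)).Connected) (hAXY : A ⊆ X ∪ Y) (hu : u ∈ A) :
    (G.induce ((A ∩ X : Finset V) : Set V)).Connected := by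
  have huX : u ∈ A ∩ X := Finset.mem_inter.2 ⟨hu, h.left⟩
  rw [SimpleGraph.connected_iff_exists_forall_reachable]
  refine ⟨⟨u, huX⟩, ?_⟩
  have key : ∀ p q : (A : Set V), (G.induce (A : Set V)).Walk p q → q.1 = u →
      ∀ hp : p.1 ∈ A ∩ X,
        (G.induce ((A ∩ X : Finset V) : Set V)).Reachable ⟨p.1, hp⟩ ⟨u, huX⟩ := by
    intro p q w
    induction w with
    | nil =>
      rintro rfl hp
      exact SimpleGraph.Reachable.refl _
    | @cons p p' q hadj w ih =>
      intro hq hp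
      by_cases hX : p'.1 ∈ X
      · have hp' : p'.1 ∈ A ∩ X := Finset.mem_inter.2 ⟨p'.2, hX⟩
        refine SimpleGraph.Reachable.trans (SimpleGraph.Adj.reachable ?_) (ih hq hp')
        exact hadj
      -- The step leaves `X`, so it starts at `u` and the goal has been reached.
      · have hY : p'.1 ∈ Y := (Finset.mem_union.1 (hAXY p'.2)).resolve_left hX
        obtain ⟨hpu, -⟩ := h.cross _ (Finset.mem_inter.1 hp).2 _ hY hadj
        simp only [hpu]
        exact SimpleGraph.Reachable.refl _
  rintro ⟨a, ha⟩
  obtain ⟨w⟩ := hA.preconnected ⟨a, (Finset.mem_inter.1 ha).1⟩ ⟨u, hu⟩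
  exact (key _ _ w rfl ha).symm

/-- A value of the bag `X`, attached to a neighbor of `u`: the part of `u` is either extended to
the neighbor, or closed. -/
def IsAttached (G : SimpleGraph V) (b : V → ℤ) (M : ℤ) (X : Finset V) (u : V) (i : ℕ) (e : ℤ) :
    Prop :=
  IsValue G b M X u i e ∨ ∃ i' y, i = i' + 1 ∧ IsValue G b M X u i' y ∧ e = M * ceilDiv M y

/-! ### The recurrence for a union of two bags -/

theorem IsJoin.disjoint_of_splits {X Y O O' : Finset V} {Q Q' : Finset (Finset V)} {u v : V}
    (h : IsJoin G X Y u v) (hX : IsSplit G X O Q) (hY : IsSplit G Y O' Q') : Disjoint Q Q' := by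
  refine Finset.disjoint_left.2 fun A hA hA' => ?_
  obtain ⟨a, ha⟩ := hX.nonempty hA
  exact Finset.disjoint_left.1 h.disj (hX.subset hA ha) (hY.subset hA' ha)

/-- The closed parts that lie inside `X`, for a split of `X ∪ Y` in which no closed part
crosses. -/
theorem IsSplit.filter_subset {X Y O O' : Finset V} {Q : Finset (Finset V)} {Q' : Finset (Finset V)}
    (h : IsSplit G (X ∪ Y) O Q) (hXY : Disjoint X Y)
    (hpure : ∀ A ∈ Q', A ⊆ X ∨ A ⊆ Y) (hQ : Q' ⊆ Q)
    (hO' : (G.induce (O' : Set V)).Connected) (hd : ∀ A ∈ Q', Disjoint O' A)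
    (hsub : O' ⊆ X) (hcov : ∀ a ∈ X, a ∈ O' ∨ ∃ A ∈ Q', a ∈ A) :
    IsSplit G X O' (Q'.filter (· ⊆ X)) where
  conn_open := hO'
  conn A hA := h.conn A (hQ (Finset.mem_filter.1 hA).1)
  disj_open A hA := hd A (Finset.mem_filter.1 hA).1
  disj A hA A' hA' := h.disj A (hQ (Finset.mem_filter.1 hA).1) A' (hQ (Finset.mem_filter.1 hA').1)
  cover a := by
    constructor
    · intro ha
      refine (hcov a ha).imp_right ?_
      rintro ⟨A, hA, haA⟩
      refine ⟨A, Finset.mem_filter.2 ⟨hA, (hpure A hA).resolve_right fun hAY => ?_⟩, haA⟩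
      exact Finset.disjoint_left.1 hXY ha (hAY haA)
    · rintro (ha | ⟨A, hA, haA⟩)
      · exact hsub ha
      · exact (Finset.mem_filter.1 hA).2 haA

theorem filter_subset_union {X Y : Finset V} {Q : Finset (Finset V)}
    (hpure : ∀ A ∈ Q, A ⊆ X ∨ A ⊆ Y) : Q.filter (· ⊆ Y) ∪ Q.filter (· ⊆ X) = Q := by
  ext A
  simp only [Finset.mem_union, Finset.mem_filter]
  constructor
  · rintro (h | h) <;> exact h.1
  · intro hA
    exact (hpure A hA).symm.imp (fun h => ⟨hA, h⟩) (fun h => ⟨hA, h⟩)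

/-- The two open parts are united through the edge `u v`. Win counts and open sums add; `- M`
removes the offset that is counted twice. -/
theorem IsJoin.isValue_union_of_isValue {X Y : Finset V} {u v : V} (h : IsJoin G X Y u v)
    {i i' : ℕ} {a e : ℤ} (ha : IsValue G b M Y v i' a) (he : IsValue G b M X u i e) :
    IsValue G b M (X ∪ Y) v (i' + i) (a + e - M) := by
  obtain ⟨O', Q', hs', hv, rfl, rfl⟩ := ha
  obtain ⟨O, Q, hs, hu, rfl, rfl⟩ := he
  have hQ := (h.disjoint_of_splits hs hs').symm
  have hO : Disjoint O' O := (Finset.disjoint_of_subset_left hs.open_subset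
    (Finset.disjoint_of_subset_right hs'.open_subset h.disj)).symm
  have d₁ : ∀ A ∈ Q, Disjoint O' A := fun A hA => (Finset.disjoint_of_subset_left (hs.subset hA)
    (Finset.disjoint_of_subset_right hs'.open_subset h.disj)).symm
  have d₂ : ∀ A ∈ Q', Disjoint O A := fun A hA => Finset.disjoint_of_subset_left hs.open_subset
    (Finset.disjoint_of_subset_right (hs'.subset hA) h.disj)
  have d₃ : ∀ A ∈ Q, ∀ A' ∈ Q', Disjoint A A' := fun A hA A' hA' =>
    Finset.disjoint_of_subset_left (hs.subset hA)
      (Finset.disjoint_of_subset_right (hs'.subset hA') h.disj)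
  refine ⟨O' ∪ O, Q' ∪ Q, ⟨?_, ?_, ?_, ?_, ?_⟩, by simp [hv],
    Finset.card_union_of_disjoint hQ, ?_⟩
  · rw [Finset.coe_union]
    exact SimpleGraph.connected_induce_union hs'.conn_open.preconnected
      hs.conn_open.preconnected (v := v) (w := u) hv hu h.adj.symm
  · intro A hA
    exact (Finset.mem_union.1 hA).elim (hs'.conn A) (hs.conn A)
  · intro A hA
    rw [Finset.disjoint_union_left]
    rcases Finset.mem_union.1 hA with hA | hA
    · exact ⟨hs'.disj_open A hA, d₂ A hA⟩
    · exact ⟨d₁ A hA, hs.disj_open A hA⟩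
  · intro A hA A' hA' hne
    rcases Finset.mem_union.1 hA with hA | hA <;> rcases Finset.mem_union.1 hA' with hA' | hA'
    · exact hs'.disj A hA A' hA' hne
    · exact (d₃ A' hA' A hA).symm
    · exact d₃ A hA A' hA'
    · exact hs.disj A hA A' hA' hne
  · intro a
    simp only [Finset.mem_union, hs.cover, hs'.cover, or_and_right, exists_or]
    generalize (∃ A ∈ Q, a ∈ A) = p, (∃ A ∈ Q', a ∈ A) = q
    tauto
  · rw [wins_union hQ, Finset.sum_union hO]
    push_cast
    ring

/-- The open part of `X` becomes one more closed part. Its win is already contained in the rounded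
value, whose open sum is zero. -/
theorem IsJoin.isValue_union_of_closed (hM : ∀ A : Finset V, |∑ v ∈ A, b v| < M)
    {X Y : Finset V} {u v : V} (h : IsJoin G X Y u v)
    {i i' : ℕ} {a y : ℤ} (ha : IsValue G b M Y v i' a) (he : IsValue G b M X u i y) :
    IsValue G b M (X ∪ Y) v (i' + (i + 1)) (a + M * ceilDiv M y - M) := by
  obtain ⟨O', Q', hs', hv, rfl, rfl⟩ := ha
  obtain ⟨O, Q, hs, hu, rfl, rfl⟩ := he
  have hQ := (h.disjoint_of_splits hs hs').symm
  have hO : Disjoint O' O := (Finset.disjoint_of_subset_left hs.open_subset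
    (Finset.disjoint_of_subset_right hs'.open_subset h.disj)).symm
  have d₁ : ∀ A ∈ Q, Disjoint O' A := fun A hA => (Finset.disjoint_of_subset_left (hs.subset hA)
    (Finset.disjoint_of_subset_right hs'.open_subset h.disj)).symm
  have d₂ : ∀ A ∈ Q', Disjoint O A := fun A hA => Finset.disjoint_of_subset_left hs.open_subset
    (Finset.disjoint_of_subset_right (hs'.subset hA) h.disj)
  have d₃ : ∀ A ∈ Q, ∀ A' ∈ Q', Disjoint A A' := fun A hA A' hA' =>
    Finset.disjoint_of_subset_left (hs.subset hA)
      (Finset.disjoint_of_subset_right (hs'.subset hA') h.disj)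
  have hOQ' : O ∉ Q' := fun hO => Finset.disjoint_left.1 (d₂ O hO) hu hu
  have hQ₂ : Disjoint Q' (insert O Q) := Finset.disjoint_insert_right.2 ⟨hOQ', hQ⟩
  refine ⟨O', Q' ∪ insert O Q, ⟨hs'.conn_open, ?_, ?_, ?_, ?_⟩, hv, ?_, ?_⟩
  · intro A hA
    rcases Finset.mem_union.1 hA with hA | hA
    · exact hs'.conn A hA
    · rcases Finset.mem_insert.1 hA with rfl | hA
      · exact hs.conn_open
      · exact hs.conn A hA
  · intro A hA
    rcases Finset.mem_union.1 hA with hA | hA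
    · exact hs'.disj_open A hA
    · rcases Finset.mem_insert.1 hA with rfl | hA
      · exact hO
      · exact d₁ A hA
  · intro A hA A' hA' hne
    simp only [Finset.mem_union, Finset.mem_insert] at hA hA'
    rcases hA with hA | rfl | hA <;> rcases hA' with hA' | rfl | hA'
    · exact hs'.disj A hA A' hA' hne
    · exact (d₂ A hA).symm
    · exact (d₃ A' hA' A hA).symm
    · exact d₂ A' hA'
    · exact absurd rfl hne
    · exact hs.disj_open A' hA'
    · exact d₃ A hA A' hA'
    · exact (hs.disj_open A hA).symm
    · exact hs.disj A hA A' hA' hne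
  · intro a
    simp only [Finset.mem_union, Finset.mem_insert, hs.cover, hs'.cover, or_and_right, exists_or,
      exists_eq_left]
    generalize (∃ A ∈ Q, a ∈ A) = p, (∃ A ∈ Q', a ∈ A) = q
    tauto
  · rw [Finset.card_union_of_disjoint hQ₂, Finset.card_insert_of_notMem hs.open_notMem]
  · rw [wins_union hQ₂, wins_insert hs.open_notMem, ceilDiv_value (hM O)]
    push_cast
    split_ifs <;> ring

/-- No closed part contains `v`, so every closed part lies on one side. Only the open part can
cross, and it does so exactly if it contains `u`. -/
theorem IsJoin.exists_of_isValue_union (hM : ∀ A : Finset V, |∑ v ∈ A, b v| < M)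
    {X Y : Finset V} {u v : V} (h : IsJoin G X Y u v) {j : ℕ} {x : ℤ}
    (hx : IsValue G b M (X ∪ Y) v j x) :
    ∃ i' i a e, i' + i = j ∧ IsValue G b M Y v i' a ∧ IsAttached G b M X u i e ∧
      x = a + e - M := by
  obtain ⟨O, Q, hs, hv, rfl, rfl⟩ := hx
  have hvQ : ∀ A ∈ Q, v ∉ A := fun A hA => Finset.disjoint_left.1 (hs.disj_open A hA) hv
  have pure₀ : ∀ A ∈ Q, A ⊆ X ∨ A ⊆ Y := fun A hA =>
    h.subset_or_subset (hs.conn A hA) (hs.subset hA) fun hc => hvQ A hA hc.2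
  have pure₁ : ∀ A ∈ Q, A ⊆ Y ∨ A ⊆ X := fun A hA => (pure₀ A hA).symm
  have hs' : IsSplit G (Y ∪ X) O Q := by rwa [Finset.union_comm]
  -- If `u` is in the open part, that part is cut along `u v`; otherwise the closed part containing
  -- `u` becomes the open part of `X`.
  by_cases hu : u ∈ O
  · have hX : IsSplit G X (O ∩ X) (Q.filter (· ⊆ X)) := by
      refine hs.filter_subset h.disj pure₀ (Finset.Subset.refl _)
        (h.connected_inter hs.conn_open hs.open_subset hu) (fun A hA =>
          Finset.disjoint_of_subset_left Finset.inter_subset_left (hs.disj_open A hA))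
        Finset.inter_subset_right fun a ha => ?_
      exact ((hs.cover a).1 (Finset.mem_union_left _ ha)).imp_left
        fun h => Finset.mem_inter.2 ⟨h, ha⟩
    have hY : IsSplit G Y (O ∩ Y) (Q.filter (· ⊆ Y)) := by
      refine hs'.filter_subset h.disj.symm pure₁ (Finset.Subset.refl _)
        (h.symm.connected_inter hs.conn_open hs'.open_subset hv) (fun A hA =>
          Finset.disjoint_of_subset_left Finset.inter_subset_left (hs.disj_open A hA))
        Finset.inter_subset_right fun a ha => ?_
      exact ((hs.cover a).1 (Finset.mem_union_right _ ha)).imp_left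
        fun h => Finset.mem_inter.2 ⟨h, ha⟩
    have hQ := (h.disjoint_of_splits hX hY).symm
    have eQ := filter_subset_union pure₀
    refine ⟨_, _, _, _, ?_, ⟨_, _, hY, Finset.mem_inter.2 ⟨hv, h.right⟩, rfl, rfl⟩,
      .inl ⟨_, _, hX, Finset.mem_inter.2 ⟨hu, h.left⟩, rfl, rfl⟩, ?_⟩
    · rw [← Finset.card_union_of_disjoint hQ, eQ]
    · have eO : O = O ∩ Y ∪ O ∩ X := by
        rw [← Finset.inter_union_distrib_left, Finset.inter_eq_left.2 hs'.open_subset]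
      have dO : Disjoint (O ∩ Y) (O ∩ X) := (Finset.disjoint_of_subset_left
        Finset.inter_subset_right (Finset.disjoint_of_subset_right
          Finset.inter_subset_right h.disj)).symm
      conv_lhs => rw [← eQ, eO, wins_union hQ, Finset.sum_union dO]
      push_cast
      ring
  · obtain ⟨O', hO'Q, huO'⟩ : ∃ A ∈ Q, u ∈ A :=
      ((hs.cover u).1 (Finset.mem_union_left _ h.left)).resolve_left hu
    have hOY : O ⊆ Y := (h.subset_or_subset hs.conn_open hs.open_subset
      fun hc => hu hc.1).resolve_left fun hc =>
        Finset.disjoint_left.1 h.disj (hc hv) h.right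
    have hO'X : O' ⊆ X := (pure₀ O' hO'Q).resolve_right fun hc =>
      Finset.disjoint_left.1 h.disj h.left (hc huO')
    have pure₂ : ∀ A ∈ Q.erase O', A ⊆ X ∨ A ⊆ Y := fun A hA =>
      pure₀ A (Finset.mem_of_mem_erase hA)
    have hX : IsSplit G X O' ((Q.erase O').filter (· ⊆ X)) := by
      refine hs.filter_subset h.disj pure₂ (Finset.erase_subset _ _) (hs.conn O' hO'Q)
        (fun A hA => hs.disj O' hO'Q A (Finset.mem_of_mem_erase hA)
          (Finset.ne_of_mem_erase hA).symm) hO'X fun a ha => ?_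
      rcases (hs.cover a).1 (Finset.mem_union_left _ ha) with hc | ⟨A, hA, haA⟩
      · exact absurd (hOY hc) (Finset.disjoint_left.1 h.disj ha)
      · by_cases hAO : A = O'
        · exact .inl (hAO ▸ haA)
        · exact .inr ⟨A, Finset.mem_erase.2 ⟨hAO, hA⟩, haA⟩
    have hY : IsSplit G Y O ((Q.erase O').filter (· ⊆ Y)) := by
      refine hs'.filter_subset h.disj.symm (fun A hA => (pure₂ A hA).symm)
        (Finset.erase_subset _ _) hs.conn_open
        (fun A hA => hs.disj_open A (Finset.mem_of_mem_erase hA)) hOY fun a ha => ?_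
      refine ((hs.cover a).1 (Finset.mem_union_right _ ha)).imp_right ?_
      rintro ⟨A, hA, haA⟩
      refine ⟨A, Finset.mem_erase.2 ⟨?_, hA⟩, haA⟩
      rintro rfl
      exact Finset.disjoint_left.1 h.disj (hO'X haA) ha
    have hQ := (h.disjoint_of_splits hX hY).symm
    have eQ := filter_subset_union pure₂
    refine ⟨_, _, _, _, ?_, ⟨_, _, hY, hv, rfl, rfl⟩,
      .inr ⟨_, _, rfl, ⟨_, _, hX, huO', rfl, rfl⟩, rfl⟩, ?_⟩
    · rw [← add_assoc, ← Finset.card_union_of_disjoint hQ, eQ, Finset.card_erase_add_one hO'Q]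
    · rw [ceilDiv_value (hM O')]
      have e : wins b Q = wins b ((Q.erase O').filter (· ⊆ Y)) +
          wins b ((Q.erase O').filter (· ⊆ X)) + if 0 < ∑ v ∈ O', b v then 1 else 0 := by
        rw [← wins_union hQ, eQ, ← wins_insert (Finset.notMem_erase _ _),
          Finset.insert_erase hO'Q]
      rw [e]
      push_cast
      split_ifs <;> ring

theorem IsJoin.isValue_union_iff (hM : ∀ A : Finset V, |∑ v ∈ A, b v| < M)
    {X Y : Finset V} {u v : V} (h : IsJoin G X Y u v) {j : ℕ} {x : ℤ} :
    IsValue G b M (X ∪ Y) v j x ↔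
    ∃ i' i a e, i' + i = j ∧ IsValue G b M Y v i' a ∧ IsAttached G b M X u i e ∧
      x = a + e - M := by
  refine ⟨h.exists_of_isValue_union hM, ?_⟩
  rintro ⟨i', i, a, e, rfl, ha, he | ⟨i₀, y, rfl, he, rfl⟩, rfl⟩
  · exact h.isValue_union_of_isValue ha he
  · exact h.isValue_union_of_closed hM ha he

end Splits

/-! ### Tables of optimal values -/

/-- `c` is the maximum of `P`, or `0` if `P` is empty. -/
def Represents (P : ℤ → Prop) (c : ℤ) : Prop :=
  (∀ x, P x → x ≤ c) ∧ (c = 0 ∨ P c)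

/-- From the optimal values of a bag to those of the bag attached to a neighbor. -/
def attachTab (M : ℤ) (f : ℕ → ℤ) (i : ℕ) : ℤ :=
  if i = 0 then f 0 else max (f i) (M * ceilDiv M (f (i - 1)))

/-- The maximum of `0` and the sums `f i + g (j - i) - M` with `i < m`, where zero entries are
left out. -/
def convTo (M : ℤ) (f g : ℕ → ℤ) (j : ℕ) : ℕ → ℤ
  | 0 => 0
  | m + 1 =>
    if 0 < f m ∧ 0 < g (j - m) then max (convTo M f g j m) (f m + g (j - m) - M)
    else convTo M f g j m

/-- The shifted max-plus convolution of two tables. -/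
def convTab (M : ℤ) (f g : ℕ → ℤ) (j : ℕ) : ℤ := convTo M f g j (j + 1)

section Tables

variable {V : Type*} [DecidableEq V] {G : SimpleGraph V} {b : V → ℤ} {M : ℤ}

theorem IsAttached.pos (hM : ∀ A : Finset V, |∑ v ∈ A, b v| < M) {X : Finset V} {u : V} {i : ℕ}
    {e : ℤ} (h : IsAttached G b M X u i e) : 0 < e := by
  have hM₀ : 0 < M := (abs_nonneg _).trans_lt (hM ∅)
  rcases h with h | ⟨i', y, -, h, rfl⟩
  · exact h.pos hM
  · exact (h.pos hM).trans_le (le_mul_ceilDiv hM₀ y)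

/-- Rounding up is monotone, so the best closed value comes from the best open value with one closed
part fewer. -/
theorem represents_attachTab (hM : ∀ A : Finset V, |∑ v ∈ A, b v| < M) {X : Finset V} {u : V}
    {n : ℕ} {f : ℕ → ℤ} (hf : ∀ i < n, Represents (IsValue G b M X u i) (f i)) :
    ∀ i < n, Represents (IsAttached G b M X u i) (attachTab M f i) := by
  have hM₀ : 0 < M := (abs_nonneg _).trans_lt (hM ∅)
  intro i hi
  rcases i with _ | i
  · rw [attachTab, if_pos rfl]
    refine ⟨?_, (hf 0 hi).2.imp_right .inl⟩
    rintro x (hx | ⟨i', y, hc, -⟩)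
    · exact (hf 0 hi).1 x hx
    · omega
  · rw [attachTab, if_neg (by omega), Nat.add_sub_cancel]
    have h₁ := hf (i + 1) hi
    have h₀ := hf i (by omega)
    refine ⟨?_, ?_⟩
    · rintro x (hx | ⟨i', y, hc, hy, rfl⟩)
      · exact le_max_of_le_left (h₁.1 x hx)
      · obtain rfl : i' = i := by omega
        exact le_max_of_le_right
          (mul_le_mul_of_nonneg_left (ceilDiv_mono hM₀ (h₀.1 y hy)) hM₀.le)
    · rcases max_choice (f (i + 1)) (M * ceilDiv M (f i)) with h | h <;> rw [h]
      · exact h₁.2.imp_right .inl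
      -- The default `0` of a missing value rounds to `0` and thus remains the default.
      · refine h₀.2.imp (fun h => by rw [h, ceilDiv_zero, mul_zero]) fun h => ?_
        exact .inr ⟨i, _, rfl, h, rfl⟩

theorem convTo_nonneg (f g : ℕ → ℤ) (j m : ℕ) : 0 ≤ convTo M f g j m := by
  induction m with
  | zero => exact le_rfl
  | succ m ih =>
    rw [convTo]
    split_ifs
    · exact le_max_of_le_left ih
    · exact ih

/-- A sum is maximal when both summands are. Zero entries must be skipped, because a missing value
plus a feasible one could look feasible. -/
theorem IsJoin.represents_convTab (hM : ∀ A : Finset V, |∑ v ∈ A, b v| < M)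
    {X Y : Finset V} {u v : V} (h : IsJoin G X Y u v) {n : ℕ} {f g : ℕ → ℤ}
    (hf : ∀ i < n, Represents (IsValue G b M Y v i) (f i))
    (hg : ∀ i < n, Represents (IsAttached G b M X u i) (g i)) :
    ∀ j < n, Represents (IsValue G b M (X ∪ Y) v j) (convTab M f g j) := by
  intro j hj
  -- Partial maxima: only splits with fewer than `m` closed parts on the side of `v` are considered.
  have key : ∀ m ≤ j + 1, Represents (fun x => ∃ i < m, ∃ a e, IsValue G b M Y v i a ∧
      IsAttached G b M X u (j - i) e ∧ x = a + e - M) (convTo M f g j m) := by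
    intro m hm
    induction m with
    | zero => exact ⟨by simp, .inl rfl⟩
    | succ m ih =>
      obtain ⟨ih₁, ih₂⟩ := ih (by omega)
      have h₁ := hf m (by omega)
      have h₂ := hg (j - m) (by omega)
      rw [convTo]
      split_ifs with hc
      · refine ⟨?_, ?_⟩
        · rintro x ⟨i, hi, a, e, ha, he, rfl⟩
          rcases Nat.lt_succ_iff_lt_or_eq.1 hi with hi | rfl
          · exact le_max_of_le_left (ih₁ _ ⟨i, hi, a, e, ha, he, rfl⟩)
          · have := h₁.1 a ha
            have := h₂.1 e he
            exact le_max_of_le_right (by linarith)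
        · rcases max_choice (convTo M f g j m) (f m + g (j - m) - M) with h | h <;> rw [h]
          · refine ih₂.imp_right ?_
            rintro ⟨i, hi, hr⟩
            exact ⟨i, by omega, hr⟩
          · exact .inr ⟨m, by omega, _, _, h₁.2.resolve_left hc.1.ne',
              h₂.2.resolve_left hc.2.ne', rfl⟩
      · refine ⟨?_, ?_⟩
        · rintro x ⟨i, hi, a, e, ha, he, rfl⟩
          rcases Nat.lt_succ_iff_lt_or_eq.1 hi with hi | rfl
          · exact ih₁ _ ⟨i, hi, a, e, ha, he, rfl⟩
          -- Values are positive, so if either bag had one its entry would be positive; a skipped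
          -- index has no pair of values.
          · exact absurd ⟨(ha.pos hM).trans_le (h₁.1 a ha), (he.pos hM).trans_le (h₂.1 e he)⟩ hc
        · refine ih₂.imp_right ?_
          rintro ⟨i, hi, hr⟩
          exact ⟨i, by omega, hr⟩
  obtain ⟨k₁, k₂⟩ := key (j + 1) le_rfl
  refine ⟨fun x hx => ?_, k₂.imp_right ?_⟩
  · obtain ⟨i', i, a, e, hi, ha, he, rfl⟩ := (h.isValue_union_iff hM).1 hx
    obtain rfl : i = j - i' := by omega
    exact k₁ _ ⟨i', by omega, a, e, ha, he, rfl⟩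
  · rintro ⟨i, hi, a, e, ha, he, hx⟩
    exact (h.isValue_union_iff hM).2 ⟨i, j - i, a, e, by omega, ha, he, hx⟩

/-- The criterion is monotone in the value, so the maximum decides. Positivity of `k` makes the
default `0` fail the test. -/
theorem Represents.exists_ceilDiv_iff (hM : 0 < M) {P : ℤ → Prop} {c : ℤ}
    (h : Represents P c) {k : ℤ} (hk : 0 < k) :
    (∃ x, P x ∧ k + 2 < 2 * ceilDiv M x) ↔ k + 2 < 2 * ceilDiv M c := by
  constructor
  · rintro ⟨x, hx, hkx⟩
    have := ceilDiv_mono hM (h.1 x hx)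
    omega
  · intro hc
    rcases h.2 with rfl | hP
    · rw [ceilDiv_zero] at hc; omega
    · exact ⟨c, hP, hc⟩

theorem Represents.bounds (hM : ∀ A : Finset V, |∑ v ∈ A, b v| < M) {X : Finset V} {v : V}
    {j : ℕ} {c : ℤ} (h : Represents (IsValue G b M X v j) c) : 0 ≤ c ∧ c ≤ M * (j + 2) := by
  have hM₀ : 0 < M := (abs_nonneg _).trans_lt (hM ∅)
  rcases h.2 with rfl | h
  · exact ⟨le_rfl, by positivity⟩
  · exact ⟨(h.pos hM).le, h.le hM⟩

end Tables

/-! ### The question in terms of values -/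

/-- The part of `root` plays the role of the open part, which leaves `k - 1` closed ones. Rounding
its value gives the number of wins plus one, so `k < 2 * wins` becomes `k + 2 < 2 * ceilDiv M x`. -/
theorem exists_partition_iff {V : Type*} [Fintype V] [DecidableEq V] {G : SimpleGraph V}
    {b : V → ℤ} {M : ℤ} (hM : ∀ A : Finset V, |∑ v ∈ A, b v| < M) (root : V) {k : ℤ}
    (hk : 0 < k) :
    (∃ P : Finpartition (Finset.univ : Finset V), (P.parts.card : ℤ) = k ∧
      (∀ A ∈ P.parts, (G.induce (A : Set V)).Connected) ∧ k < 2 * wins b P.parts) ↔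
    ∃ x, IsValue G b M Finset.univ root (k - 1).toNat x ∧ k + 2 < 2 * ceilDiv M x := by
  constructor
  · rintro ⟨P, hP, hconn, hw⟩
    obtain ⟨O, hO, hr⟩ := P.exists_mem (Finset.mem_univ root)
    refine ⟨_, ⟨O, P.parts.erase O, ⟨hconn O hO, fun A hA => hconn A (Finset.mem_of_mem_erase hA),
      fun A hA => P.disjoint hO (Finset.mem_of_mem_erase hA) (Finset.ne_of_mem_erase hA).symm,
      fun A hA A' hA' h => P.disjoint (Finset.mem_of_mem_erase hA)
        (Finset.mem_of_mem_erase hA') h, fun a => ?_⟩, hr, ?_, rfl⟩, ?_⟩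
    · refine iff_of_true (Finset.mem_univ a) ?_
      obtain ⟨A, hA, ha⟩ := P.exists_mem (Finset.mem_univ a)
      by_cases h : A = O
      · exact .inl (h ▸ ha)
      · exact .inr ⟨A, Finset.mem_erase.2 ⟨h, hA⟩, ha⟩
    · rw [Finset.card_erase_of_mem hO]; omega
    · rw [ceilDiv_value (hM O)]
      have e := wins_insert (b := b) (Finset.notMem_erase O P.parts)
      rw [Finset.insert_erase hO] at e
      rw [e] at hw
      push_cast at hw
      split_ifs at hw ⊢ <;> linarith
  · rintro ⟨_, ⟨O, Q, h, hr, hQ, rfl⟩, hk'⟩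
    have hmem : ∀ A ∈ insert O Q, A ≠ ⊥ := by
      intro A hA
      rw [Finset.bot_eq_empty, ← Finset.nonempty_iff_ne_empty]
      rcases Finset.mem_insert.1 hA with rfl | hA
      · exact ⟨root, hr⟩
      · exact h.nonempty hA
    have hdisj : ((insert O Q : Finset (Finset V)) : Set (Finset V)).PairwiseDisjoint id := by
      intro A hA A' hA' hne
      simp only [Finset.coe_insert, Set.mem_insert_iff, Finset.mem_coe] at hA hA'
      rcases hA with rfl | hA <;> rcases hA' with rfl | hA'
      · exact absurd rfl hne
      · exact h.disj_open A' hA'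
      · exact (h.disj_open A hA).symm
      · exact h.disj A hA A' hA' hne
    refine ⟨⟨insert O Q, Finset.supIndep_iff_pairwiseDisjoint.2 hdisj, ?_,
      fun hb => hmem _ hb rfl⟩, ?_, ?_, ?_⟩
    · ext a
      simp only [Finset.mem_sup, Finset.mem_insert, id, exists_eq_or_imp]
      exact (h.cover a).symm
    · simp only [Finset.card_insert_of_notMem h.open_notMem]
      push_cast
      omega
    · intro A hA
      rcases Finset.mem_insert.1 hA with rfl | hA
      · exact h.conn_open
      · exact h.conn A hA
    · rw [ceilDiv_value (hM O)] at hk'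
      simp only [wins_insert h.open_notMem]
      push_cast
      split_ifs at hk' ⊢ <;> linarith

/-- The signed weight of a vertex: positive for the target color, negative otherwise. -/
def Instance.balance (I : Instance) (v : Fin I.n) : ℤ :=
  if I.color v = I.target then (I.weight v : ℤ) else -(I.weight v : ℤ)

/-- One more than the total weight. -/
def Instance.modulus (I : Instance) : ℤ := 1 + ((∑ v, I.weight v : ℕ) : ℤ)

theorem Instance.abs_sum_balance_lt (I : Instance) (A : Finset (Fin I.n)) :
    |∑ v ∈ A, I.balance v| < I.modulus := by
  have h₁ : |∑ v ∈ A, I.balance v| ≤ ∑ v ∈ A, |I.balance v| := Finset.abs_sum_le_sum_abs _ _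
  have h₂ : ∑ v ∈ A, |I.balance v| = ((∑ v ∈ A, I.weight v : ℕ) : ℤ) := by
    push_cast
    refine Finset.sum_congr rfl fun v _ => ?_
    unfold Instance.balance
    split_ifs <;> simp
  have h₃ : ∑ v ∈ A, I.weight v ≤ ∑ v, I.weight v :=
    Finset.sum_le_sum_of_subset (Finset.subset_univ A)
  unfold Instance.modulus
  omega

theorem Instance.sum_balance (I : Instance) (h2 : I.numColors = 2) (A : Finset (Fin I.n))
    {r : Fin I.numColors} (hr : r ≠ I.target) :
    ∑ v ∈ A, I.balance v = (colorWeight I.weight I.color I.target A : ℤ) -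
      colorWeight I.weight I.color r A := by
  have hcol : ∀ v, I.color v = r ↔ ¬ I.color v = I.target := by
    intro v
    have h₁ := (I.color v).isLt
    have h₂ := r.isLt
    have h₃ := I.target.isLt
    rw [Fin.ext_iff, Fin.ext_iff]
    rw [Ne, Fin.ext_iff] at hr
    omega
  unfold colorWeight Instance.balance
  rw [Finset.sum_ite]
  push_cast
  simp only [hcol]
  rw [Finset.sum_neg_distrib, sub_eq_add_neg]

/-- The bounds on `k` are necessary because parts are nonempty; they are stated so that the program
can reject other `k` without a table lookup. -/
theorem Instance.isYes_iff (I : Instance) (h2 : I.numColors = 2) (root : Fin I.n) :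
    I.IsYes ↔ 0 < I.k ∧ I.k ≤ I.n ∧ ∃ x, IsValue I.graph I.balance I.modulus Finset.univ root
      (I.k - 1).toNat x ∧ I.k + 2 < 2 * ceilDiv I.modulus x := by
  classical
  obtain ⟨r₀, hr₀⟩ : ∃ r : Fin I.numColors, r ≠ I.target := by
    have : Nontrivial (Fin I.numColors) := by rw [h2]; infer_instance
    exact exists_ne I.target
  have huniq : ∀ r : Fin I.numColors, r ≠ I.target → r = r₀ := by
    intro r hr
    have h₁ := r₀.isLt
    have h₂ := r.isLt
    have h₃ := I.target.isLt
    rw [Fin.ext_iff]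
    rw [Ne, Fin.ext_iff] at hr hr₀
    omega
  have hu : ∀ A, IsUniquelyColored I.weight I.color I.target A ↔ 0 < ∑ v ∈ A, I.balance v := by
    intro A
    rw [I.sum_balance h2 A hr₀]
    constructor
    · intro h
      have := h r₀ hr₀
      omega
    · intro h r hr
      rw [huniq r hr]
      omega
  have hc : ∀ A, IsColored I.weight I.color r₀ A ↔ ¬ 0 < ∑ v ∈ A, I.balance v := by
    intro A
    rw [I.sum_balance h2 A hr₀]
    constructor
    · intro h
      have := h I.target
      omega
    · intro h r
      by_cases hr : r = I.target
      · rw [hr]; omega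
      · rw [huniq r hr]
  have hyes : I.IsYes ↔ ∃ P : Finpartition (Finset.univ : Finset (Fin I.n)),
      (P.parts.card : ℤ) = I.k ∧ (∀ A ∈ P.parts, (I.graph.induce (A : Set (Fin I.n))).Connected) ∧
      I.k < 2 * wins I.balance P.parts := by
    unfold Instance.IsYes
    refine exists_congr fun P => and_congr_right fun hP => and_congr_right fun _ => ?_
    have hcount : (∀ r : Fin I.numColors, r ≠ I.target →
        (P.parts.filter (fun A => IsColored I.weight I.color r A)).card <
          (P.parts.filter (fun A => IsUniquelyColored I.weight I.color I.target A)).card) ↔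
        (P.parts.filter (fun A => IsColored I.weight I.color r₀ A)).card <
          (P.parts.filter (fun A => IsUniquelyColored I.weight I.color I.target A)).card :=
      ⟨fun h => h r₀ hr₀, fun h r hr => by rw [huniq r hr]; exact h⟩
    rw [hcount]
    simp only [hu, hc]
    -- The parts of the other color are exactly those without positive sum, so they number `k` minus
    -- the wins.
    have e := Finset.card_filter_add_card_filter_not (s := P.parts)
      (fun A => 0 < ∑ v ∈ A, I.balance v)
    unfold wins
    omega
  rw [hyes]
  constructor
  · rintro ⟨P, hP, h⟩
    have : Nonempty (Fin I.n) := ⟨root⟩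
    have hpos : 0 < P.parts.card :=
      Finset.card_pos.2 (P.parts_nonempty (by simpa using Finset.univ_nonempty.ne_empty))
    have hle := P.card_parts_le_card
    rw [Finset.card_univ, Fintype.card_fin] at hle
    have hk : 0 < I.k := by omega
    exact ⟨hk, by omega, (exists_partition_iff I.abs_sum_balance_lt root hk).1 ⟨P, hP, h⟩⟩
  · rintro ⟨hk, -, h⟩
    exact (exists_partition_iff I.abs_sum_balance_lt root hk).2 h

/-! ### Contracting the edges of a tree, leaf by leaf -/

section Contraction

variable {V : Type*} {G : SimpleGraph V} {root : V} {r : V → V}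

/-- Some edges of `G` have been contracted, and `r` maps every vertex to the vertex it has been
merged into. The vertices that are fixed by `r` are still there, and so are the edges between
them. -/
structure IsContraction (G : SimpleGraph V) (root : V) (r : V → V) : Prop where
  idem : ∀ a, r (r a) = r a
  root : r root = root
  adj : ∀ a b, G.Adj a b → (r a = a ∧ r b = b) ∨ r a = r b

theorem isContraction_id : IsContraction G root id :=
  ⟨fun _ => rfl, rfl, fun _ _ _ => .inl ⟨rfl, rfl⟩⟩

variable [Fintype V]

open Classical in
/-- The neighbors of `v` which are still there. -/
noncomputable def remainingNeighbors (G : SimpleGraph V) (r : V → V) (v : V) : Finset V :=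
  Finset.univ.filter fun b => G.Adj v b ∧ r v = v ∧ r b = b

open Classical in
/-- The number of remaining neighbors, increased by one for the root. -/
noncomputable def remainingDegree (G : SimpleGraph V) (root : V) (r : V → V) (v : V) : ℕ :=
  (remainingNeighbors G r v).card + if v = root then 1 else 0

open Classical in
/-- The vertices which are still there. -/
noncomputable def remaining (r : V → V) : Finset V := Finset.univ.filter fun a => r a = a

open Classical in
/-- The vertices which have been merged into `v`. -/
noncomputable def bag (r : V → V) (v : V) : Finset V := Finset.univ.filter fun a => r a = v

open Classical in
/-- Merge `u` into `v`. -/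
noncomputable def mergeInto (r : V → V) (u v : V) (a : V) : V := if r a = u then v else r a

/-- `u` is a leaf with neighbor `v` among the remaining vertices, and `u` is not the root. -/
structure IsLeafEdge (G : SimpleGraph V) (root : V) (r : V → V) (u v : V) : Prop where
  adj : G.Adj u v
  deg_left : remainingDegree G root r u = 1
  deg_right : 0 < remainingDegree G root r v

theorem mem_remainingNeighbors {v b : V} :
    b ∈ remainingNeighbors G r v ↔ G.Adj v b ∧ r v = v ∧ r b = b := by
  simp [remainingNeighbors]

theorem mem_bag {v a : V} : a ∈ bag r v ↔ r a = v := by simp [bag]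

theorem mem_remaining {a : V} : a ∈ remaining r ↔ r a = a := by simp [remaining]

/-- A positive degree certifies that a vertex is still there, so the program stores degrees and need
not store `r`. -/
theorem IsContraction.fixed_of_degree_pos (h : IsContraction G root r) {v : V}
    (hv : 0 < remainingDegree G root r v) : r v = v := by
  by_cases hr : v = root
  · rw [hr, h.root]
  · rw [remainingDegree, if_neg hr, add_zero, Finset.card_pos] at hv
    obtain ⟨b, hb⟩ := hv
    exact (mem_remainingNeighbors.1 hb).2.1

/-! ### The effect of merging a leaf -/

namespace IsLeafEdge

variable {u v : V}

theorem fixed_left (h : IsLeafEdge G root r u v) (hr : IsContraction G root r) : r u = u :=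
  hr.fixed_of_degree_pos (by rw [h.deg_left]; exact one_pos)

theorem fixed_right (h : IsLeafEdge G root r u v) (hr : IsContraction G root r) : r v = v :=
  hr.fixed_of_degree_pos h.deg_right

theorem mem_neighbors (h : IsLeafEdge G root r u v) (hr : IsContraction G root r) :
    v ∈ remainingNeighbors G r u :=
  mem_remainingNeighbors.2 ⟨h.adj, h.fixed_left hr, h.fixed_right hr⟩

/-- The extra unit gives a root with a remaining neighbor degree at least two, so the root is never
merged away. -/
theorem ne_root (h : IsLeafEdge G root r u v) (hr : IsContraction G root r) : u ≠ root := by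
  intro hu
  have h₁ := h.deg_left
  rw [remainingDegree, if_pos hu] at h₁
  have := Finset.card_pos.2 ⟨v, h.mem_neighbors hr⟩
  omega

theorem neighbors_eq (h : IsLeafEdge G root r u v) (hr : IsContraction G root r) :
    remainingNeighbors G r u = {v} := by
  have h₁ := h.deg_left
  rw [remainingDegree, if_neg (h.ne_root hr), add_zero, Finset.card_eq_one] at h₁
  obtain ⟨a, ha⟩ := h₁
  have h₂ := h.mem_neighbors hr
  rw [ha, Finset.mem_singleton] at h₂
  rw [ha, h₂]

theorem eq_of_adj (h : IsLeafEdge G root r u v) (hr : IsContraction G root r) {b : V}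
    (hb : G.Adj u b) (hrb : r b = b) : b = v := by
  have : b ∈ remainingNeighbors G r u := mem_remainingNeighbors.2 ⟨hb, h.fixed_left hr, hrb⟩
  rwa [h.neighbors_eq hr, Finset.mem_singleton] at this

theorem mergeInto_eq_self_iff (h : IsLeafEdge G root r u v) (hr : IsContraction G root r) {x : V} :
    mergeInto r u v x = x ↔ r x = x ∧ x ≠ u := by
  unfold mergeInto
  have hvu : v ≠ u := h.adj.ne'
  have hv := h.fixed_right hr
  split_ifs with hx
  · constructor
    · rintro rfl
      exact absurd (hv.symm.trans hx) hvu
    · rintro ⟨h₁, h₂⟩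
      exact absurd (h₁.symm.trans hx) h₂
  · constructor
    · intro h₁
      exact ⟨h₁, fun h₂ => hx (h₁.trans h₂)⟩
    · exact fun h₁ => h₁.1

/-- Among the remaining edges only `u v` ends at `u`, and it becomes internal to the new bag. -/
theorem isContraction_mergeInto (h : IsLeafEdge G root r u v) (hr : IsContraction G root r) :
    IsContraction G root (mergeInto r u v) where
  idem a := by
    rw [h.mergeInto_eq_self_iff hr]
    unfold mergeInto
    split_ifs with ha
    · exact ⟨h.fixed_right hr, h.adj.ne'⟩
    · exact ⟨hr.idem a, ha⟩
  root := (h.mergeInto_eq_self_iff hr).2 ⟨hr.root, (h.ne_root hr).symm⟩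
  adj a b hab := by
    rcases hr.adj a b hab with ⟨ha, hb⟩ | hab'
    · by_cases hau : a = u
      · subst hau
        obtain rfl := h.eq_of_adj hr hab hb
        right
        rw [(h.mergeInto_eq_self_iff hr).2 ⟨hb, hab.ne'⟩, mergeInto, if_pos ha]
      · by_cases hbu : b = u
        · subst hbu
          obtain rfl := h.eq_of_adj hr hab.symm ha
          right
          rw [(h.mergeInto_eq_self_iff hr).2 ⟨ha, hau⟩, mergeInto, if_pos hb]
        · exact .inl ⟨(h.mergeInto_eq_self_iff hr).2 ⟨ha, hau⟩,
            (h.mergeInto_eq_self_iff hr).2 ⟨hb, hbu⟩⟩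
    · exact .inr (by unfold mergeInto; rw [hab'])

theorem degree_mergeInto_left (h : IsLeafEdge G root r u v) (hr : IsContraction G root r) :
    remainingDegree G root (mergeInto r u v) u = 0 := by
  rw [remainingDegree, if_neg (h.ne_root hr), add_zero, Finset.card_eq_zero]
  refine Finset.eq_empty_of_forall_notMem fun b hb => ?_
  exact ((h.mergeInto_eq_self_iff hr).1 (mem_remainingNeighbors.1 hb).2.1).2 rfl

open Classical in
theorem neighbors_mergeInto (h : IsLeafEdge G root r u v) (hr : IsContraction G root r) {x : V}
    (hx : x ≠ u) :
    remainingNeighbors G (mergeInto r u v) x = (remainingNeighbors G r x).erase u := by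
  ext b
  simp only [mem_remainingNeighbors, h.mergeInto_eq_self_iff hr, Finset.mem_erase]
  tauto

theorem degree_mergeInto_right (h : IsLeafEdge G root r u v) (hr : IsContraction G root r) :
    remainingDegree G root r v = remainingDegree G root (mergeInto r u v) v + 1 := by
  classical
  have hu : u ∈ remainingNeighbors G r v :=
    mem_remainingNeighbors.2 ⟨h.adj.symm, h.fixed_right hr, h.fixed_left hr⟩
  rw [remainingDegree, remainingDegree, h.neighbors_mergeInto hr h.adj.ne',
    ← Finset.card_erase_add_one hu]
  ring

theorem degree_mergeInto_of_ne (h : IsLeafEdge G root r u v) (hr : IsContraction G root r) {x : V}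
    (hu : x ≠ u) (hv : x ≠ v) :
    remainingDegree G root (mergeInto r u v) x = remainingDegree G root r x := by
  classical
  rw [remainingDegree, remainingDegree, h.neighbors_mergeInto hr hu, Finset.erase_eq_of_notMem]
  intro hc
  obtain ⟨h₁, h₂, -⟩ := mem_remainingNeighbors.1 hc
  exact hv (h.eq_of_adj hr h₁.symm h₂)

theorem card_remaining (h : IsLeafEdge G root r u v) (hr : IsContraction G root r) :
    (remaining r).card = (remaining (mergeInto r u v)).card + 1 := by
  classical
  have e : remaining (mergeInto r u v) = (remaining r).erase u := by
    ext x
    simp only [mem_remaining, h.mergeInto_eq_self_iff hr, Finset.mem_erase]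
    tauto
  rw [e, Finset.card_erase_add_one (mem_remaining.2 (h.fixed_left hr))]

/-- An edge between different bags joins two fixed vertices, and these are the representatives of
their bags. -/
theorem isJoin (h : IsLeafEdge G root r u v) (hr : IsContraction G root r) :
    IsJoin G (bag r u) (bag r v) u v where
  disj := Finset.disjoint_left.2 fun a ha hb =>
    h.adj.ne ((mem_bag.1 ha).symm.trans (mem_bag.1 hb))
  left := mem_bag.2 (h.fixed_left hr)
  right := mem_bag.2 (h.fixed_right hr)
  adj := h.adj
  cross x hx y hy hxy := by
    rw [mem_bag] at hx hy
    rcases hr.adj x y hxy with ⟨h₁, h₂⟩ | h₁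
    · exact ⟨h₁.symm.trans hx, h₂.symm.trans hy⟩
    · exact absurd (hx.symm.trans (h₁.trans hy)) h.adj.ne

theorem bag_mergeInto_right [DecidableEq V] (h : IsLeafEdge G root r u v) :
    bag (mergeInto r u v) v = bag r u ∪ bag r v := by
  ext a
  simp only [mem_bag, Finset.mem_union, mergeInto]
  have := h.adj.ne
  split_ifs with ha
  · simp [ha]
  · simp [ha]

theorem bag_mergeInto_of_ne {x : V} (hu : x ≠ u) (hv : x ≠ v) :
    bag (mergeInto r u v) x = bag r x := by
  ext a
  simp only [mem_bag, mergeInto]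
  split_ifs with ha
  · simp [ha, hu.symm, hv.symm]
  · rfl

end IsLeafEdge

/-- A walk from `a` to the root has to leave the bag of `a`, and the edge by which it leaves joins
`a` to a remaining vertex. -/
theorem IsContraction.exists_neighbor (h : IsContraction G root r) (hG : G.Connected) {a : V}
    (ha : r a = a) (har : a ≠ root) : ∃ b, G.Adj a b ∧ r b = b := by
  obtain ⟨p⟩ := hG.preconnected a root
  obtain ⟨d, -, h₁, h₂⟩ := p.exists_boundary_dart {x | r x = a} ha
    (by rw [Set.mem_ofPred_eq, h.root]; exact har.symm)
  rw [Set.mem_ofPred_eq] at h₁ h₂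
  rcases h.adj _ _ d.adj with ⟨h₃, h₄⟩ | h₃
  · exact ⟨d.snd, by rw [← h₁, h₃]; exact d.adj, h₄⟩
  · exact absurd (h₃.symm.trans h₁) h₂

/-- In a tree, at most one neighbor of a vertex is not farther from the root. -/
theorem eq_of_adj_of_dist_le (hG : G.IsTree) {u x y : V} (hx : G.Adj u x) (hy : G.Adj u y)
    (hdx : G.dist root x ≤ G.dist root u) (hdy : G.dist root y ≤ G.dist root u) : x = y := by
  classical
  obtain ⟨p, hp, -⟩ := hG.existsUnique_path u root
  have key : ∀ z, G.Adj u z → G.dist root z ≤ G.dist root u → z = p.snd := by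
    intro z hz hd
    refine hG.isAcyclic.eq_snd_of_adj_start hp hz ?_
    obtain ⟨q, hq, hql⟩ := hG.connected.exists_path_of_dist z root
    -- A shortest path from `z` through `u` would make `u` strictly closer to the root than `z`.
    have hu : u ∉ q.support := by
      intro hu
      have h₁ := congrArg SimpleGraph.Walk.length (q.take_spec hu)
      rw [SimpleGraph.Walk.length_append] at h₁
      have h₂ := SimpleGraph.dist_le (q.dropUntil u hu)
      have h₃ : (q.takeUntil u hu).length ≠ 0 := fun h0 =>
        hz.ne' (SimpleGraph.Walk.eq_of_length_eq_zero h0)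
      rw [SimpleGraph.dist_comm] at h₂ hql
      omega
    have hpq : (SimpleGraph.Walk.cons hz q).IsPath := hq.cons hu
    -- Paths in a tree are unique, so `z` is the second vertex of the path from `u` to the root.
    have e : p = SimpleGraph.Walk.cons hz q :=
      congrArg Subtype.val (hG.isAcyclic.subsingleton_path u root |>.elim ⟨p, hp⟩ ⟨_, hpq⟩)
    rw [e]
    simp
  rw [key x hx hdx, key y hy hdy]

/-- Take a remaining vertex at maximal distance from the root: none of its remaining neighbors is
farther, so there is at most one. -/
theorem IsContraction.exists_isLeafEdge (h : IsContraction G root r) (hG : G.IsTree)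
    (hcard : 2 ≤ (remaining r).card) : ∃ u v, IsLeafEdge G root r u v := by
  classical
  have hne : ((remaining r).erase root).Nonempty := by
    rw [← Finset.card_pos, Finset.card_erase_of_mem (mem_remaining.2 h.root)]
    omega
  obtain ⟨u, hu, hmax⟩ := Finset.exists_max_image _ (fun a => G.dist root a) hne
  obtain ⟨hur, hu⟩ := Finset.mem_erase.1 hu
  rw [mem_remaining] at hu
  have hle : ∀ b, r b = b → G.dist root b ≤ G.dist root u := by
    intro b hb
    by_cases hbr : b = root
    · rw [hbr, SimpleGraph.dist_self]; exact Nat.zero_le _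
    · exact hmax b (Finset.mem_erase.2 ⟨hbr, mem_remaining.2 hb⟩)
  obtain ⟨v, huv, hv⟩ := h.exists_neighbor hG.connected hu hur
  refine ⟨u, v, huv, ?_, ?_⟩
  · rw [remainingDegree, if_neg hur, add_zero, Finset.card_eq_one]
    refine ⟨v, ?_⟩
    ext b
    rw [mem_remainingNeighbors, Finset.mem_singleton]
    constructor
    · rintro ⟨hb, -, hrb⟩
      exact eq_of_adj_of_dist_le hG hb huv (hle b hrb) (hle v hv)
    · rintro rfl
      exact ⟨huv, hu, hv⟩
  · have : 0 < (remainingNeighbors G r v).card :=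
      Finset.card_pos.2 ⟨u, mem_remainingNeighbors.2 ⟨huv.symm, hv, hu⟩⟩
    exact Nat.add_pos_left this _

theorem IsContraction.bag_root (h : IsContraction G root r) (hcard : (remaining r).card ≤ 1) :
    bag r root = Finset.univ := by
  refine Finset.eq_univ_of_forall fun a => mem_bag.2 ?_
  exact Finset.card_le_one.1 hcard _ (mem_remaining.2 (h.idem a)) _ (mem_remaining.2 h.root)

end Contraction

end Gerrymandering

namespace RAM

open Gerrymandering Cmd

/-! ### Registers and memory of the dynamic program -/

/-- The registers that are constant in the main part of the program. -/
structure Env (n : ℕ) (M : ℤ) (reg : ℕ → ℤ) : Prop where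
  one : reg 1 = 1
  zero : reg 2 = 0
  size : reg 3 = n
  modulus : reg 6 = M
  top : reg 7 = (((n - 1) * n : ℕ) : ℤ)
  deg : reg 8 = ((4 * n + 2 : ℕ) : ℤ)
  tab : reg 9 = ((5 * n + 2 : ℕ) : ℤ)
  edges : reg 10 = ((4 + 2 * n : ℕ) : ℤ)
  pred : reg 11 = ((n - 1 : ℕ) : ℤ)

theorem Env.congr {n : ℕ} {M : ℤ} {reg reg' : ℕ → ℤ} (h : Env n M reg)
    (hr : ∀ i < 12, reg' i = reg i) : Env n M reg' := by
  obtain ⟨h₁, h₂, h₃, h₄, h₅, h₆, h₇, h₈, h₉⟩ := h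
  constructor <;> rw [hr _ (by norm_num)] <;> assumption

theorem Env.update {n : ℕ} {M : ℤ} {reg : ℕ → ℤ} (h : Env n M reg) {i : ℕ} (hi : 12 ≤ i) (z : ℤ) :
    Env n M (Function.update reg i z) :=
  h.congr fun _ hj => Function.update_of_ne (by omega) _ _

theorem Env.frame {n : ℕ} {M : ℤ} {reg reg' : ℕ → ℤ} (h : Env n M reg) {c : Cmd}
    (hf : ∀ r ∉ c.writes, reg' r = reg r) (hc : ∀ r ∈ c.writes, 12 ≤ r) : Env n M reg' :=
  h.congr fun i hi => hf i fun hm => by have := hc i hm; omega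

/-- The address of the entry of the table for `v` and `j`. -/
def tabAddr (n v j : ℕ) : ℕ := 5 * n + 2 + j * n + v

/-- The memory holds the input, the remaining degrees and the tables. -/
structure Holds (n : ℕ) (inp deg : ℕ → ℤ) (tab : ℕ → ℕ → ℤ) (mem : ℕ → ℤ) : Prop where
  input : ∀ a < 4 * n + 2, mem a = inp a
  deg : ∀ v < n, mem (4 * n + 2 + v) = deg v
  tab : ∀ v < n, ∀ j < n, mem (tabAddr n v j) = tab v j

/-- `v` and `j` are remainder and quotient modulo `n`. With this layout, changing `j` by one means
adding or subtracting `n`, so no multiplication is needed to address the table. -/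
theorem tabAddr_inj {n v v' j j' : ℕ} (hv : v < n) (hv' : v' < n)
    (h : tabAddr n v j = tabAddr n v' j') : v = v' ∧ j = j' := by
  unfold tabAddr at h
  have h₁ : v + n * j = v' + n * j' := by rw [mul_comm n, mul_comm n]; omega
  have h₂ := congrArg (· % n) h₁
  simp only [Nat.add_mul_mod_self_left, Nat.mod_eq_of_lt hv, Nat.mod_eq_of_lt hv'] at h₂
  subst h₂
  exact ⟨rfl, Nat.eq_of_mul_eq_mul_left (by omega : 0 < n) (by omega)⟩

namespace Holds

variable {n : ℕ} {inp deg : ℕ → ℤ} {tab : ℕ → ℕ → ℤ} {mem : ℕ → ℤ}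

theorem congr {deg' : ℕ → ℤ} {tab' : ℕ → ℕ → ℤ} (h : Holds n inp deg tab mem)
    (hd : ∀ v < n, deg v = deg' v) (ht : ∀ v < n, ∀ j < n, tab v j = tab' v j) :
    Holds n inp deg' tab' mem :=
  ⟨h.input, fun v hv => (h.deg v hv).trans (hd v hv),
    fun v hv j hj => (h.tab v hv j hj).trans (ht v hv j hj)⟩

theorem store_tab (h : Holds n inp deg tab mem) {v j : ℕ} (hv : v < n) (x : ℤ) :
    Holds n inp deg (Function.update tab v (Function.update (tab v) j x))
      (Function.update mem (tabAddr n v j) x) where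
  input a ha := by
    rw [Function.update_of_ne (by unfold tabAddr; omega), h.input a ha]
  deg w hw := by
    rw [Function.update_of_ne (by unfold tabAddr; omega), h.deg w hw]
  tab w hw i hi := by
    by_cases hwi : w = v ∧ i = j
    · obtain ⟨rfl, rfl⟩ := hwi
      simp
    · rw [Function.update_of_ne (fun hc => hwi (tabAddr_inj hw hv hc)), h.tab w hw i hi]
      by_cases hwv : w = v
      · subst hwv
        rw [Function.update_self, Function.update_of_ne (fun hc => hwi ⟨rfl, hc⟩)]
      · rw [Function.update_of_ne hwv]

theorem store_deg (h : Holds n inp deg tab mem) {v : ℕ} (hv : v < n) (x : ℤ) :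
    Holds n inp (Function.update deg v x) tab (Function.update mem (4 * n + 2 + v) x) where
  input a ha := by rw [Function.update_of_ne (by omega), h.input a ha]
  deg w hw := by
    by_cases hwv : w = v
    · subst hwv; simp
    · rw [Function.update_of_ne (by omega), Function.update_of_ne hwv, h.deg w hw]
  tab w hw i hi := by
    rw [Function.update_of_ne (by unfold tabAddr; omega), h.tab w hw i hi]

end Holds

/-- The bound `B` suffices for all numbers of the dynamic program. -/
structure Suffices (n : ℕ) (M B : ℤ) : Prop where
  size_pos : 0 < n
  modulus_pos : 0 < M
  addr : ((n : ℤ) + 10) * (n + 10) ≤ B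
  value : M * (n + 10) ≤ B

/-- The polynomial is `(n + 10) * (n + 10)`, expanded so that linear arithmetic can use it. -/
theorem Suffices.abs_le {n : ℕ} {M B : ℤ} (h : Suffices n M B) {x : ℤ}
    (h₁ : -(n * n + 20 * n + 100) ≤ x) (h₂ : x ≤ n * n + 20 * n + 100) : |x| ≤ B := by
  have := h.addr
  rw [_root_.abs_le]
  constructor <;> nlinarith

theorem Suffices.abs_le_value {n : ℕ} {M B : ℤ} (h : Suffices n M B) {x : ℤ}
    (h₁ : -(M * n + M * 10) ≤ x) (h₂ : x ≤ M * n + M * 10) : |x| ≤ B := by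
  have := h.value
  rw [mul_add] at this
  rw [_root_.abs_le]
  constructor <;> linarith

theorem Suffices.abs_natCast_le {n : ℕ} {M B : ℤ} (h : Suffices n M B) {a : ℕ}
    (ha : a ≤ n * n + 20 * n + 100) : |(a : ℤ)| ≤ B := by
  have h₁ : (a : ℤ) ≤ n * n + 20 * n + 100 := by exact_mod_cast ha
  exact h.abs_le (by linarith [mul_nonneg (Nat.cast_nonneg (α := ℤ) n) (Nat.cast_nonneg n)]) h₁

theorem Suffices.abs_natCast_sub_le {n : ℕ} {M B : ℤ} (h : Suffices n M B) {a b : ℕ}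
    (ha : a ≤ n * n + 20 * n + 100) (hb : b ≤ n * n + 20 * n + 100) : |(a : ℤ) - b| ≤ B := by
  have h₁ : (a : ℤ) ≤ n * n + 20 * n + 100 := by exact_mod_cast ha
  have h₂ : (b : ℤ) ≤ n * n + 20 * n + 100 := by exact_mod_cast hb
  have h₃ : (0 : ℤ) ≤ a := Nat.cast_nonneg a
  have h₄ : (0 : ℤ) ≤ b := Nat.cast_nonneg b
  exact h.abs_le (by linarith) (by linarith)

theorem tabAddr_le {n v j : ℕ} (hv : v < n) (hj : j ≤ n) :
    tabAddr n v j ≤ n * n + 6 * n + 2 := by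
  have := Nat.mul_le_mul_right n hj
  unfold tabAddr
  omega

theorem Suffices.abs_tabAddr_le {n : ℕ} {M B : ℤ} (h : Suffices n M B) {v j : ℕ} (hv : v < n)
    (hj : j ≤ n) : |((tabAddr n v j : ℕ) : ℤ)| ≤ B :=
  h.abs_natCast_le ((tabAddr_le hv hj).trans (by omega))

/-- Covers pointers that step down past row zero at the end of a loop. -/
theorem Suffices.abs_tabAddr_sub_le {n : ℕ} {M B : ℤ} (h : Suffices n M B) {v j : ℕ} (hv : v < n)
    (hj : j ≤ n) : |((tabAddr n v j : ℕ) : ℤ) - n| ≤ B :=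
  h.abs_natCast_sub_le ((tabAddr_le hv hj).trans (by omega)) (by omega)

/-! ### Rounding up to a multiple of the modulus -/

theorem mul_ceilDiv_sub_one_lt {M : ℤ} (hM : 0 < M) (x : ℤ) : M * (ceilDiv M x - 1) < x := by
  by_contra! h
  have := (ceilDiv_le_iff hM).2 h
  omega

/-- One step of `ceilBlock`. -/
def ceilBody : Cmd := .block [.add 18 18 6, .add 28 28 1, .sub 19 17 18]

/-- With `x` in register 17, computes `M * ⌈x / M⌉` in register 18 and `⌈x / M⌉` in
register 28. -/
def ceilBlock : Cmd := .block [.const 18 0, .const 28 0, .sub 19 17 18, .loop 19 ceilBody]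

/-- Multiples of `M` are generated until one reaches `x`. The number of iterations is the quotient,
which is at most `n + 1`. -/
theorem ensures_ceilBlock {B M x : ℤ} {s : State} {n : ℕ} (hB : Suffices n M B) (hx : 0 ≤ x)
    (hxn : x ≤ M * (n + 1 : ℕ)) (henv : Env n M s.reg) (h17 : s.reg 17 = x) :
    Ensures B ceilBlock s fun s' => s'.reg 18 = M * ceilDiv M x ∧ s'.reg 28 = ceilDiv M x ∧
      s'.mem = s.mem ∧ s'.clock ≤ s.clock + 5 * n + 10 := by
  have hM := hB.modulus_pos
  obtain ⟨c, hc⟩ : ∃ c : ℕ, (c : ℤ) = ceilDiv M x := by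
    refine ⟨(ceilDiv M x).toNat, Int.toNat_of_nonneg ?_⟩
    rw [← ceilDiv_zero (M := M)]
    exact ceilDiv_mono hM hx
  have h₁ := le_mul_ceilDiv hM x
  have h₂ := mul_ceilDiv_sub_one_lt hM x
  have h₃ := (ceilDiv_le_iff hM).2 hxn
  rw [← hc] at h₁ h₂ h₃ ⊢
  have hcn : c ≤ n + 1 := by exact_mod_cast h₃
  have hpos : 0 ≤ M * (n : ℤ) := by positivity
  push_cast [mul_add] at hxn
  have hxB : |x| ≤ B := hB.abs_le_value (by linarith) (by linarith)
  have h0B : |(0 : ℤ)| ≤ B := hB.abs_le_value (by linarith) (by linarith)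
  unfold ceilBlock
  simp only [ensures_block_cons, ensures_block_nil, ensures_const, ensures_sub,
    Function.update_apply, h17, reduceIte, Nat.reduceEqDiff, sub_zero]
  refine ⟨h0B, h0B, hxB, ?_⟩
  -- In all loop invariants `k` counts the iterations still to come; here `c - k` copies of `M` have
  -- been added.
  refine ensures_loop (fun k s' => k ≤ c ∧ s'.reg 18 = M * ((c : ℤ) - k) ∧
    s'.reg 28 = (c : ℤ) - k ∧ s'.reg 19 = x - M * ((c : ℤ) - k) ∧ s'.mem = s.mem ∧
    s'.clock + 5 * k ≤ s.clock + 3 + 5 * c) c ?_ ?_ ?_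
  · rintro k s' hf ⟨hk, e18, e28, e19, emem, hclk⟩
    have e6 : s'.reg 6 = M := by
      rw [hf 6 (by decide)]
      simp [Function.update_apply, henv.modulus]
    have e1 : s'.reg 1 = 1 := by
      rw [hf 1 (by decide)]
      simp [Function.update_apply, henv.one]
    have e17 : s'.reg 17 = x := by
      rw [hf 17 (by decide)]
      simp [Function.update_apply, h17]
    have hck : ((c : ℤ) - (k + 1 : ℕ)) ≤ c - 1 := by push_cast; linarith
    have hck' := mul_le_mul_of_nonneg_left hck hM.le
    have hck0 : (0 : ℤ) ≤ (c : ℤ) - (k + 1 : ℕ) := by push_cast; omega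
    have hck0' := mul_nonneg hM.le hck0
    have a₁ : M * ((c : ℤ) - (k + 1 : ℕ)) + M = M * ((c : ℤ) - k) := by push_cast; ring
    have a₂ : (c : ℤ) - (k + 1 : ℕ) + 1 = (c : ℤ) - k := by push_cast; ring
    have a₃ : M * ((c : ℤ) - k) ≤ M * (n + 1) :=
      mul_le_mul_of_nonneg_left (by omega) hM.le
    rw [mul_add, mul_one] at a₃
    refine ⟨by rw [e19]; linarith, ?_⟩
    unfold ceilBody
    simp only [ensures_block_cons, ensures_block_nil, ensures_add, ensures_sub,
      Function.update_apply, e18, e28, e19, e6, e1, e17, reduceIte, Nat.reduceEqDiff, a₁, a₂]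
    refine ⟨hB.abs_le_value (by linarith) (by linarith), hB.abs_le ?_ ?_,
      hB.abs_le_value (by linarith) (by linarith), by omega, trivial, trivial, trivial, emem,
      by omega⟩
    · linarith [mul_nonneg (Nat.cast_nonneg (α := ℤ) n) (Nat.cast_nonneg n)]
    · have : (c : ℤ) ≤ n + 1 := h₃
      linarith [mul_nonneg (Nat.cast_nonneg (α := ℤ) n) (Nat.cast_nonneg n)]
  · rintro s' - ⟨-, e18, e28, e19, emem, hclk⟩
    push_cast at e18 e28 e19
    rw [sub_zero] at e18 e28 e19
    exact ⟨by rw [e19]; linarith, e18, e28, emem, by simp only; omega⟩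
  · simp [Function.update_apply]

/-! ### Closing the open part of a leaf -/

/-- One step of `attachBlock`. -/
def attachBody : Cmd := .block [.sub 23 22 3, .load 17 23, ceilBlock, .load 17 22, .sub 19 18 17,
  .ite 19 (.store 22 18) .skip, .add 22 23 2, .sub 13 13 1]

/-- Replaces the table of the vertex in register 20 by its `attachTab`. -/
def attachBlock : Cmd := .block [.add 22 9 20, .add 22 22 7, .add 13 11 2, .loop 13 attachBody]

theorem tabAddr_succ_sub (n v j : ℕ) :
    ((tabAddr n v (j + 1) : ℕ) : ℤ) - n = (tabAddr n v j : ℕ) := by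
  unfold tabAddr
  push_cast
  ring

/-- Entry `j` depends on the old entries `j` and `j - 1`, so working downwards allows overwriting in
place. The `n` roundings dominate the time. -/
theorem ensures_attachBlock {B M : ℤ} {s : State} {n u : ℕ} {inp deg : ℕ → ℤ} {tab : ℕ → ℕ → ℤ}
    (hB : Suffices n M B) (henv : Env n M s.reg) (hmem : Holds n inp deg tab s.mem)
    (hu : u < n) (h20 : s.reg 20 = u) (h₀ : ∀ j < n, 0 ≤ tab u j ∧ tab u j ≤ M * (j + 2)) :
    Ensures B attachBlock s fun s' =>
      Holds n inp deg (Function.update tab u (attachTab M (tab u))) s'.mem ∧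
      s'.clock ≤ s.clock + 5 + n * (5 * n + 30) := by
  have hn := hB.size_pos
  have hM := hB.modulus_pos
  obtain ⟨m, rfl⟩ : ∃ m, n = m + 1 := ⟨n - 1, by omega⟩
  unfold attachBlock
  simp only [ensures_block_cons, ensures_block_nil, ensures_add, henv.tab, henv.top, henv.pred,
    henv.zero, h20, Function.update_apply, reduceIte, Nat.reduceEqDiff, add_zero,
    Nat.add_sub_cancel]
  have e0 : ((5 * (m + 1) + 2 : ℕ) : ℤ) + u + ((m * (m + 1) : ℕ) : ℤ) =
      (tabAddr (m + 1) u m : ℕ) := by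
    unfold tabAddr; push_cast; ring
  rw [e0, ← Nat.cast_add]
  refine ⟨hB.abs_natCast_le (by omega), hB.abs_tabAddr_le hu (by omega),
    hB.abs_natCast_le (by omega), ?_⟩
  refine ensures_loop (fun k s' => k < m + 1 ∧ s'.reg 13 = (k : ℤ) ∧
    s'.reg 22 = (tabAddr (m + 1) u k : ℕ) ∧
    Holds (m + 1) inp deg (Function.update tab u (fun j => if k < j then attachTab M (tab u) j
      else tab u j)) s'.mem ∧
    s'.clock + k * (5 * (m + 1) + 30) ≤ s.clock + 3 + m * (5 * (m + 1) + 30)) m ?_ ?_ ?_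
  · rintro k s' hf ⟨hk, e13, e22, hh, hclk⟩
    have henv' : Env (m + 1) M s'.reg :=
      (((henv.update (by norm_num) _).update (by norm_num) _).update (by norm_num) _).frame hf
        (by decide)
    have l₁ : s'.mem (tabAddr (m + 1) u k) = tab u k := by
      rw [hh.tab u hu k (by omega), Function.update_self, if_neg (by omega)]
    have l₂ : s'.mem (tabAddr (m + 1) u (k + 1)) = tab u (k + 1) := by
      rw [hh.tab u hu _ hk, Function.update_self, if_neg (by omega)]
    have hk₀ := h₀ k (by omega)
    have hk₁ := h₀ (k + 1) hk
    refine ⟨by rw [e13]; positivity, ?_⟩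
    unfold attachBody
    simp only [ensures_block_cons, ensures_block_nil, ensures_add, ensures_sub, ensures_load,
      Function.update_apply, e13, e22, henv'.size, henv'.zero, henv'.one, reduceIte,
      Nat.reduceEqDiff, add_zero, tabAddr_succ_sub, Int.toNat_natCast, l₁]
    refine ⟨hB.abs_tabAddr_le hu (by omega), ?_⟩
    have hc₁ : ceilDiv M (tab u k) ≤ k + 2 := (ceilDiv_le_iff hM).2 hk₀.2
    have hc₂ := mul_le_mul_of_nonneg_left hc₁ hM.le
    have hc₃ := hk₀.1.trans (le_mul_ceilDiv hM (tab u k))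
    have hkm : M * ((k : ℤ) + 3) ≤ M * ((m + 1 : ℕ) + 2) :=
      mul_le_mul_of_nonneg_left (by push_cast; omega) hM.le
    have hk₁' := hk₁.2
    push_cast [mul_add] at hkm hc₂ hk₁'
    have hm1 : M * ((m + 1 : ℕ) : ℤ) = M * m + M * 1 := by push_cast; ring
    have hm0 : 0 ≤ M * (m : ℤ) := by positivity
    refine (ensures_ceilBlock (n := m + 1) (x := tab u k) hB hk₀.1 ?_
      ((henv'.update (by norm_num) _).update (by norm_num) _) (by simp)).mono ?_
    · refine hk₀.2.trans (mul_le_mul_of_nonneg_left ?_ hM.le)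
      push_cast
      omega
    rintro s₂ hf₂ ⟨d18, -, dmem, dclk⟩
    have henv₂ : Env (m + 1) M s₂.reg :=
      ((henv'.update (by norm_num) _).update (by norm_num) _).frame hf₂ (by decide)
    have d22 : s₂.reg 22 = (tabAddr (m + 1) u (k + 1) : ℕ) := by
      rw [hf₂ 22 (by decide)]; simp [Function.update_apply, e22]
    have d23 : s₂.reg 23 = (tabAddr (m + 1) u k : ℕ) := by
      rw [hf₂ 23 (by decide)]; simp [Function.update_apply]
    have d13 : s₂.reg 13 = ((k + 1 : ℕ) : ℤ) := by
      rw [hf₂ 13 (by decide)]; simp [Function.update_apply, e13]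
    simp only at dmem dclk
    have e13' : ((k + 1 : ℕ) : ℤ) - 1 = k := by push_cast; ring
    have hab : |((k : ℕ) : ℤ)| ≤ B := hB.abs_natCast_le (by omega)
    have hclk' : s₂.clock + 10 + k * (5 * (m + 1) + 30) ≤
        s.clock + 3 + m * (5 * (m + 1) + 30) := by
      rw [add_mul] at hclk
      omega
    simp only [ensures_block_cons, ensures_block_nil, ensures_add, ensures_sub, ensures_load,
      ensures_ite, ensures_store, ensures_skip,
      Function.update_apply, d13, d22, d23, d18, dmem, henv₂.size, henv₂.zero, henv₂.one,
      reduceIte, Nat.reduceEqDiff, add_zero, Int.toNat_natCast, l₂, e13']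
    refine ⟨hB.abs_le_value (by linarith) (by linarith), fun hlt => ?_, fun hlt => ?_⟩
    · refine ⟨hB.abs_tabAddr_le hu (by omega), hab, by omega, trivial, trivial, ?_, by omega⟩
      refine (hh.store_tab (j := k + 1) hu (M * ceilDiv M (tab u k))).congr (fun _ _ => rfl)
        fun v hv j hj => ?_
      by_cases hvu : v = u
      · subst hvu
        simp only [Function.update_self, Function.update_apply]
        rcases lt_trichotomy j (k + 1) with h | rfl | h
        · rw [if_neg (by omega), if_neg (by omega), if_neg (by omega)]
        · rw [if_pos rfl, if_pos (by omega), attachTab, if_neg (by omega), Nat.add_sub_cancel,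
            max_eq_right (by linarith)]
        · rw [if_neg (by omega), if_pos (by omega), if_pos (by omega)]
      · simp [Function.update_of_ne hvu]
    · refine ⟨hB.abs_tabAddr_le hu (by omega), hab, by omega, trivial, trivial, ?_, by omega⟩
      refine hh.congr (fun _ _ => rfl) fun v hv j hj => ?_
      by_cases hvu : v = u
      · subst hvu
        simp only [Function.update_self]
        rcases lt_trichotomy j (k + 1) with h | rfl | h
        · rw [if_neg (by omega), if_neg (by omega)]
        · rw [if_neg (by omega), if_pos (by omega), attachTab, if_neg (by omega),
            Nat.add_sub_cancel, max_eq_left (by linarith)]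
        · rw [if_pos (by omega), if_pos (by omega)]
      · simp [Function.update_of_ne hvu]
  · rintro s' - ⟨-, e13, -, hh, hclk⟩
    refine ⟨by simp [e13], ?_, ?_⟩
    · refine hh.congr (fun _ _ => rfl) fun v hv j hj => ?_
      by_cases hvu : v = u
      · subst hvu
        simp only [Function.update_self]
        split_ifs with hj
        · rfl
        · obtain rfl : j = 0 := by omega
          simp [attachTab]
      · simp [Function.update_of_ne hvu]
    · simp only
      rw [add_mul m 1]
      omega
  · refine ⟨by omega, by simp, by simp [Function.update_apply], ?_, by simp⟩
    refine hmem.congr (fun _ _ => rfl) fun v hv j hj => ?_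
    by_cases hvu : v = u
    · subst hvu
      rw [Function.update_self, if_neg (by omega)]
    · rw [Function.update_of_ne hvu]

/-! ### Merging a leaf into its neighbor -/

/-- One step of the inner loop of `convBody`. -/
def convStep : Cmd := .block [.load 16 22, .load 17 23,
  .ite 16 (.ite 17 (.block [.add 16 16 17, .sub 16 16 6, .sub 19 16 24,
    .ite 19 (.add 24 16 2) .skip]) .skip) .skip,
  .add 22 22 3, .sub 23 23 3, .sub 25 25 1]

/-- Computes one entry of the convolution. -/
def convBody : Cmd := .block [.const 24 0, .add 22 9 21, .add 23 15 2, .add 25 13 2,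
  .loop 25 convStep, .store 14 24, .sub 14 14 3, .sub 15 15 3, .sub 13 13 1]

/-- Replaces the table of the vertex in register 21 by its convolution with the table of the
vertex in register 20. -/
def convBlock : Cmd := .block [.add 14 9 21, .add 14 14 7, .add 15 9 20, .add 15 15 7, .add 13 3 2,
  .loop 13 convBody]

/-- A crude bound, `M * (m + 2) + M * (j - m + 2) - M`, that is needed only against overflow. -/
theorem convTo_le {M : ℤ} (hM : 0 ≤ M) {f g : ℕ → ℤ} {j : ℕ}
    (hf : ∀ i ≤ j, f i ≤ M * (i + 2)) (hg : ∀ i ≤ j, g i ≤ M * (i + 2)) :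
    ∀ m ≤ j + 1, convTo M f g j m ≤ M * (j + 3) := by
  intro m hm
  induction m with
  | zero => rw [convTo]; positivity
  | succ m ih =>
    rw [convTo]
    split_ifs
    · refine max_le (ih (by omega)) ?_
      have h₁ := hf m (by omega)
      have h₂ := hg (j - m) (by omega)
      rw [Nat.cast_sub (by omega)] at h₂
      linarith
    · exact ih (by omega)

/-- One pointer climbs in the column of `v` while the other descends in that of `u`, so their
indices always sum to `j`. -/
theorem ensures_convLoop {B M : ℤ} {s : State} {n u v j : ℕ} {f g : ℕ → ℤ}
    (hB : Suffices n M B) (henv : Env n M s.reg) (hu : u < n) (hv : v < n) (hj : j < n)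
    (hf : ∀ i ≤ j, s.mem (tabAddr n v i) = f i) (hg : ∀ i ≤ j, s.mem (tabAddr n u i) = g i)
    (hf₀ : ∀ i ≤ j, 0 ≤ f i ∧ f i ≤ M * (i + 2)) (hg₀ : ∀ i ≤ j, 0 ≤ g i ∧ g i ≤ M * (i + 2))
    (h22 : s.reg 22 = (tabAddr n v 0 : ℕ)) (h23 : s.reg 23 = (tabAddr n u j : ℕ))
    (h24 : s.reg 24 = 0) (h25 : s.reg 25 = ((j + 1 : ℕ) : ℤ)) :
    Ensures B (.loop 25 convStep) s fun s' => s'.reg 24 = convTab M f g j ∧ s'.mem = s.mem ∧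
      s'.clock ≤ s.clock + 20 * j + 22 := by
  have hM := hB.modulus_pos
  -- The descending pointer is described by an integer difference, since it ends one row below the
  -- table.
  refine ensures_loop (fun k s' => k ≤ j + 1 ∧ s'.reg 25 = (k : ℤ) ∧
    s'.reg 22 = (tabAddr n v (j + 1 - k) : ℕ) ∧
    s'.reg 23 = (tabAddr n u j : ℕ) - ((j + 1 - k : ℕ) : ℤ) * n ∧
    s'.reg 24 = convTo M f g j (j + 1 - k) ∧ s'.mem = s.mem ∧
    s'.clock + 20 * k ≤ s.clock + 20 * j + 20) (j + 1) ?_ ?_ ?_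
  · rintro k s' hfr ⟨hk, e25, e22, e23, e24, emem, hclk⟩
    have henv' : Env n M s'.reg := henv.frame hfr (by decide)
    obtain ⟨m, hm⟩ : ∃ m, m + k = j := ⟨j - k, by omega⟩
    have hm' : j + 1 - (k + 1) = m := by omega
    have hm'' : j + 1 - k = m + 1 := by omega
    rw [hm'] at e22 e23 e24
    have e23' : s'.reg 23 = (tabAddr n u (j - m) : ℕ) := by
      rw [e23]
      unfold tabAddr
      have : (j : ℤ) = m + k := by omega
      have h' : j - m = k := by omega
      rw [h']
      push_cast
      rw [this]
      ring
    have a22 : ((tabAddr n v m : ℕ) : ℤ) + n = (tabAddr n v (m + 1) : ℕ) := by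
      unfold tabAddr; push_cast; ring
    have a25 : ((k + 1 : ℕ) : ℤ) - 1 = k := by push_cast; ring
    have a23 : ((tabAddr n u (j - m) : ℕ) : ℤ) - n =
        (tabAddr n u j : ℕ) - ((m + 1 : ℕ) : ℤ) * n := by
      rw [← e23', e23]; push_cast; ring
    have hjm : j - m = k := by omega
    have f₀ := hf₀ m (by omega)
    have g₀ := hg₀ (j - m) (by omega)
    have c₀ := convTo_nonneg (M := M) f g j m
    have c₁ := convTo_le hM.le (fun i hi => (hf₀ i hi).2) (fun i hi => (hg₀ i hi).2) m (by omega)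
    have fg : f m + g (j - m) ≤ M * j + M * 4 := by
      have h₁ := f₀.2
      have h₂ := g₀.2
      rw [Nat.cast_sub (by omega)] at h₂
      linarith
    have hjn : M * (j : ℤ) ≤ M * n := mul_le_mul_of_nonneg_left (by omega) hM.le
    have hb22 : |((tabAddr n v (m + 1) : ℕ) : ℤ)| ≤ B := hB.abs_tabAddr_le hv (by omega)
    have hb23 : |((tabAddr n u (j - m) : ℕ) : ℤ) - n| ≤ B := hB.abs_tabAddr_sub_le hu (by omega)
    have hb25 : |(k : ℤ)| ≤ B := hB.abs_natCast_le (by omega)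
    rw [a23] at hb23
    rw [mul_add] at c₁
    refine ⟨by rw [e25]; positivity, ?_⟩
    have hstep : convTo M f g j (m + 1) =
      if 0 < f m ∧ 0 < g (j - m) then max (convTo M f g j m) (f m + g (j - m) - M)
      else convTo M f g j m := by rw [convTo]
    unfold convStep
    simp only [ensures_block_cons, ensures_block_nil, ensures_add, ensures_sub, ensures_load,
      ensures_ite, ensures_skip, Function.update_apply, e22, e23', e24, e25, emem, hm'', a22, a23,
      a25, henv'.size, henv'.zero, henv'.one, henv'.modulus, reduceIte, Nat.reduceEqDiff, add_zero,
      Int.toNat_natCast, hf m (by omega), hg (j - m) (by omega)]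
    refine ⟨fun h₁ => ⟨fun h₂ => ⟨hB.abs_le_value (by linarith) (by linarith),
      hB.abs_le_value (by linarith) (by linarith), hB.abs_le_value (by linarith) (by linarith),
      fun h₃ => ⟨hB.abs_le_value (by linarith) (by linarith), hb22, hb23, hb25, by omega, trivial,
        trivial, trivial, ?_, trivial, by omega⟩,
      fun h₃ => ⟨hb22, hb23, hb25, by omega, trivial, trivial, trivial, ?_, trivial, by omega⟩⟩,
      fun h₂ => ⟨hb22, hb23, hb25, by omega, trivial, trivial, trivial, ?_, trivial, by omega⟩⟩,
      fun h₁ => ⟨hb22, hb23, hb25, by omega, trivial, trivial, trivial, ?_, trivial, by omega⟩⟩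
    · rw [hstep, if_pos ⟨h₁, h₂⟩, max_eq_right (by linarith)]
    · rw [hstep, if_pos ⟨h₁, h₂⟩, max_eq_left (by linarith)]
    · rw [hstep, if_neg fun hc => h₂ hc.2]
    · rw [hstep, if_neg fun hc => h₁ hc.1]
  · rintro s' - ⟨-, e25, -, -, e24, emem, hclk⟩
    exact ⟨by simp [e25], e24, emem, by simp only; omega⟩
  · refine ⟨le_rfl, h25, by simpa using h22, by simpa using h23, by simpa [convTo] using h24, rfl,
      by omega⟩

/-- Entry `j` of the convolution uses only entries up to `j` of both tables, so it can be written in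
place from the top down. -/
theorem ensures_convBlock {B M : ℤ} {s : State} {n u v : ℕ} {inp deg : ℕ → ℤ} {tab : ℕ → ℕ → ℤ}
    (hB : Suffices n M B) (henv : Env n M s.reg) (hmem : Holds n inp deg tab s.mem)
    (hu : u < n) (hv : v < n) (huv : u ≠ v) (h20 : s.reg 20 = u) (h21 : s.reg 21 = v)
    (hf₀ : ∀ j < n, 0 ≤ tab v j ∧ tab v j ≤ M * (j + 2))
    (hg₀ : ∀ j < n, 0 ≤ tab u j ∧ tab u j ≤ M * (j + 2)) :
    Ensures B convBlock s fun s' =>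
      Holds n inp deg (Function.update tab v (convTab M (tab v) (tab u))) s'.mem ∧
      s'.clock ≤ s.clock + 7 + n * (20 * n + 40) := by
  have hn := hB.size_pos
  have hM := hB.modulus_pos
  obtain ⟨m, rfl⟩ : ∃ m, n = m + 1 := ⟨n - 1, by omega⟩
  have e0 : ∀ w : ℕ, ((5 * (m + 1) + 2 : ℕ) : ℤ) + w + ((m * (m + 1) : ℕ) : ℤ) =
      (tabAddr (m + 1) w m : ℕ) := by
    intro w; unfold tabAddr; push_cast; ring
  have e1 : ∀ w : ℕ, ((5 * (m + 1) + 2 : ℕ) : ℤ) + w = (tabAddr (m + 1) w 0 : ℕ) := by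
    intro w; unfold tabAddr; push_cast; ring
  unfold convBlock
  simp only [ensures_block_cons, ensures_block_nil, ensures_add, henv.tab, henv.top, henv.size,
    henv.zero, h20, h21, Function.update_apply, reduceIte, Nat.reduceEqDiff, add_zero,
    Nat.add_sub_cancel, e0]
  rw [e1, e1]
  refine ⟨hB.abs_tabAddr_le hv (by omega), hB.abs_tabAddr_le hv (by omega),
    hB.abs_tabAddr_le hu (by omega), hB.abs_tabAddr_le hu (by omega), hB.abs_natCast_le (by omega), ?_⟩
  -- Rows from `k` on are finished; the pointers stand one row lower, at the next entry to compute.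
  refine ensures_loop (fun k s' => k ≤ m + 1 ∧ s'.reg 13 = (k : ℤ) ∧
    s'.reg 14 = (tabAddr (m + 1) v k : ℕ) - ((m + 1 : ℕ) : ℤ) ∧
    s'.reg 15 = (tabAddr (m + 1) u k : ℕ) - ((m + 1 : ℕ) : ℤ) ∧
    Holds (m + 1) inp deg (Function.update tab v (fun j => if k ≤ j then
      convTab M (tab v) (tab u) j else tab v j)) s'.mem ∧
    s'.clock + k * (20 * (m + 1) + 40) ≤ s.clock + 5 + (m + 1) * (20 * (m + 1) + 40))
    (m + 1) ?_ ?_ ?_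
  · rintro k s' hf ⟨hk, e13, e14, e15, hh, hclk⟩
    rw [tabAddr_succ_sub] at e14 e15
    have henv' : Env (m + 1) M s'.reg := by
      refine Env.frame (c := convBody) ?_ hf (by decide)
      exact ((((henv.update (by norm_num) _).update (by norm_num) _).update (by norm_num)
        _).update (by norm_num) _).update (by norm_num) _
    have e20 : s'.reg 20 = u := by
      rw [hf 20 (by decide)]; simp [Function.update_apply, h20]
    have e21 : s'.reg 21 = v := by
      rw [hf 21 (by decide)]; simp [Function.update_apply, h21]
    refine ⟨by rw [e13]; positivity, ?_⟩
    have hb13 : |((k + 1 : ℕ) : ℤ)| ≤ B := hB.abs_natCast_le (by omega)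
    have hb13' : |(k : ℤ)| ≤ B := hB.abs_natCast_le (by omega)
    have hb0 : |(0 : ℤ)| ≤ B := by exact_mod_cast hB.abs_natCast_le (a := 0) (by omega)
    unfold convBody
    simp only [ensures_block_cons, ensures_block_nil, ensures_add, ensures_sub, ensures_const,
      ensures_store, Function.update_apply, e13, e14, e15, e20, e21, henv'.tab, henv'.zero,
      reduceIte, Nat.reduceEqDiff, add_zero, e1]
    refine ⟨hb0, hB.abs_tabAddr_le hv (by omega), hB.abs_tabAddr_le hu (by omega), hb13, ?_⟩
    have henv₂ : Env (m + 1) M (Function.update (Function.update (Function.update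
        (Function.update s'.reg 24 0) 22 (tabAddr (m + 1) v 0 : ℕ)) 23
        (tabAddr (m + 1) u k : ℕ)) 25 ((k + 1 : ℕ) : ℤ)) :=
      (((henv'.update (by norm_num) _).update (by norm_num) _).update (by norm_num)
        _).update (by norm_num) _
    refine (ensures_convLoop (f := tab v) (g := tab u) (j := k) hB henv₂ hu hv (by omega) ?_ ?_
      (fun i hi => hf₀ i (by omega)) (fun i hi => hg₀ i (by omega)) (by simp [Function.update_apply])
      (by simp [Function.update_apply]) (by simp [Function.update_apply]) (by simp)).mono ?_
    · intro i hi
      simp only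
      rw [hh.tab v hv i (by omega), Function.update_self, if_neg (by omega)]
    · intro i hi
      simp only
      rw [hh.tab u hu i (by omega), Function.update_of_ne huv]
    rintro s₂ hf₂ ⟨d24, dmem, dclk⟩
    have henv₃ : Env (m + 1) M s₂.reg := henv₂.frame (c := .loop 25 convStep) hf₂ (by decide)
    have d13 : s₂.reg 13 = ((k + 1 : ℕ) : ℤ) := by
      rw [hf₂ 13 (by decide)]; simp [Function.update_apply, e13]
    have d14 : s₂.reg 14 = (tabAddr (m + 1) v k : ℕ) := by
      rw [hf₂ 14 (by decide)]; simp [Function.update_apply, e14]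
    have d15 : s₂.reg 15 = (tabAddr (m + 1) u k : ℕ) := by
      rw [hf₂ 15 (by decide)]; simp [Function.update_apply, e15]
    simp only at dmem dclk
    have a13 : ((k + 1 : ℕ) : ℤ) - 1 = k := by push_cast; ring
    have hb : ∀ w < m + 1, |((tabAddr (m + 1) w k : ℕ) : ℤ) - ((m + 1 : ℕ) : ℤ)| ≤ B :=
      fun w hw => hB.abs_tabAddr_sub_le hw (by omega)
    simp only [ensures_block_cons, ensures_block_nil, ensures_sub, ensures_store,
      Function.update_apply, d13, d14, d15, d24, dmem, henv₃.size, henv₃.one,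
      reduceIte, Nat.reduceEqDiff, Int.toNat_natCast, a13]
    refine ⟨hb v hv, hb u hu, hb13', by omega, trivial, trivial, trivial, ?_, ?_⟩
    · refine (hh.store_tab (j := k) hv (convTab M (tab v) (tab u) k)).congr (fun _ _ => rfl)
        fun w hw j hj => ?_
      by_cases hwv : w = v
      · subst hwv
        simp only [Function.update_self, Function.update_apply]
        rcases lt_trichotomy j k with h | rfl | h
        · rw [if_neg (by omega), if_neg (by omega), if_neg (by omega)]
        · rw [if_pos rfl, if_pos le_rfl]
        · rw [if_neg (by omega), if_pos (by omega), if_pos (by omega)]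
      · simp [Function.update_of_ne hwv]
    · rw [add_mul] at hclk
      omega
  · rintro s' - ⟨-, e13, -, -, hh, hclk⟩
    refine ⟨by simp [e13], ?_, ?_⟩
    · simpa using hh
    · simp only
      omega
  · refine ⟨le_rfl, by simp, ?_, ?_, ?_, by simp⟩
    · simp [Function.update_apply, tabAddr_succ_sub, ← tabAddr_succ_sub (m + 1) v m]
    · simp [Function.update_apply, tabAddr_succ_sub, ← tabAddr_succ_sub (m + 1) u m]
    · refine hmem.congr (fun _ _ => rfl) fun w hw j hj => ?_
      by_cases hwv : w = v
      · subst hwv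
        rw [Function.update_self, if_neg (by omega)]
      · rw [Function.update_of_ne hwv]

/-! ### Finding a leaf -/

/-- One step of `scanBlock`. -/
def scanBody : Cmd := .block [.load 16 14, .add 14 14 1, .load 26 14, .add 14 14 1,
  .add 17 8 16, .load 17 17, .add 18 8 26, .load 18 18, .sub 19 17 1,
  .ite 19 (.block [.add 27 16 2, .add 16 26 2, .add 26 27 2, .add 27 17 2, .add 17 18 2,
    .add 18 27 2]) .skip,
  .sub 19 17 1,
  .ite 19 .skip (.ite 17 (.ite 18 (.block [.add 20 16 2, .add 21 26 2]) .skip) .skip),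
  .sub 13 13 1]

/-- Finds an edge with an end of degree one; this end is put into register 20, and the other end
into register 21. -/
def scanBlock : Cmd := .block [.add 14 10 2, .add 13 11 2, .loop 13 scanBody]

/-- `a` and `b` are the ends of the edge number `t`, and `a` has degree one. -/
structure IsGoodEdge (deg : ℕ → ℤ) (ea eb : ℕ → ℕ) (t a b : ℕ) : Prop where
  ends : (a = ea t ∧ b = eb t) ∨ (a = eb t ∧ b = ea t)
  left : deg a = 1
  right : 0 < deg b

/-- The edges in the input: the ends of the edge number `t` are `ea t` and `eb t`. -/
def ListsEdges (n : ℕ) (inp : ℕ → ℤ) (ea eb : ℕ → ℕ) : Prop :=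
  ∀ t, t + 1 < n → inp (4 + 2 * n + 2 * t) = ea t ∧ inp (4 + 2 * n + 2 * t + 1) = eb t ∧
    ea t < n ∧ eb t < n

theorem Suffices.abs_le_linear {n : ℕ} {M B : ℤ} (h : Suffices n M B) {x : ℤ}
    (h₁ : -(20 * n + 100) ≤ x) (h₂ : x ≤ 20 * n + 100) : |x| ≤ B :=
  h.abs_le (by linarith [mul_nonneg (Nat.cast_nonneg (α := ℤ) n) (Nat.cast_nonneg n)])
    (by linarith [mul_nonneg (Nat.cast_nonneg (α := ℤ) n) (Nat.cast_nonneg n)])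

/-- The ends are swapped if the first has degree above one. This misses nothing: otherwise, in a
good edge, the first end has positive degree at most one and can serve as the leaf. -/
theorem ensures_scanBody {B M : ℤ} {s : State} {n t k : ℕ} {inp deg : ℕ → ℤ} {tab : ℕ → ℕ → ℤ}
    {ea eb : ℕ → ℕ} (hB : Suffices n M B) (henv : Env n M s.reg) (hmem : Holds n inp deg tab s.mem)
    (hE : ListsEdges n inp ea eb) (hdeg : ∀ v < n, 0 ≤ deg v ∧ deg v ≤ n + 1)
    (ht : t + 1 < n) (hk : k < n) (h13 : s.reg 13 = (k + 1 : ℕ))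
    (h14 : s.reg 14 = (4 + 2 * n + 2 * t : ℕ)) :
    Ensures B scanBody s fun s' => s'.reg 13 = (k : ℕ) ∧
      s'.reg 14 = (4 + 2 * n + 2 * (t + 1) : ℕ) ∧ s'.mem = s.mem ∧ s'.clock ≤ s.clock + 30 ∧
      ((∃ a b, IsGoodEdge deg ea eb t a b ∧ s'.reg 20 = a ∧ s'.reg 21 = b) ∨
        ((∀ a b, ¬ IsGoodEdge deg ea eb t a b) ∧ s'.reg 20 = s.reg 20 ∧
          s'.reg 21 = s.reg 21)) := by
  obtain ⟨hia, hib, ha, hb⟩ := hE t ht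
  have l₁ : s.mem (4 + 2 * n + 2 * t) = ea t := by rw [hmem.input _ (by omega), hia]
  have l₂ : s.mem (4 + 2 * n + 2 * t + 1) = eb t := by rw [hmem.input _ (by omega), hib]
  have l₃ := hmem.deg _ ha
  have l₄ := hmem.deg _ hb
  have da := hdeg _ ha
  have db := hdeg _ hb
  have c₁ : ((4 + 2 * n + 2 * t : ℕ) : ℤ) + 1 = (4 + 2 * n + 2 * t + 1 : ℕ) := by push_cast; ring
  have c₂ : ((4 + 2 * n + 2 * t + 1 : ℕ) : ℤ) + 1 = (4 + 2 * n + 2 * (t + 1) : ℕ) := by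
    push_cast; ring
  have c₃ : ∀ w : ℕ, ((4 * n + 2 : ℕ) : ℤ) + w = (4 * n + 2 + w : ℕ) := by
    intro w; push_cast; ring
  have c₄ : ((k + 1 : ℕ) : ℤ) - 1 = k := by push_cast; ring
  have b₁ : |((4 + 2 * n + 2 * t + 1 : ℕ) : ℤ)| ≤ B := hB.abs_natCast_le (by omega)
  have b₂ : |((4 + 2 * n + 2 * (t + 1) : ℕ) : ℤ)| ≤ B := hB.abs_natCast_le (by omega)
  have b₃ : |((4 * n + 2 + ea t : ℕ) : ℤ)| ≤ B := hB.abs_natCast_le (by omega)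
  have b₄ : |((4 * n + 2 + eb t : ℕ) : ℤ)| ≤ B := hB.abs_natCast_le (by omega)
  have b₅ : |deg (ea t) - 1| ≤ B := hB.abs_le_linear (by linarith) (by linarith)
  have b₆ : |deg (eb t) - 1| ≤ B := hB.abs_le_linear (by linarith) (by linarith)
  have b₇ : |(ea t : ℤ)| ≤ B := hB.abs_natCast_le (by omega)
  have b₈ : |(eb t : ℤ)| ≤ B := hB.abs_natCast_le (by omega)
  have b₉ : |(k : ℤ)| ≤ B := hB.abs_natCast_le (by omega)
  have b₁₀ : |deg (ea t)| ≤ B := hB.abs_le_linear (by linarith) (by linarith)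
  have b₁₁ : |deg (eb t)| ≤ B := hB.abs_le_linear (by linarith) (by linarith)
  unfold scanBody
  simp only [ensures_block_cons, ensures_block_nil, ensures_add, ensures_sub, ensures_load,
    ensures_ite, ensures_skip, Function.update_apply, h13, h14, henv.one, henv.zero, henv.deg,
    reduceIte, Nat.reduceEqDiff, add_zero, Int.toNat_natCast, c₁, c₂, c₃, c₄, l₁, l₂, l₃, l₄]
  refine ⟨b₁, b₂, b₃, b₄, b₅, fun h₁ => ⟨b₇, b₈, b₇, b₁₀, b₁₁, b₁₀, b₆, fun h₂ => ?_,
    fun h₂ => ⟨fun h₃ => ⟨fun h₄ => ?_, fun h₄ => ?_⟩, fun h₃ => ?_⟩⟩,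
    fun h₁ => ⟨b₅, fun h₂ => absurd h₂ h₁, fun h₂ => ⟨fun h₃ => ⟨fun h₄ => ?_, fun h₄ => ?_⟩,
      fun h₃ => ?_⟩⟩⟩
  · refine ⟨b₉, trivial, trivial, trivial, by omega, .inr ⟨?_, trivial, trivial⟩⟩
    rintro a b ⟨⟨rfl, rfl⟩ | ⟨rfl, rfl⟩, h₅, h₆⟩ <;> omega
  · exact ⟨b₈, b₇, b₉, trivial, trivial, trivial, by omega,
      .inl ⟨_, _, ⟨.inr ⟨rfl, rfl⟩, by omega, by omega⟩, rfl, rfl⟩⟩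
  · refine ⟨b₉, trivial, trivial, trivial, by omega, .inr ⟨?_, trivial, trivial⟩⟩
    rintro a b ⟨⟨rfl, rfl⟩ | ⟨rfl, rfl⟩, h₅, h₆⟩ <;> omega
  · refine ⟨b₉, trivial, trivial, trivial, by omega, .inr ⟨?_, trivial, trivial⟩⟩
    rintro a b ⟨⟨rfl, rfl⟩ | ⟨rfl, rfl⟩, h₅, h₆⟩ <;> omega
  · exact ⟨b₇, b₈, b₉, trivial, trivial, trivial, by omega,
      .inl ⟨_, _, ⟨.inl ⟨rfl, rfl⟩, by omega, by omega⟩, rfl, rfl⟩⟩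
  · refine ⟨b₉, trivial, trivial, trivial, by omega, .inr ⟨?_, trivial, trivial⟩⟩
    rintro a b ⟨⟨rfl, rfl⟩ | ⟨rfl, rfl⟩, h₅, h₆⟩ <;> omega
  · refine ⟨b₉, trivial, trivial, trivial, by omega, .inr ⟨?_, trivial, trivial⟩⟩
    rintro a b ⟨⟨rfl, rfl⟩ | ⟨rfl, rfl⟩, h₅, h₆⟩ <;> omega

/-- The scan does not stop early; a later good edge overwrites an earlier one, and any of them will
do. -/
theorem ensures_scanBlock {B M : ℤ} {s : State} {n : ℕ} {inp deg : ℕ → ℤ} {tab : ℕ → ℕ → ℤ}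
    {ea eb : ℕ → ℕ} (hB : Suffices n M B) (henv : Env n M s.reg) (hmem : Holds n inp deg tab s.mem)
    (hE : ListsEdges n inp ea eb) (hdeg : ∀ v < n, 0 ≤ deg v ∧ deg v ≤ n + 1)
    (hex : ∃ t a b, t + 1 < n ∧ IsGoodEdge deg ea eb t a b) :
    Ensures B scanBlock s fun s' => s'.mem = s.mem ∧ s'.clock ≤ s.clock + 4 + n * 32 ∧
      ∃ t a b, t + 1 < n ∧ IsGoodEdge deg ea eb t a b ∧ s'.reg 20 = a ∧ s'.reg 21 = b := by
  have hn := hB.size_pos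
  obtain ⟨m, rfl⟩ : ∃ m, n = m + 1 := ⟨n - 1, by omega⟩
  unfold scanBlock
  simp only [ensures_block_cons, ensures_block_nil, ensures_add, henv.edges, henv.pred,
    henv.zero, Function.update_apply, reduceIte, Nat.reduceEqDiff, add_zero, Nat.add_sub_cancel]
  refine ⟨hB.abs_natCast_le (by omega), hB.abs_natCast_le (by omega), ?_⟩
  refine ensures_loop (fun k s' => k ≤ m ∧ s'.reg 13 = (k : ℕ) ∧
    s'.reg 14 = (4 + 2 * (m + 1) + 2 * (m - k) : ℕ) ∧ s'.mem = s.mem ∧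
    s'.clock + 32 * k ≤ s.clock + 2 + 32 * m ∧
    ((∃ t < m - k, ∃ a b, IsGoodEdge deg ea eb t a b) →
      ∃ t a b, t < m ∧ IsGoodEdge deg ea eb t a b ∧ s'.reg 20 = a ∧ s'.reg 21 = b)) m ?_ ?_ ?_
  · rintro k s' hf ⟨hk, e13, e14, emem, hclk, hfound⟩
    have henv' : Env (m + 1) M s'.reg :=
      ((henv.update (by norm_num) _).update (by norm_num) _).frame hf (by decide)
    refine ⟨by rw [e13]; positivity, ?_⟩
    have hmk : m - (k + 1) + 1 = m - k := by omega
    refine (ensures_scanBody (s := ⟨s'.reg, s'.mem, s'.clock + 2⟩) (t := m - (k + 1)) (k := k) hB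
      henv' (by simp only [emem]; exact hmem) hE hdeg (by omega) (by omega) e13 e14).mono ?_
    rintro s₂ - ⟨d13, d14, dmem, dclk, dfound⟩
    rw [hmk] at d14
    simp only at dmem dclk
    refine ⟨by omega, d13, d14, dmem.trans emem, by omega, ?_⟩
    rintro ⟨t, ht, hg⟩
    rcases dfound with ⟨a, b, hab, d20, d21⟩ | ⟨hno, d20, d21⟩
    · exact ⟨_, a, b, by omega, hab, d20, d21⟩
    · have : t < m - (k + 1) := by
        rcases Nat.lt_or_ge t (m - (k + 1)) with h | h
        · exact h
        · obtain rfl : t = m - (k + 1) := by omega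
          obtain ⟨a, b, hab⟩ := hg
          exact absurd hab (hno a b)
      rw [d20, d21]
      exact hfound ⟨t, this, hg⟩
  · rintro s' - ⟨-, e13, -, emem, hclk, hfound⟩
    refine ⟨by simp [e13], emem, by simp only; omega, ?_⟩
    obtain ⟨t₀, a₀, b₀, ht₀, h₀⟩ := hex
    obtain ⟨t, a, b, ht, hab⟩ := hfound ⟨t₀, by omega, a₀, b₀, h₀⟩
    exact ⟨t, a, b, by omega, hab⟩
  · refine ⟨le_rfl, by simp, by simp [Function.update_apply], rfl, by simp, ?_⟩
    rintro ⟨t, ht, -⟩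
    omega

/-! ### One round -/

/-- Updates the degrees after a leaf has been merged. -/
def degreeBlock : Cmd := .block [.add 17 8 20, .store 17 2, .add 17 8 21, .load 18 17,
  .sub 18 18 1, .store 17 18]

theorem ensures_degreeBlock {B M : ℤ} {s : State} {n u v : ℕ} {inp deg : ℕ → ℤ} {tab : ℕ → ℕ → ℤ}
    (hB : Suffices n M B) (henv : Env n M s.reg) (hmem : Holds n inp deg tab s.mem)
    (hdeg : ∀ v < n, 0 ≤ deg v ∧ deg v ≤ n + 1)
    (hu : u < n) (hv : v < n) (huv : u ≠ v) (h20 : s.reg 20 = u) (h21 : s.reg 21 = v) :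
    Ensures B degreeBlock s fun s' =>
      Holds n inp (Function.update (Function.update deg u 0) v (deg v - 1)) tab s'.mem ∧
      s'.clock ≤ s.clock + 6 := by
  have c₃ : ∀ w : ℕ, ((4 * n + 2 : ℕ) : ℤ) + w = (4 * n + 2 + w : ℕ) := by
    intro w; push_cast; ring
  have dv := hdeg v hv
  have l : Function.update s.mem (4 * n + 2 + u) 0 (4 * n + 2 + v) = deg v := by
    rw [Function.update_of_ne (by omega), hmem.deg v hv]
  unfold degreeBlock
  simp only [ensures_block_cons, ensures_block_nil, ensures_add, ensures_sub, ensures_load,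
    ensures_store, h20, h21, henv.one, henv.zero, henv.deg, Function.update_apply s.reg,
    Function.update_self, Function.update_apply (Function.update s.reg _ _),
    Function.update_apply (Function.update (Function.update s.reg _ _) _ _),
    reduceIte, Nat.reduceEqDiff, add_zero, Int.toNat_natCast, c₃, l]
  exact ⟨hB.abs_natCast_le (by omega), hB.abs_natCast_le (by omega),
    hB.abs_le_linear (by linarith) (by linarith), by
      simp only [Function.update_apply, reduceIte, Nat.reduceEqDiff, Int.toNat_natCast]
      exact (hmem.store_deg hu 0).store_deg hv (deg v - 1), by omega⟩

/-- Finds a leaf and merges it into its neighbor. -/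
def roundBlock : Cmd := .block [scanBlock, degreeBlock, attachBlock, convBlock, .sub 12 12 1]

/-- The degrees and the tables of a contraction. -/
structure IsProgress {n : ℕ} (G : SimpleGraph (Fin n)) (root : Fin n) (b : Fin n → ℤ) (M : ℤ)
    (r : Fin n → Fin n) (deg : ℕ → ℤ) (tab : ℕ → ℕ → ℤ) : Prop where
  contraction : IsContraction G root r
  deg : ∀ v : Fin n, deg v = remainingDegree G root r v
  tab : ∀ v : Fin n, r v = v → ∀ j < n, Represents (IsValue G b M (bag r v) v j) (tab v j)

theorem attachTab_bounds {M : ℤ} (hM : 0 < M) {f : ℕ → ℤ} {n : ℕ}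
    (hf : ∀ j < n, 0 ≤ f j ∧ f j ≤ M * (j + 2)) :
    ∀ j < n, 0 ≤ attachTab M f j ∧ attachTab M f j ≤ M * (j + 2) := by
  intro j hj
  unfold attachTab
  split_ifs with h
  · subst h; exact hf 0 hj
  · refine ⟨le_max_of_le_left (hf j hj).1, max_le (hf j hj).2 ?_⟩
    refine mul_le_mul_of_nonneg_left ((ceilDiv_le_iff hM).2 ?_) hM.le
    refine (hf (j - 1) (by omega)).2.trans (mul_le_mul_of_nonneg_left ?_ hM.le)
    rw [Nat.cast_sub (by omega)]
    linarith

namespace IsProgress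

variable {n : ℕ} {G : SimpleGraph (Fin n)} {root : Fin n} {b : Fin n → ℤ} {M : ℤ}
  {r : Fin n → Fin n} {deg : ℕ → ℤ} {tab : ℕ → ℕ → ℤ}

theorem deg_bounds (h : IsProgress G root b M r deg tab) :
    ∀ v < n, 0 ≤ deg v ∧ deg v ≤ n + 1 := by
  intro v hv
  rw [h.deg ⟨v, hv⟩]
  refine ⟨by positivity, ?_⟩
  have h₁ : (remainingNeighbors G r ⟨v, hv⟩).card ≤ n := by
    simpa using Finset.card_le_univ (remainingNeighbors G r ⟨v, hv⟩)
  unfold remainingDegree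
  push_cast
  split_ifs <;> omega

/-- The attached table left at `u` is harmless, because nothing is claimed about vertices that have
been merged away. -/
theorem merge (hM : ∀ A : Finset (Fin n), |∑ v ∈ A, b v| < M)
    (h : IsProgress G root b M r deg tab) {u v : Fin n} (huv : IsLeafEdge G root r u v) :
    IsProgress G root b M (mergeInto r u v)
      (Function.update (Function.update deg u 0) v (deg v - 1))
      (Function.update (Function.update tab u (attachTab M (tab u))) v
        (convTab M (tab v) (attachTab M (tab u)))) where
  contraction := huv.isContraction_mergeInto h.contraction
  deg x := by
    have hne : (u : ℕ) ≠ v := fun hc => huv.adj.ne (Fin.ext hc)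
    by_cases hxv : x = v
    · subst hxv
      have h₁ := huv.degree_mergeInto_right h.contraction
      rw [Function.update_self, h.deg, h₁]
      push_cast
      ring
    · by_cases hxu : x = u
      · subst hxu
        rw [Function.update_of_ne hne, Function.update_self,
          huv.degree_mergeInto_left h.contraction]
        rfl
      · rw [Function.update_of_ne (fun hc => hxv (Fin.ext hc)),
          Function.update_of_ne (fun hc => hxu (Fin.ext hc)), h.deg,
          huv.degree_mergeInto_of_ne h.contraction hxu hxv]
  tab x hx j hj := by
    obtain ⟨hrx, hxu⟩ := (huv.mergeInto_eq_self_iff h.contraction).1 hx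
    by_cases hxv : x = v
    · subst hxv
      rw [Function.update_self, huv.bag_mergeInto_right]
      exact (huv.isJoin h.contraction).represents_convTab hM (h.tab x hrx)
        (represents_attachTab hM (h.tab u (huv.fixed_left h.contraction))) j hj
    · rw [Function.update_of_ne (fun hc => hxv (Fin.ext hc)),
        Function.update_of_ne (fun hc => hxu (Fin.ext hc)),
        IsLeafEdge.bag_mergeInto_of_ne hxu hxv]
      exact h.tab x hrx j hj

end IsProgress

/-- The edges number `0, …, n - 2` are the edges of `G`. -/
def EnumeratesEdges {n : ℕ} (G : SimpleGraph (Fin n)) (ea eb : ℕ → ℕ) : Prop :=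
  ∀ a b : Fin n, G.Adj a b ↔
    ∃ t, t + 1 < n ∧ (((a : ℕ) = ea t ∧ (b : ℕ) = eb t) ∨ ((a : ℕ) = eb t ∧ (b : ℕ) = ea t))

theorem ensures_roundBlock {B M : ℤ} {s : State} {n k : ℕ} {inp deg : ℕ → ℤ} {tab : ℕ → ℕ → ℤ}
    {ea eb : ℕ → ℕ} {G : SimpleGraph (Fin n)} {root : Fin n} {b : Fin n → ℤ} {r : Fin n → Fin n}
    (hB : Suffices n M B) (henv : Env n M s.reg) (hmem : Holds n inp deg tab s.mem)
    (hE : ListsEdges n inp ea eb) (hG : G.IsTree) (hGE : EnumeratesEdges G ea eb)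
    (hM : ∀ A : Finset (Fin n), |∑ v ∈ A, b v| < M)
    (hp : IsProgress G root b M r deg tab) (hk : k < n) (hr : (remaining r).card = k + 2)
    (h12 : s.reg 12 = (k + 1 : ℕ)) :
    Ensures B roundBlock s fun s' => s'.reg 12 = (k : ℕ) ∧
      s'.clock ≤ s.clock + 25 * (n * n) + 102 * n + 23 ∧
      ∃ r deg tab, Holds n inp deg tab s'.mem ∧ IsProgress G root b M r deg tab ∧
        (remaining r).card = k + 1 := by
  have hM₀ := hB.modulus_pos
  unfold roundBlock
  simp only [ensures_block_cons, ensures_block_nil]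
  refine (ensures_scanBlock hB henv hmem hE hp.deg_bounds ?_).mono ?_
  · obtain ⟨u, v, huv⟩ := hp.contraction.exists_isLeafEdge hG (by omega)
    obtain ⟨t, ht, hends⟩ := (hGE u v).1 huv.adj
    refine ⟨t, u, v, ht, hends, ?_, ?_⟩
    · rw [hp.deg, huv.deg_left]; rfl
    · rw [hp.deg]; exact_mod_cast huv.deg_right
  rintro s₁ hf₁ ⟨mem₁, clk₁, t, u, v, ht, hgood, r20, r21⟩
  obtain ⟨-, -, hat, hbt⟩ := hE t ht
  have hu : u < n := by rcases hgood.ends with ⟨h, -⟩ | ⟨h, -⟩ <;> omega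
  have hv : v < n := by rcases hgood.ends with ⟨-, h⟩ | ⟨-, h⟩ <;> omega
  -- Whichever good edge the scan has returned, the stored degrees make it a leaf edge of the
  -- contraction.
  have huv : IsLeafEdge G root r ⟨u, hu⟩ ⟨v, hv⟩ := by
    refine ⟨(hGE _ _).2 ⟨t, ht, hgood.ends⟩, ?_, ?_⟩
    · have h₁ := hgood.left
      rw [hp.deg ⟨u, hu⟩] at h₁
      exact_mod_cast h₁
    · have h₁ := hgood.right
      rw [hp.deg ⟨v, hv⟩] at h₁
      exact_mod_cast h₁
  have hne : u ≠ v := fun hc => huv.adj.ne (Fin.ext hc)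
  have henv₁ : Env n M s₁.reg := henv.frame hf₁ (by decide)
  rw [← mem₁] at hmem
  refine (ensures_degreeBlock hB henv₁ hmem hp.deg_bounds hu hv hne r20 r21).mono ?_
  rintro s₂ hf₂ ⟨mem₂, clk₂⟩
  have henv₂ : Env n M s₂.reg := henv₁.frame hf₂ (by decide)
  have r20₂ : s₂.reg 20 = u := by rw [hf₂ 20 (by decide), r20]
  have r21₂ : s₂.reg 21 = v := by rw [hf₂ 21 (by decide), r21]
  have bu : ∀ j < n, 0 ≤ tab u j ∧ tab u j ≤ M * (j + 2) := fun j hj =>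
    (hp.tab ⟨u, hu⟩ (huv.fixed_left hp.contraction) j hj).bounds hM
  have bv : ∀ j < n, 0 ≤ tab v j ∧ tab v j ≤ M * (j + 2) := fun j hj =>
    (hp.tab ⟨v, hv⟩ (huv.fixed_right hp.contraction) j hj).bounds hM
  refine (ensures_attachBlock hB henv₂ mem₂ hu r20₂ bu).mono ?_
  rintro s₃ hf₃ ⟨mem₃, clk₃⟩
  have henv₃ : Env n M s₃.reg := henv₂.frame hf₃ (by decide)
  have r20₃ : s₃.reg 20 = u := by rw [hf₃ 20 (by decide), r20₂]
  have r21₃ : s₃.reg 21 = v := by rw [hf₃ 21 (by decide), r21₂]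
  refine (ensures_convBlock hB henv₃ mem₃ hu hv hne r20₃ r21₃ ?_ ?_).mono ?_
  · rw [Function.update_of_ne hne.symm]
    exact bv
  · rw [Function.update_self]
    exact attachTab_bounds hM₀ bu
  rintro s₄ hf₄ ⟨mem₄, clk₄⟩
  have henv₄ : Env n M s₄.reg := henv₃.frame hf₄ (by decide)
  have r12 : s₄.reg 12 = (k + 1 : ℕ) := by
    rw [hf₄ 12 (by decide), hf₃ 12 (by decide), hf₂ 12 (by decide), hf₁ 12 (by decide), h12]
  rw [Function.update_of_ne hne.symm, Function.update_self] at mem₄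
  have c₄ : ((k + 1 : ℕ) : ℤ) - 1 = k := by push_cast; ring
  simp only [ensures_sub, r12, henv₄.one, Function.update_apply, reduceIte, c₄]
  refine ⟨hB.abs_natCast_le (by omega), trivial, ?_, _, _, _, mem₄, hp.merge hM huv, ?_⟩
  · have e₁ : n * (20 * n + 40) = 20 * (n * n) + 40 * n := by ring
    have e₂ : n * (5 * n + 30) = 5 * (n * n) + 30 * n := by ring
    omega
  · have := huv.card_remaining hp.contraction
    omega

/-! ### The main loop -/

/-- Merges all vertices into the root. -/
def mainBlock : Cmd := .block [.add 12 11 2, .loop 12 roundBlock]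

/-- With `k` rounds to go there are `k + 1` remaining vertices. At the end the bag of the root is
everything. -/
theorem ensures_mainBlock {B M : ℤ} {s : State} {n : ℕ} {inp deg : ℕ → ℤ} {tab : ℕ → ℕ → ℤ}
    {ea eb : ℕ → ℕ} {G : SimpleGraph (Fin n)} {root : Fin n} {b : Fin n → ℤ} {r : Fin n → Fin n}
    (hB : Suffices n M B) (henv : Env n M s.reg) (hmem : Holds n inp deg tab s.mem)
    (hE : ListsEdges n inp ea eb) (hG : G.IsTree) (hGE : EnumeratesEdges G ea eb)
    (hM : ∀ A : Finset (Fin n), |∑ v ∈ A, b v| < M)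
    (hp : IsProgress G root b M r deg tab) (hr : (remaining r).card = n) :
    Ensures B mainBlock s fun s' =>
      s'.clock ≤ s.clock + 3 + n * (25 * (n * n) + 102 * n + 25) ∧
      ∃ deg tab, Holds n inp deg tab s'.mem ∧
        ∀ j < n, Represents (IsValue G b M Finset.univ root j) (tab root j) := by
  have hn := hB.size_pos
  obtain ⟨m, rfl⟩ : ∃ m, n = m + 1 := ⟨n - 1, by omega⟩
  unfold mainBlock
  simp only [ensures_block_cons, ensures_block_nil, ensures_add, henv.pred,
    henv.zero, Function.update_apply, add_zero, Nat.add_sub_cancel]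
  refine ⟨hB.abs_natCast_le (by omega), ?_⟩
  refine ensures_loop (fun k s' => k ≤ m ∧ s'.reg 12 = (k : ℕ) ∧
    s'.clock + k * (25 * ((m + 1) * (m + 1)) + 102 * (m + 1) + 25) ≤
      s.clock + 1 + m * (25 * ((m + 1) * (m + 1)) + 102 * (m + 1) + 25) ∧
    ∃ r deg tab, Holds (m + 1) inp deg tab s'.mem ∧ IsProgress G root b M r deg tab ∧
      (remaining r).card = k + 1) m ?_ ?_ ?_
  · rintro k s' hf ⟨hk, e12, hclk, r', deg', tab', hmem', hp', hr'⟩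
    have henv' : Env (m + 1) M s'.reg := (henv.update (by norm_num) _).frame hf (by decide)
    refine ⟨by rw [e12]; positivity, ?_⟩
    refine (ensures_roundBlock (s := ⟨s'.reg, s'.mem, s'.clock + 2⟩) (k := k) hB henv' hmem' hE hG
      hGE hM hp' (by omega) hr' e12).mono ?_
    rintro s₂ - ⟨d12, dclk, dp⟩
    simp only at dclk
    refine ⟨by omega, d12, ?_, dp⟩
    rw [add_mul k 1] at hclk
    omega
  · rintro s' - ⟨-, e12, hclk, r', deg', tab', hmem', hp', hr'⟩
    refine ⟨by simp [e12], ?_, deg', tab', hmem', ?_⟩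
    · simp only
      rw [add_mul m 1]
      omega
    · rw [← hp'.contraction.bag_root (by omega)]
      exact hp'.tab root hp'.contraction.root
  · exact ⟨le_rfl, by simp, by simp, r, deg, tab, hmem, hp, hr⟩

/-! ### Setting up the tables -/

/-- One step of `weightBlock`. -/
def weightBody : Cmd := .block [.load 17 14, .add 6 6 17, .add 7 7 3, .add 14 14 1, .sub 13 13 1]

/-- Computes the modulus and the constants of `Env`. -/
def weightBlock : Cmd := .block [.const 6 1, .const 7 0, .const 14 4, .add 13 3 2,
  .loop 13 weightBody, .sub 7 7 3, .sub 11 3 1, .add 10 14 3, .add 8 10 11, .add 8 8 11, .add 9 8 3]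

/-- The machine cannot multiply, so `n * n` is accumulated alongside the weights. Weights being
nonnegative, all partial sums stay below `M`. -/
theorem ensures_weightBlock {B M : ℤ} {s : State} {n : ℕ} {wt : ℕ → ℤ}
    (hB : Suffices n M B) (hwt : ∀ v < n, s.mem (4 + v) = wt v ∧ 0 ≤ wt v)
    (hM : M = 1 + ∑ v ∈ Finset.range n, wt v)
    (h1 : s.reg 1 = 1) (h2 : s.reg 2 = 0) (h3 : s.reg 3 = n) :
    Ensures B weightBlock s fun s' => Env n M s'.reg ∧ s'.mem = s.mem ∧
      s'.clock ≤ s.clock + 7 * n + 12 := by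
  have hn := hB.size_pos
  have hM₀ := hB.modulus_pos
  have hMn : 0 ≤ M * (n : ℤ) := by positivity
  have bn : ∀ a : ℕ, a ≤ n * n + 20 * n + 100 → |(a : ℤ)| ≤ B := fun a ha => hB.abs_natCast_le ha
  have b1 : |(1 : ℤ)| ≤ B := by exact_mod_cast bn 1 (by omega)
  have b0 : |(0 : ℤ)| ≤ B := by exact_mod_cast bn 0 (by omega)
  have b4 : |(4 : ℤ)| ≤ B := by exact_mod_cast bn 4 (by omega)
  unfold weightBlock
  simp only [ensures_block_cons, ensures_block_nil, ensures_const, ensures_add, ensures_sub, h2, h3,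
    Function.update_apply, reduceIte, Nat.reduceEqDiff, add_zero]
  refine ⟨b1, b0, b4, bn n (by omega), ?_⟩
  refine ensures_loop (fun k s' => ∃ t, t + k = n ∧ s'.reg 13 = (k : ℕ) ∧
    s'.reg 14 = (4 + t : ℕ) ∧ s'.reg 6 = 1 + ∑ v ∈ Finset.range t, wt v ∧
    s'.reg 7 = (t * n : ℕ) ∧ s'.mem = s.mem ∧ s'.clock + 7 * k ≤ s.clock + 4 + 7 * n) n ?_ ?_ ?_
  · rintro k s' hf ⟨t, ht, e13, e14, e6, e7, emem, hclk⟩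
    have e1 : s'.reg 1 = 1 := by rw [hf 1 (by decide)]; simp [Function.update_apply, h1]
    have e3 : s'.reg 3 = n := by rw [hf 3 (by decide)]; simp [Function.update_apply, h3]
    have l := (hwt t (by omega)).1
    have b6 : |1 + ∑ v ∈ Finset.range (t + 1), wt v| ≤ B := by
      have h₁ : ∑ v ∈ Finset.range (t + 1), wt v ≤ ∑ v ∈ Finset.range n, wt v :=
        Finset.sum_le_sum_of_subset_of_nonneg (Finset.range_subset_range.2 (by omega))
          fun v hv _ => (hwt v (Finset.mem_range.1 hv)).2
      have h₂ : 0 ≤ ∑ v ∈ Finset.range (t + 1), wt v :=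
        Finset.sum_nonneg fun v hv => (hwt v (by have := Finset.mem_range.1 hv; omega)).2
      exact hB.abs_le_value (by linarith) (by linarith)
    have a6 : 1 + ∑ v ∈ Finset.range t, wt v + wt t = 1 + ∑ v ∈ Finset.range (t + 1), wt v := by
      rw [Finset.sum_range_succ]; ring
    have a7 : ((t * n : ℕ) : ℤ) + n = ((t + 1) * n : ℕ) := by push_cast; ring
    have a14 : ((4 + t : ℕ) : ℤ) + 1 = (4 + (t + 1) : ℕ) := by push_cast; ring
    have a13 : ((k + 1 : ℕ) : ℤ) - 1 = k := by push_cast; ring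
    refine ⟨by rw [e13]; positivity, ?_⟩
    unfold weightBody
    simp only [ensures_block_cons, ensures_block_nil, ensures_load, ensures_add, ensures_sub, e1,
      e3, e13, e14, e6, e7, emem, Function.update_apply, reduceIte, Nat.reduceEqDiff,
      Int.toNat_natCast, l, a6, a7, a14, a13]
    exact ⟨b6, bn _ (by have := Nat.mul_le_mul_right n (show t + 1 ≤ n by omega); omega),
      bn _ (by omega), bn _ (by omega), t + 1, by omega, trivial, rfl, rfl, rfl,
      trivial, by omega⟩
  · rintro s' hf ⟨t, ht, e13, e14, e6, e7, emem, hclk⟩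
    have e1 : s'.reg 1 = 1 := by rw [hf 1 (by decide)]; simp [Function.update_apply, h1]
    have e2 : s'.reg 2 = 0 := by rw [hf 2 (by decide)]; simp [Function.update_apply, h2]
    have e3 : s'.reg 3 = n := by rw [hf 3 (by decide)]; simp [Function.update_apply, h3]
    obtain rfl : t = n := by omega
    obtain ⟨m, rfl⟩ : ∃ m, t = m + 1 := ⟨t - 1, by omega⟩
    refine ⟨by simp [e13], ?_⟩
    have a7 : (((m + 1) * (m + 1) : ℕ) : ℤ) - (m + 1 : ℕ) = ((m + 1 - 1) * (m + 1) : ℕ) := by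
      rw [Nat.add_sub_cancel]; push_cast; ring
    have a11 : ((m + 1 : ℕ) : ℤ) - 1 = (m + 1 - 1 : ℕ) := by rw [Nat.add_sub_cancel]; push_cast; ring
    have a10 : ((4 + (m + 1) : ℕ) : ℤ) + (m + 1 : ℕ) = (4 + 2 * (m + 1) : ℕ) := by push_cast; ring
    have a8 : ((4 + 2 * (m + 1) : ℕ) : ℤ) + (m + 1 - 1 : ℕ) = (4 + 2 * (m + 1) + m : ℕ) := by
      rw [Nat.add_sub_cancel]; push_cast; ring
    have a8' : ((4 + 2 * (m + 1) + m : ℕ) : ℤ) + (m + 1 - 1 : ℕ) = (4 * (m + 1) + 2 : ℕ) := by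
      rw [Nat.add_sub_cancel]; push_cast; ring
    have a9 : ((4 * (m + 1) + 2 : ℕ) : ℤ) + (m + 1 : ℕ) = (5 * (m + 1) + 2 : ℕ) := by
      push_cast; ring
    have hle : (m + 1 - 1) * (m + 1) ≤ (m + 1) * (m + 1) := Nat.mul_le_mul_right _ (by omega)
    simp only [ensures_block_cons, ensures_block_nil, ensures_load, ensures_add, ensures_sub, e1,
      e2, e3, e14, e7, Function.update_apply, reduceIte, Nat.reduceEqDiff, a7, a11, a10, a8, a8',
      a9]
    refine ⟨bn _ (by omega), bn _ (by omega), bn _ (by omega), bn _ (by omega), bn _ (by omega),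
      bn _ (by omega), ?_, emem, by omega⟩
    constructor <;> simp [e1, e2, e3, e6, hM]
  · exact ⟨0, by omega, by simp, by simp [Function.update_apply], by simp [Function.update_apply],
      by simp [Function.update_apply], rfl, by simp⟩

/-- One step of `initBlock`. -/
def initBody : Cmd := .block [.load 17 15, .load 18 14, .sub 18 18 4,
  .ite 18 (.sub 17 2 17) (.block [.sub 18 2 18, .ite 18 (.sub 17 2 17) .skip]),
  .add 17 17 6, .store 22 17, .add 22 22 1, .add 14 14 1, .add 15 15 1, .sub 13 13 1]

/-- Sets up the tables of single vertices. -/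
def initBlock : Cmd := .block [.const 15 4, .add 14 15 3, .add 22 9 2, .add 13 3 2,
  .loop 13 initBody, .store 8 1]

/-- Equality of a color with the target is decided by testing the sign of their difference in both
directions. The final store is the extra degree of the root, vertex `0`. -/
theorem ensures_initBlock {B M T : ℤ} {s : State} {n : ℕ} {inp deg : ℕ → ℤ} {tab : ℕ → ℕ → ℤ}
    {bal : ℕ → ℤ} (hB : Suffices n M B) (henv : Env n M s.reg) (hmem : Holds n inp deg tab s.mem)
    (hwt : ∀ v < n, 0 ≤ inp (4 + v) ∧ inp (4 + v) ≤ M)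
    (hcol : ∀ v < n, 0 ≤ inp (4 + n + v) ∧ inp (4 + n + v) ≤ 1) (hT : 0 ≤ T ∧ T ≤ 1)
    (hbal : ∀ v < n, bal v = if inp (4 + n + v) = T then inp (4 + v) else -inp (4 + v))
    (h4 : s.reg 4 = T) :
    Ensures B initBlock s fun s' => Holds n inp (Function.update deg 0 1)
      (fun v j => if j = 0 then M + bal v else tab v j) s'.mem ∧
      s'.clock ≤ s.clock + 20 * n + 10 := by
  have hn := hB.size_pos
  have hM₀ := hB.modulus_pos
  have hMn : 0 ≤ M * (n : ℤ) := by positivity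
  have bn : ∀ a : ℕ, a ≤ n * n + 20 * n + 100 → |(a : ℤ)| ≤ B := fun a ha => hB.abs_natCast_le ha
  have b4 : |(4 : ℤ)| ≤ B := by exact_mod_cast bn 4 (by omega)
  have a14 : (4 : ℤ) + n = (4 + n : ℕ) := by push_cast; ring
  unfold initBlock
  simp only [ensures_block_cons, ensures_block_nil, ensures_const, ensures_add, ensures_sub,
    henv.size, henv.zero, henv.tab,
    Function.update_apply, reduceIte, Nat.reduceEqDiff, add_zero, a14]
  refine ⟨b4, bn _ (by omega), bn _ (by omega), bn n (by omega), ?_⟩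
  refine ensures_loop (fun k s' => ∃ t, t + k = n ∧ s'.reg 13 = (k : ℕ) ∧
    s'.reg 14 = (4 + n + t : ℕ) ∧ s'.reg 15 = (4 + t : ℕ) ∧ s'.reg 22 = (tabAddr n t 0 : ℕ) ∧
    Holds n inp deg (fun v j => if j = 0 ∧ v < t then M + bal v else tab v j) s'.mem ∧
    s'.clock + 20 * k ≤ s.clock + 4 + 20 * n) n ?_ ?_ ?_
  · rintro k s' hf ⟨t, ht, e13, e14, e15, e22, hh, hclk⟩
    have henv' : Env n M s'.reg :=
      ((((henv.update (by norm_num) _).update (by norm_num) _).update (by norm_num)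
        _).update (by norm_num) _).frame hf (by decide)
    have e4 : s'.reg 4 = T := by rw [hf 4 (by decide)]; simp [Function.update_apply, h4]
    have htn : t < n := by omega
    have l₁ := hh.input (4 + t) (by omega)
    have l₂ := hh.input (4 + n + t) (by omega)
    have wt := hwt t htn
    have col := hcol t htn
    have bal' := hbal t htn
    have a22 : ((tabAddr n t 0 : ℕ) : ℤ) + 1 = (tabAddr n (t + 1) 0 : ℕ) := by
      unfold tabAddr; push_cast; ring
    have a14 : ((4 + n + t : ℕ) : ℤ) + 1 = (4 + n + (t + 1) : ℕ) := by push_cast; ring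
    have a15 : ((4 + t : ℕ) : ℤ) + 1 = (4 + (t + 1) : ℕ) := by push_cast; ring
    have a13 : ((k + 1 : ℕ) : ℤ) - 1 = k := by push_cast; ring
    have bc : |inp (4 + n + t) - T| ≤ B := hB.abs_le_linear (by omega) (by omega)
    have bc' : |(0 : ℤ) - (inp (4 + n + t) - T)| ≤ B := hB.abs_le_linear (by omega) (by omega)
    have bw : |(0 : ℤ) - inp (4 + t)| ≤ B := hB.abs_le_value (by linarith) (by linarith)
    have bm : |(0 : ℤ) - inp (4 + t) + M| ≤ B := hB.abs_le_value (by linarith) (by linarith)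
    have bp : |inp (4 + t) + M| ≤ B := hB.abs_le_value (by linarith) (by linarith)
    have b22 : |((tabAddr n (t + 1) 0 : ℕ) : ℤ)| ≤ B := bn _ (by unfold tabAddr; omega)
    have b14 : |((4 + n + (t + 1) : ℕ) : ℤ)| ≤ B := bn _ (by omega)
    have b15 : |((4 + (t + 1) : ℕ) : ℤ)| ≤ B := bn _ (by omega)
    have b13 : |(k : ℤ)| ≤ B := bn _ (by omega)
    have key : ∀ x, x = M + bal t → Holds n inp deg
        (fun v j => if j = 0 ∧ v < t + 1 then M + bal v else tab v j)
        (Function.update s'.mem (tabAddr n t 0) x) := by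
      rintro x rfl
      refine (hh.store_tab (j := 0) htn (M + bal t)).congr (fun _ _ => rfl) fun v hv j hj => ?_
      by_cases hvt : v = t
      · subst hvt
        by_cases hj0 : j = 0
        · subst hj0; simp
        · simp [hj0]
      · rw [Function.update_of_ne hvt]
        have : v < t + 1 ↔ v < t := by omega
        simp only [this]
    refine ⟨by rw [e13]; positivity, ?_⟩
    unfold initBody
    simp only [ensures_block_cons, ensures_block_nil, ensures_load, ensures_add, ensures_sub,
      ensures_store, ensures_ite, ensures_skip, henv'.one, henv'.zero, henv'.modulus, e4,
      e13, e14, e15, e22, Function.update_apply, reduceIte, Nat.reduceEqDiff,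
      Int.toNat_natCast, l₁, l₂, a22, a14, a15, a13]
    refine ⟨bc, fun h => ⟨bw, bm, b22, b14, b15, b13, t + 1, by omega, trivial, rfl, rfl,
      rfl, key _ ?_, by omega⟩, fun h => ⟨bc', fun h' => ⟨bw, bm, b22, b14, b15, b13, t + 1,
      by omega, trivial, rfl, rfl, rfl, key _ ?_, by omega⟩, fun h' => ⟨bp, b22, b14,
      b15, b13, t + 1, by omega, trivial, rfl, rfl, rfl, key _ ?_, by omega⟩⟩⟩
    · rw [bal', if_neg (by omega)]; ring
    · rw [bal', if_neg (by omega)]; ring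
    · rw [bal', if_pos (by omega)]; ring
  · rintro s' hf ⟨t, ht, e13, e14, e15, e22, hh, hclk⟩
    have henv' : Env n M s'.reg :=
      ((((henv.update (by norm_num) _).update (by norm_num) _).update (by norm_num)
        _).update (by norm_num) _).frame hf (by decide)
    obtain rfl : t = n := by omega
    refine ⟨by simp [e13], ?_⟩
    simp only [ensures_store, henv'.deg, henv'.one, Int.toNat_natCast]
    refine ⟨?_, by omega⟩
    have := (hh.store_deg hn 1)
    rw [add_zero] at this
    refine this.congr (fun _ _ => rfl) fun v hv j hj => ?_
    simp [hv]
  · refine ⟨0, by omega, by simp, by simp [Function.update_apply], by simp [Function.update_apply],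
      by simp [Function.update_apply, tabAddr], ?_, by simp⟩
    simpa using hmem

/-- One step of `countBlock`. -/
def countBody : Cmd := .block [.load 17 14, .add 17 8 17, .load 18 17, .add 18 18 1, .store 17 18,
  .add 14 14 1, .sub 13 13 1]

/-- Computes the degrees. -/
def countBlock : Cmd := .block [.add 14 10 2, .add 13 11 11, .loop 13 countBody]

/-- Each of the `2 * (n - 1)` endpoints in the edge list adds one to the degree of its vertex. -/
theorem ensures_countBlock {B M : ℤ} {s : State} {n : ℕ} {inp deg : ℕ → ℤ} {tab : ℕ → ℕ → ℤ}
    {e : ℕ → ℕ} (hB : Suffices n M B) (henv : Env n M s.reg) (hmem : Holds n inp deg tab s.mem)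
    (he : ∀ t < 2 * (n - 1), inp (4 + 2 * n + t) = e t ∧ e t < n)
    (hdeg : ∀ v < n, 0 ≤ deg v ∧ deg v ≤ 1) :
    Ensures B countBlock s fun s' => Holds n inp
      (fun v => deg v + ∑ t ∈ Finset.range (2 * (n - 1)), if e t = v then 1 else 0) tab s'.mem ∧
      s'.clock ≤ s.clock + 18 * n + 4 := by
  have hn := hB.size_pos
  obtain ⟨m, rfl⟩ : ∃ m, n = m + 1 := ⟨n - 1, by omega⟩
  have bn : ∀ a : ℕ, a ≤ (m + 1) * (m + 1) + 20 * (m + 1) + 100 → |(a : ℤ)| ≤ B :=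
    fun a ha => hB.abs_natCast_le ha
  rw [Nat.add_sub_cancel] at he ⊢
  have a13 : (m : ℤ) + m = (2 * m : ℕ) := by push_cast; ring
  unfold countBlock
  simp only [ensures_block_cons, ensures_block_nil, ensures_add, henv.pred, henv.zero, henv.edges,
    Function.update_apply, reduceIte, Nat.reduceEqDiff, add_zero, Nat.add_sub_cancel, a13]
  refine ⟨bn _ (by omega), bn _ (by omega), ?_⟩
  refine ensures_loop (fun k s' => ∃ t, t + k = 2 * m ∧ s'.reg 13 = (k : ℕ) ∧
    s'.reg 14 = (4 + 2 * (m + 1) + t : ℕ) ∧ Holds (m + 1) inp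
      (fun v => deg v + ∑ i ∈ Finset.range t, if e i = v then 1 else 0) tab s'.mem ∧
    s'.clock + 9 * k ≤ s.clock + 2 + 9 * (2 * m)) (2 * m) ?_ ?_ ?_
  · rintro k s' hf ⟨t, ht, e13, e14, hh, hclk⟩
    have henv' : Env (m + 1) M s'.reg :=
      ((henv.update (by norm_num) _).update (by norm_num) _).frame hf (by decide)
    obtain ⟨het, hetn⟩ := he t (by omega)
    have l₁ := hh.input (4 + 2 * (m + 1) + t) (by omega)
    rw [het] at l₁
    have l₂ := hh.deg (e t) hetn
    have c₃ : ((4 * (m + 1) + 2 : ℕ) : ℤ) + (e t : ℕ) = (4 * (m + 1) + 2 + e t : ℕ) := by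
      push_cast; ring
    have a14 : ((4 + 2 * (m + 1) + t : ℕ) : ℤ) + 1 = (4 + 2 * (m + 1) + (t + 1) : ℕ) := by
      push_cast; ring
    have a13 : ((k + 1 : ℕ) : ℤ) - 1 = k := by push_cast; ring
    have hd := hdeg (e t) hetn
    have b18 : |deg (e t) + (∑ i ∈ Finset.range t, if e i = e t then (1 : ℤ) else 0) + 1| ≤ B := by
      have h₁ : (∑ i ∈ Finset.range t, if e i = e t then (1 : ℤ) else 0) ≤ t := by
        rw [Finset.sum_boole]
        exact_mod_cast (Finset.card_filter_le _ _).trans (by simp)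
      have h₂ : 0 ≤ (∑ i ∈ Finset.range t, if e i = e t then (1 : ℤ) else 0) :=
        Finset.sum_nonneg fun i _ => by split_ifs <;> norm_num
      apply hB.abs_le_linear <;> push_cast <;> omega
    refine ⟨by rw [e13]; positivity, ?_⟩
    unfold countBody
    simp only [ensures_block_cons, ensures_block_nil, ensures_load, ensures_add, ensures_sub,
      ensures_store, henv'.one, henv'.deg, e13, e14, Function.update_apply, reduceIte,
      Nat.reduceEqDiff, Int.toNat_natCast, l₁, l₂, c₃, a14, a13]
    refine ⟨bn _ (by omega), b18, bn _ (by omega), bn _ (by omega), t + 1, by omega, trivial,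
      rfl, ?_, by omega⟩
    refine (hh.store_deg hetn _).congr (fun v hv => ?_) fun _ _ _ _ => rfl
    rw [Finset.sum_range_succ]
    by_cases hv' : v = e t
    · subst hv'
      rw [Function.update_self, if_pos rfl]
      ring
    · rw [Function.update_of_ne hv', if_neg (Ne.symm hv')]
      ring
  · rintro s' - ⟨t, ht, e13, -, hh, hclk⟩
    obtain rfl : t = 2 * m := by omega
    exact ⟨by simp [e13], hh, by simp only; omega⟩
  · refine ⟨0, by omega, by simp, by simp [Function.update_apply], ?_, by simp⟩
    simpa using hmem

/-! ### The answer -/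

/-- One step of the loop of `answerBlock`. -/
def rowBody : Cmd := .block [.add 14 14 3, .sub 13 13 1]

/-- Reads off the answer from the table of the root. -/
def answerBlock : Cmd := .block [.add 14 9 2, .sub 13 5 1, .loop 13 rowBody, .load 17 14,
  ceilBlock, .add 28 28 28, .sub 28 28 5, .sub 28 28 1, .sub 28 28 1, .ite 28 (.const 0 1) .skip]

/-- The row of `k - 1` closed parts is reached by repeated addition of `n`; this is affordable
because `k ≤ n`. -/
theorem ensures_answerBlock {B M : ℤ} {s : State} {n j : ℕ} {inp deg : ℕ → ℤ} {tab : ℕ → ℕ → ℤ}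
    (hB : Suffices n M B) (henv : Env n M s.reg) (hmem : Holds n inp deg tab s.mem)
    (hj : j < n) (htab : 0 ≤ tab 0 j ∧ tab 0 j ≤ M * (j + 2))
    (h0 : s.reg 0 = 0) (h5 : s.reg 5 = (j + 1 : ℕ)) :
    Ensures B answerBlock s fun s' =>
      s'.reg 0 = (if ((j + 1 : ℕ) : ℤ) + 2 < 2 * ceilDiv M (tab 0 j) then 1 else 0) ∧
      s'.clock ≤ s.clock + 9 * n + 30 := by
  have hn := hB.size_pos
  have hM₀ := hB.modulus_pos
  have bn : ∀ a : ℕ, a ≤ n * n + 20 * n + 100 → |(a : ℤ)| ≤ B := fun a ha => hB.abs_natCast_le ha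
  have a13 : ((j + 1 : ℕ) : ℤ) - 1 = j := by push_cast; ring
  have b1 : |(1 : ℤ)| ≤ B := by exact_mod_cast bn 1 (by omega)
  unfold answerBlock
  simp only [ensures_block_cons, ensures_block_nil, ensures_add, ensures_sub, henv.one, henv.zero,
    henv.tab, h5, Function.update_apply, reduceIte, Nat.reduceEqDiff, add_zero, a13]
  refine ⟨bn _ (by omega), bn _ (by omega), ?_⟩
  refine ensures_loop (fun k s' => ∃ t, t + k = j ∧ s'.reg 13 = (k : ℕ) ∧
    s'.reg 14 = (tabAddr n 0 t : ℕ) ∧ s'.mem = s.mem ∧ s'.clock + 4 * k ≤ s.clock + 2 + 4 * j)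
    j ?_ ?_ ?_
  · rintro k s' hf ⟨t, ht, e13, e14, emem, hclk⟩
    have henv' : Env n M s'.reg :=
      ((henv.update (by norm_num) _).update (by norm_num) _).frame hf (by decide)
    have a14 : ((tabAddr n 0 t : ℕ) : ℤ) + n = (tabAddr n 0 (t + 1) : ℕ) := by
      unfold tabAddr; push_cast; ring
    have a13 : ((k + 1 : ℕ) : ℤ) - 1 = k := by push_cast; ring
    refine ⟨by rw [e13]; positivity, ?_⟩
    unfold rowBody
    simp only [ensures_block_cons, ensures_block_nil, ensures_add, ensures_sub, henv'.one,
      henv'.size, e13, e14, Function.update_apply, reduceIte, Nat.reduceEqDiff, a13, a14]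
    exact ⟨hB.abs_tabAddr_le hn (by omega), bn _ (by omega), t + 1, by omega, trivial, rfl,
      emem, by omega⟩
  · rintro s' hf ⟨t, ht, e13, e14, emem, hclk⟩
    have henv' : Env n M s'.reg :=
      ((henv.update (by norm_num) _).update (by norm_num) _).frame hf (by decide)
    have e0 : s'.reg 0 = 0 := by rw [hf 0 (by decide)]; simp [Function.update_apply, h0]
    have e5 : s'.reg 5 = (j + 1 : ℕ) := by
      rw [hf 5 (by decide)]; simp [Function.update_apply, h5]
    obtain rfl : t = j := by omega
    refine ⟨by simp [e13], ?_⟩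
    simp only [ensures_block_cons, ensures_load, e14, emem, Int.toNat_natCast, hmem.tab 0 hn t hj]
    refine (ensures_ceilBlock (n := n) (x := tab 0 t) hB htab.1 ?_ (henv'.update (by norm_num) _)
      (by simp)).mono ?_
    · refine htab.2.trans (mul_le_mul_of_nonneg_left ?_ hM₀.le)
      push_cast
      omega
    rintro s₂ hf₂ ⟨-, d28, -, dclk⟩
    have henv₂ : Env n M s₂.reg := (henv'.update (by norm_num) _).frame hf₂ (by decide)
    have d0 : s₂.reg 0 = 0 := by rw [hf₂ 0 (by decide)]; simp [Function.update_apply, e0]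
    have d5 : s₂.reg 5 = (t + 1 : ℕ) := by
      rw [hf₂ 5 (by decide)]; simp [Function.update_apply, e5]
    have hc₁ : ceilDiv M (tab 0 t) ≤ t + 2 := (ceilDiv_le_iff hM₀).2 htab.2
    have hc₂ : 0 ≤ ceilDiv M (tab 0 t) := by
      rw [← ceilDiv_zero (M := M)]
      exact ceilDiv_mono hM₀ htab.1
    simp only at dclk
    simp only [ensures_block_cons, ensures_block_nil, ensures_add, ensures_sub, ensures_ite,
      ensures_const, ensures_skip, henv₂.one, d0, d5, d28, Function.update_apply, reduceIte,
      Nat.reduceEqDiff]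
    refine ⟨hB.abs_le_linear ?_ ?_, hB.abs_le_linear ?_ ?_, hB.abs_le_linear ?_ ?_,
      hB.abs_le_linear ?_ ?_, fun h => ⟨b1, ?_, by omega⟩, fun h => ⟨?_, by omega⟩⟩
    · omega
    · omega
    · push_cast; omega
    · push_cast; omega
    · push_cast; omega
    · push_cast; omega
    · push_cast; omega
    · push_cast; omega
    · rw [if_pos (by omega)]
    · rw [if_neg (by omega)]
  · exact ⟨0, by omega, by simp, by simp [Function.update_apply, tabAddr], rfl, by simp⟩

end RAM

namespace Gerrymandering

/-! ### Reading the input -/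

/-- The ends of the edges, in the order of the input. -/
def endpoints {n : ℕ} (es : List (Fin n × Fin n)) : List (Fin n) :=
  es.flatMap fun e => [e.1, e.2]

/-- The entry number `t` of `endpoints`, as a number. -/
def endpoint {n : ℕ} (es : List (Fin n × Fin n)) (t : ℕ) : ℕ :=
  ((endpoints es).map Fin.val).getD t 0

section Endpoints

variable {n : ℕ}

theorem length_endpoints (es : List (Fin n × Fin n)) : (endpoints es).length = 2 * es.length := by
  induction es with
  | nil => rfl
  | cons e es ih =>
    rw [endpoints, List.flatMap_cons, List.length_append, ← endpoints, ih, List.length_cons]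
    simp only [List.length_cons, List.length_nil]
    ring

theorem endpoint_two_mul (es : List (Fin n × Fin n)) {t : ℕ} (ht : t < es.length) :
    endpoint es (2 * t) = es[t].1 ∧ endpoint es (2 * t + 1) = es[t].2 := by
  induction es generalizing t with
  | nil => exact absurd ht (by simp)
  | cons e es ih =>
    cases t with
    | zero => exact ⟨rfl, rfl⟩
    | succ t => exact ih (t := t) (by simpa using ht)

theorem endpoint_lt (es : List (Fin n × Fin n)) {t : ℕ} (ht : t < 2 * es.length) :
    endpoint es t < n := by
  have h : t < ((endpoints es).map Fin.val).length := by
    rwa [List.length_map, length_endpoints]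
  rw [endpoint, List.getD_eq_getElem _ _ h, List.getElem_map]
  exact Fin.isLt _

theorem sum_range_getD_eq_count (l : List ℕ) (v : ℕ) :
    (∑ t ∈ Finset.range l.length, if l.getD t 0 = v then (1 : ℤ) else 0) = l.count v := by
  induction l with
  | nil => rfl
  | cons a l ih =>
    rw [List.length_cons, Finset.sum_range_succ', List.count_cons]
    simp only [List.getD_cons_succ, List.getD_cons_zero, ih, beq_iff_eq]
    push_cast
    rfl

/-- An edge that is no loop has `v` as an end at most once, and distinct edges at `v` lead to
distinct neighbors. -/
theorem count_endpoints {es : List (Fin n × Fin n)} (hnd : (es.map fun e => s(e.1, e.2)).Nodup)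
    (hne : ∀ e ∈ es, e.1 ≠ e.2) (v : Fin n) :
    (endpoints es).count v =
      (Finset.univ.filter fun b => s(v, b) ∈ es.map fun e => s(e.1, e.2)).card := by
  induction es with
  | nil => simp [endpoints]
  | cons e es ih =>
    rw [List.map_cons, List.nodup_cons] at hnd
    have hd : Disjoint (Finset.univ.filter fun b => s(v, b) = s(e.1, e.2))
        (Finset.univ.filter fun b => s(v, b) ∈ es.map fun e => s(e.1, e.2)) := by
      refine Finset.disjoint_filter.2 fun b _ h₁ h₂ => hnd.1 ?_
      rwa [h₁] at h₂
    have e₁ : (Finset.univ.filter fun b => s(v, b) ∈ (e :: es).map fun e => s(e.1, e.2)) =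
        (Finset.univ.filter fun b => s(v, b) = s(e.1, e.2)) ∪
        (Finset.univ.filter fun b => s(v, b) ∈ es.map fun e => s(e.1, e.2)) := by
      ext b; simp only [List.map_cons, List.mem_cons, Finset.mem_filter, Finset.mem_union,
        Finset.mem_univ, true_and]
    rw [e₁, Finset.card_union_of_disjoint hd, endpoints, List.flatMap_cons, List.count_append,
      ← endpoints, ih hnd.2 fun e he => hne e (List.mem_cons_of_mem _ he)]
    congr 1
    have hee := hne e List.mem_cons_self
    have e₂ : ∀ b, s(v, b) = s(e.1, e.2) ↔ (v = e.1 ∧ b = e.2) ∨ (v = e.2 ∧ b = e.1) := by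
      intro b; rw [Sym2.eq_iff]
    simp only [e₂, List.count_cons, List.count_nil, beq_iff_eq, zero_add]
    by_cases h₁ : v = e.1
    · subst h₁
      have : (Finset.univ.filter fun b => (e.1 = e.1 ∧ b = e.2) ∨ (e.1 = e.2 ∧ b = e.1)) = {e.2} := by
        ext b; simp [hee]
      rw [this]
      simp [hee.symm]
    · by_cases h₂ : v = e.2
      · subst h₂
        have : (Finset.univ.filter fun b => (e.2 = e.1 ∧ b = e.2) ∨ (e.2 = e.2 ∧ b = e.1)) = {e.1} := by
          ext b; simp [hee.symm]
        rw [this]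
        simp [hee]
      · simp [h₁, h₂, Ne.symm h₁, Ne.symm h₂]

end Endpoints

/-! ### Edge listings and the layout of the input -/

namespace Instance

variable {I : Instance} {es : List (Fin I.n × Fin I.n)}

theorem IsEdgeListing.ne (h : I.IsEdgeListing es) : ∀ e ∈ es, e.1 ≠ e.2 := by
  intro e he
  exact ((SimpleGraph.mem_edgeSet _).1 ((h.2 s(e.1, e.2)).1 (List.mem_map.2 ⟨e, he, rfl⟩))).ne

theorem IsEdgeListing.length_add_one (h : I.IsEdgeListing es) (hT : I.graph.IsTree) :
    es.length + 1 = I.n := by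
  classical
  have h₁ := hT.card_edgeFinset
  have e : I.graph.edgeFinset = (es.map fun e => s(e.1, e.2)).toFinset := by
    ext x
    rw [SimpleGraph.mem_edgeFinset, List.mem_toFinset, h.2]
  rw [e, List.toFinset_card_of_nodup h.1, List.length_map, Fintype.card_fin] at h₁
  exact h₁

theorem IsEdgeListing.enumeratesEdges (h : I.IsEdgeListing es) (hT : I.graph.IsTree) :
    RAM.EnumeratesEdges I.graph (fun t => endpoint es (2 * t))
      (fun t => endpoint es (2 * t + 1)) := by
  have hl := h.length_add_one hT
  intro a b
  rw [← SimpleGraph.mem_edgeSet, ← h.2, List.mem_map]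
  constructor
  · rintro ⟨e, he, hab⟩
    obtain ⟨t, ht, rfl⟩ := List.getElem_of_mem he
    obtain ⟨h₁, h₂⟩ := endpoint_two_mul es ht
    refine ⟨t, by omega, ?_⟩
    simp only [h₁, h₂]
    rcases Sym2.eq_iff.1 hab with ⟨ha, hb⟩ | ⟨ha, hb⟩
    · exact .inl ⟨by rw [ha], by rw [hb]⟩
    · exact .inr ⟨by rw [hb], by rw [ha]⟩
  · rintro ⟨t, ht, hab⟩
    have ht' : t < es.length := by omega
    obtain ⟨h₁, h₂⟩ := endpoint_two_mul es ht'
    simp only [h₁, h₂] at hab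
    refine ⟨es[t], List.getElem_mem ht', Sym2.eq_iff.2 ?_⟩
    rcases hab with ⟨ha, hb⟩ | ⟨ha, hb⟩
    · exact .inl ⟨Fin.ext ha.symm, Fin.ext hb.symm⟩
    · exact .inr ⟨Fin.ext hb.symm, Fin.ext ha.symm⟩

theorem IsEdgeListing.remainingDegree_eq (h : I.IsEdgeListing es) (root v : Fin I.n) :
    (remainingDegree I.graph root id v : ℤ) = (if v = root then 1 else 0) +
      ∑ t ∈ Finset.range (2 * es.length), if endpoint es t = v then 1 else 0 := by
  classical
  have e₁ := sum_range_getD_eq_count ((endpoints es).map Fin.val) v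
  rw [List.length_map, length_endpoints] at e₁
  have e₂ : (remainingNeighbors I.graph id v).card = (endpoints es).count v := by
    rw [count_endpoints h.1 h.ne]
    congr 1
    ext b
    rw [mem_remainingNeighbors, Finset.mem_filter, h.2, SimpleGraph.mem_edgeSet]
    simp
  unfold endpoint
  rw [e₁, List.count_map_of_injective _ _ Fin.val_injective, ← e₂, remainingDegree]
  push_cast
  split_ifs <;> ring

/-- The input in the memory of the machine. -/
def input (I : Instance) (es : List (Fin I.n × Fin I.n)) (a : ℕ) : ℤ := (I.encode es).getD a 0

theorem encode_eq : I.encode es = [(I.n : ℤ), (I.numColors : ℤ), ((I.target : ℕ) : ℤ), I.k] ++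
    (List.ofFn (fun v : Fin I.n => (I.weight v : ℤ)) ++
      (List.ofFn (fun v : Fin I.n => ((I.color v : ℕ) : ℤ)) ++
        ((endpoints es).map Fin.val).map Nat.cast)) := by
  unfold encode endpoints
  simp only [List.append_assoc, List.map_flatMap, List.map_cons, List.map_nil]

theorem input_weight (v : Fin I.n) : I.input es (4 + v) = I.weight v := by
  rw [input, encode_eq, List.getD_append_right _ _ _ _ (by simp)]
  rw [List.getD_append _ _ _ _ (by simp), List.getD_eq_getElem _ _ (by simp)]
  simp

theorem input_color (v : Fin I.n) : I.input es (4 + I.n + v) = (I.color v : ℕ) := by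
  rw [input, encode_eq, List.getD_append_right _ _ _ _ (by simp; omega)]
  rw [List.getD_append_right _ _ _ _ (by simp; omega)]
  rw [List.getD_append _ _ _ _ (by simp; omega), List.getD_eq_getElem _ _ (by simp; omega)]
  simp only [List.getElem_ofFn, List.length_ofFn, List.length_cons, List.length_nil]
  congr 2
  refine congrArg I.color (Fin.ext ?_)
  simp only
  omega

theorem input_edges (t : ℕ) : I.input es (4 + 2 * I.n + t) = endpoint es t := by
  rw [input, encode_eq, List.getD_append_right _ _ _ _ (by simp; omega)]
  rw [List.getD_append_right _ _ _ _ (by simp; omega)]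
  rw [List.getD_append_right _ _ _ _ (by simp; omega)]
  have e : 4 + 2 * I.n + t - ([(I.n : ℤ), (I.numColors : ℤ), ((I.target : ℕ) : ℤ), I.k]).length -
      (List.ofFn fun v : Fin I.n => (I.weight v : ℤ)).length -
      (List.ofFn fun v : Fin I.n => ((I.color v : ℕ) : ℤ)).length = t := by
    simp only [List.length_ofFn, List.length_cons, List.length_nil]
    omega
  rw [e, endpoint, ← Nat.cast_zero, List.getD_map]

/-- A tree has `n - 1` edges, so the input ends there; the cells for degrees and tables start out as
zero. -/
theorem IsEdgeListing.input_eq_zero (h : I.IsEdgeListing es) (hT : I.graph.IsTree) {a : ℕ}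
    (ha : 4 * I.n + 2 ≤ a) : I.input es a = 0 := by
  have hl := h.length_add_one hT
  refine List.getD_eq_default _ _ ?_
  rw [encode_eq]
  simp only [List.length_append, List.length_map, length_endpoints, List.length_ofFn,
    List.length_cons, List.length_nil]
  omega

theorem abs_input_le (h2 : I.numColors = 2) (a : ℕ) :
    |I.input es a| ≤ ((I.n + I.k.natAbs + (∑ v, I.weight v) + 2 : ℕ) : ℤ) := by
  have hmem : ∀ z ∈ I.encode es, |z| ≤ ((I.n + I.k.natAbs + (∑ v, I.weight v) + 2 : ℕ) : ℤ) := by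
    intro z hz
    rw [encode_eq] at hz
    simp only [List.mem_append, List.mem_cons, List.not_mem_nil, or_false, List.mem_ofFn,
      List.mem_map] at hz
    rcases hz with (rfl | rfl | rfl | rfl) | ⟨v, rfl⟩ | ⟨v, rfl⟩ | ⟨-, ⟨v, -, rfl⟩, rfl⟩
    · rw [Nat.abs_cast]; omega
    · rw [Nat.abs_cast]; omega
    · have := I.target.isLt
      rw [Nat.abs_cast]; omega
    · rw [Int.abs_eq_natAbs]; omega
    · have := Finset.single_le_sum (f := I.weight) (fun _ _ => Nat.zero_le _) (Finset.mem_univ v)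
      rw [Nat.abs_cast]; omega
    · have := (I.color v).isLt
      rw [Nat.abs_cast]; omega
    · have := v.isLt
      rw [Nat.abs_cast]; omega
  unfold input
  by_cases ha : a < (I.encode es).length
  · rw [List.getD_eq_getElem _ _ ha]
    exact hmem _ (List.getElem_mem ha)
  · rw [List.getD_eq_default _ _ (by omega), abs_zero]
    positivity

end Instance

end Gerrymandering

namespace RAM

open Gerrymandering Cmd

/-! ### The complete program -/

/-- The program for `1 ≤ k ≤ n`. -/
def treeBlock : Cmd := .block [weightBlock, initBlock, countBlock, mainBlock, answerBlock]

/-- Gerrymandering over trees with two colors. -/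
def gerrymander : Cmd := .block [.const 1 1, .load 3 2, .const 14 2, .load 4 14, .const 14 3,
  .load 5 14, .add 17 3 1, .sub 17 17 5, .ite 5 (.ite 17 treeBlock .skip) .skip]

/-- Before any contraction all bags are single vertices: one value without closed parts, and the
default `0` elsewhere. -/
theorem isProgress_init {I : Instance} {root : Fin I.n} {deg : ℕ → ℤ}
    {tab : ℕ → ℕ → ℤ}
    (hdeg : ∀ v : Fin I.n, deg v = remainingDegree I.graph root id v)
    (htab : ∀ v : Fin I.n, ∀ j, tab v j = if j = 0 then I.modulus + I.balance v else 0) :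
    IsProgress I.graph root I.balance I.modulus id deg tab where
  contraction := isContraction_id
  deg := hdeg
  tab v _ j _ := by
    have e : bag (id : Fin I.n → Fin I.n) v = {v} := by
      ext a; simp [mem_bag]
    rw [e, htab]
    refine ⟨fun x hx => ?_, ?_⟩
    · obtain ⟨rfl, rfl⟩ := isValue_singleton_iff.1 hx
      simp
    · split_ifs with hj
      · exact .inr (isValue_singleton_iff.2 ⟨hj, rfl⟩)
      · exact .inl rfl

theorem ensures_treeBlock {I : Instance} {es : List (Fin I.n × Fin I.n)} {B : ℤ} {s : State}
    (h2 : I.numColors = 2) (hT : I.graph.IsTree) (hes : I.IsEdgeListing es)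
    (hB : Suffices I.n I.modulus B) (hk : 0 < I.k) (hkn : I.k ≤ I.n)
    (hmem : s.mem = I.input es) (h0 : s.reg 0 = 0) (h1 : s.reg 1 = 1) (h2' : s.reg 2 = 0)
    (h3 : s.reg 3 = I.n) (h4 : s.reg 4 = (I.target : ℕ)) (h5 : s.reg 5 = I.k) :
    Ensures B treeBlock s fun s' =>
      (I.IsYes → s'.reg 0 = 1) ∧ (¬ I.IsYes → s'.reg 0 = 0) ∧
      s'.clock ≤ s.clock + I.n * (25 * (I.n * I.n) + 102 * I.n + 25) + 54 * I.n + 59 := by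
  have hn := hB.size_pos
  have hM := hB.modulus_pos
  have hl := hes.length_add_one hT
  obtain ⟨j, hj⟩ : ∃ j : ℕ, I.k = (j + 1 : ℕ) := ⟨(I.k - 1).toNat, by omega⟩
  set root : Fin I.n := ⟨0, hn⟩ with hroot
  have hwle : ∀ v : Fin I.n, (I.weight v : ℤ) ≤ I.modulus := by
    intro v
    have := Finset.single_le_sum (f := I.weight) (fun _ _ => Nat.zero_le _) (Finset.mem_univ v)
    unfold Instance.modulus
    omega
  have hcol : ∀ v, ((I.color v : ℕ) : ℤ) = (I.target : ℕ) ↔ I.color v = I.target := by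
    intro v
    rw [Fin.ext_iff]
    exact Nat.cast_inj
  unfold treeBlock
  simp only [ensures_block_cons, ensures_block_nil]
  refine (ensures_weightBlock (wt := fun v => I.input es (4 + v)) hB ?_ ?_ h1 h2' h3).mono ?_
  · intro v hv
    rw [hmem]
    refine ⟨rfl, ?_⟩
    rw [Instance.input_weight ⟨v, hv⟩]
    positivity
  · rw [Finset.sum_range, Instance.modulus]
    push_cast
    congr 1
    exact Finset.sum_congr rfl fun v _ => (Instance.input_weight v).symm
  rintro s₁ hf₁ ⟨env₁, mem₁, clk₁⟩
  have r4₁ : s₁.reg 4 = (I.target : ℕ) := by rw [hf₁ 4 (by decide), h4]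
  have holds₁ : Holds I.n (I.input es) (fun _ => 0) (fun _ _ => 0) s₁.mem := by
    rw [mem₁, hmem]
    refine ⟨fun _ _ => rfl, fun v _ => hes.input_eq_zero hT (by omega),
      fun v _ j _ => hes.input_eq_zero hT ?_⟩
    unfold tabAddr
    omega
  refine (ensures_initBlock (T := (I.target : ℕ))
    (bal := fun v => if h : v < I.n then I.balance ⟨v, h⟩ else 0) hB env₁ holds₁
    ?_ ?_ ?_ ?_ r4₁).mono ?_
  · intro v hv
    rw [Instance.input_weight ⟨v, hv⟩]
    exact ⟨by positivity, hwle _⟩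
  · intro v hv
    have := (I.color ⟨v, hv⟩).isLt
    rw [Instance.input_color ⟨v, hv⟩]
    omega
  · have := I.target.isLt
    omega
  · intro v hv
    rw [Instance.input_color ⟨v, hv⟩, Instance.input_weight ⟨v, hv⟩, dif_pos hv, Instance.balance]
    simp only [hcol]
  rintro s₂ hf₂ ⟨holds₂, clk₂⟩
  have env₂ : Env I.n I.modulus s₂.reg := env₁.frame hf₂ (by decide)
  have hnl : I.n - 1 = es.length := by omega
  refine (ensures_countBlock (e := endpoint es) hB env₂ holds₂ ?_ ?_).mono ?_
  · intro t ht
    rw [hnl] at ht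
    exact ⟨Instance.input_edges t, endpoint_lt es ht⟩
  · intro v hv
    rw [Function.update_apply]
    split_ifs <;> norm_num
  rintro s₃ hf₃ ⟨holds₃, clk₃⟩
  have env₃ : Env I.n I.modulus s₃.reg := env₂.frame hf₃ (by decide)
  have hE : ListsEdges I.n (I.input es) (fun t => endpoint es (2 * t))
      (fun t => endpoint es (2 * t + 1)) := by
    intro t ht
    exact ⟨Instance.input_edges _, Instance.input_edges (2 * t + 1), endpoint_lt es (by omega),
      endpoint_lt es (by omega)⟩
  refine (ensures_mainBlock (root := root) (r := id) hB env₃ holds₃ hE hT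
    (hes.enumeratesEdges hT) I.abs_sum_balance_lt (isProgress_init ?_ ?_) ?_).mono ?_
  · intro v
    rw [hes.remainingDegree_eq root v, hnl, Function.update_apply]
    simp only [hroot, Fin.ext_iff]
  · intro v j
    simp only [v.isLt, dif_pos]
  · simp [remaining]
  rintro s₄ hf₄ ⟨clk₄, deg, tab, holds₄, hrep⟩
  have env₄ : Env I.n I.modulus s₄.reg := env₃.frame hf₄ (by decide)
  have hjn : j < I.n := by omega
  have hrep' := hrep j hjn
  refine (ensures_answerBlock (j := j) hB env₄ holds₄ hjn (hrep'.bounds I.abs_sum_balance_lt)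
    ?_ ?_).mono ?_
  · rw [hf₄ 0 (by decide), hf₃ 0 (by decide), hf₂ 0 (by decide), hf₁ 0 (by decide), h0]
  · rw [hf₄ 5 (by decide), hf₃ 5 (by decide), hf₂ 5 (by decide), hf₁ 5 (by decide), h5, hj]
  rintro s₅ - ⟨r0, clk₅⟩
  have hyes : I.IsYes ↔ ((j + 1 : ℕ) : ℤ) + 2 < 2 * ceilDiv I.modulus (tab 0 j) := by
    have e : (I.k - 1).toNat = j := by omega
    rw [I.isYes_iff h2 root, e, hrep'.exists_ceilDiv_iff hM hk, ← hj]
    exact ⟨fun h => h.2.2, fun h => ⟨hk, hkn, h⟩⟩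
  refine ⟨fun h => ?_, fun h => ?_, by omega⟩
  · rw [r0, if_pos (hyes.1 h)]
  · rw [r0, if_neg fun h' => h (hyes.2 h')]

/-- If `k` is outside `1, …, n` the answer is no at once; otherwise every table index is in range.
The bound on `|I.k|` covers the computation of `n + 1 - k`. -/
theorem ensures_gerrymander {I : Instance} {es : List (Fin I.n × Fin I.n)} {B : ℤ}
    (h2 : I.numColors = 2) (hT : I.graph.IsTree) (hes : I.IsEdgeListing es)
    (hB : Suffices I.n I.modulus B) (hkB : I.n + 1 + |I.k| ≤ B) :
    Ensures B gerrymander ⟨fun _ => 0, I.input es, 0⟩ fun s =>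
      s.clock ≤ 300 * I.n ^ 3 ∧ (I.IsYes → s.reg 0 = 1) ∧ (¬ I.IsYes → s.reg 0 = 0) := by
  have hn := hB.size_pos
  have bn : ∀ a : ℕ, a ≤ I.n * I.n + 20 * I.n + 100 → |(a : ℤ)| ≤ B :=
    fun a ha => hB.abs_natCast_le ha
  have b1 : |(1 : ℤ)| ≤ B := by exact_mod_cast bn 1 (by omega)
  have b2 : |(2 : ℤ)| ≤ B := by exact_mod_cast bn 2 (by omega)
  have b3 : |(3 : ℤ)| ≤ B := by exact_mod_cast bn 3 (by omega)
  have l0 : I.input es 0 = I.n := rfl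
  have l2 : I.input es 2 = (I.target : ℕ) := rfl
  have l3 : I.input es 3 = I.k := rfl
  have t0 : (0 : ℤ).toNat = 0 := rfl
  have t2 : (2 : ℤ).toNat = 2 := rfl
  have t3 : (3 : ℤ).toNat = 3 := rfl
  -- As `n ≥ 1`, lower powers are absorbed by the cube; the coefficients of all terms add up to less
  -- than `300`.
  have hcube : I.n * I.n ≤ I.n ^ 3 ∧ I.n ≤ I.n ^ 3 ∧ 1 ≤ I.n ^ 3 := by
    refine ⟨?_, Nat.le_self_pow (by norm_num) _, Nat.one_le_pow _ _ hn⟩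
    rw [← pow_two]
    exact Nat.pow_le_pow_right hn (by norm_num)
  have hk₁ := le_abs_self I.k
  have hk₂ := neg_abs_le I.k
  have hno : ¬ (0 < I.k ∧ I.k ≤ I.n) → ¬ I.IsYes := by
    intro h h'
    have := (I.isYes_iff h2 ⟨0, hn⟩).1 h'
    exact h ⟨this.1, this.2.1⟩
  unfold gerrymander
  simp only [ensures_block_cons, ensures_block_nil, ensures_const, ensures_load, ensures_add,
    ensures_sub, ensures_ite, ensures_skip, Function.update_apply, reduceIte, Nat.reduceEqDiff,
    t0, t2, t3, l0, l2, l3, OfNat.zero_ne_ofNat, OfNat.ofNat_ne_zero, OfNat.ofNat_ne_one,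
    OfNat.one_ne_ofNat]
  refine ⟨b1, b2, b3, ?_, ?_, fun h₁ => ⟨fun h₂ => ?_, fun h₂ => ?_⟩, fun h₁ => ?_⟩
  · exact_mod_cast bn (I.n + 1) (by omega)
  · rw [abs_le]
    constructor <;> linarith
  · refine (ensures_treeBlock h2 hT hes hB h₁ (by omega) rfl ?_ ?_ ?_ ?_ ?_ ?_).mono ?_
    · simp [Function.update_apply]
    · simp [Function.update_apply]
    · simp [Function.update_apply]
    · simp [Function.update_apply]
    · simp [Function.update_apply]
    · simp [Function.update_apply]
    rintro s' - ⟨hy, hn', hclk⟩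
    refine ⟨?_, hy, hn'⟩
    have e : I.n * (25 * (I.n * I.n) + 102 * I.n + 25) =
        25 * I.n ^ 3 + 102 * (I.n * I.n) + 25 * I.n := by ring
    simp only at hclk
    omega
  · exact ⟨by omega, fun h => absurd h (hno fun hc => by omega), fun _ => trivial⟩
  · exact ⟨by omega, fun h => absurd h (hno fun hc => by omega), fun _ => trivial⟩

end RAM

/-- Restricted to trees and to exactly two colors, Gerrymandering over Graphs is solved by one
program in `O(n ^ 3)` steps on words of `O(log (n + |k| + total weight))` bits. -/
theorem proposition3 :
    ∃ (P : RAM.Program) (c d : ℕ), ∀ I : Gerrymandering.Instance,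
      I.numColors = 2 → I.graph.IsTree →
      ∀ es : List (Fin I.n × Fin I.n), I.IsEdgeListing es →
        RAM.DecidesWithin P (I.encode es) I.IsYes
          (c * I.n ^ 3) ((I.n + I.k.natAbs + (∑ v, I.weight v) + 2) ^ d) := by
  refine ⟨RAM.gerrymander.code 0, 300, 8, fun I h2 hT es hes => ?_⟩
  set X := I.n + I.k.natAbs + (∑ v, I.weight v) + 2 with hX
  have hn : 0 < I.n := by
    have := hes.length_add_one hT
    omega
  have hX₁ : X ≤ X ^ 8 := Nat.le_self_pow (by norm_num) _
  -- Since `n ≥ 1`, `X` is at least `3`, so `X ^ 3 ≥ 9 * X`, while `X ≥ n + 2`.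
  have hX₃ : I.n + 10 ≤ X ^ 3 := by
    have h : 3 ^ 2 * X ≤ X ^ 2 * X := Nat.mul_le_mul_right _ (Nat.pow_le_pow_left (by omega) 2)
    have e : X ^ 3 = X ^ 2 * X := by ring
    omega
  have hle : ∀ i ≤ 8, X ^ i ≤ X ^ 8 := fun i hi => Nat.pow_le_pow_right (by omega) hi
  -- Addresses need `X ^ 6` and values need `X ^ 4`; the exponent `8` leaves slack.
  have hB : RAM.Suffices I.n I.modulus ((X ^ 8 : ℕ) : ℤ) := by
    refine ⟨hn, ?_, ?_, ?_⟩
    · unfold Gerrymandering.Instance.modulus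
      positivity
    · have h : (I.n + 10) * (I.n + 10) ≤ X ^ 8 :=
        (Nat.mul_le_mul hX₃ hX₃).trans (by rw [← pow_add]; exact hle 6 (by norm_num))
      exact_mod_cast h
    · have h : (1 + ∑ v, I.weight v) * (I.n + 10) ≤ X ^ 8 :=
        (Nat.mul_le_mul (show _ ≤ X by omega) hX₃).trans
          (by rw [← pow_succ']; exact hle 4 (by norm_num))
      unfold Gerrymandering.Instance.modulus
      exact_mod_cast h
  refine RAM.DecidesWithin.of_ensures (fun a => ?_) (RAM.ensures_gerrymander h2 hT hes hB ?_)
  · exact (Gerrymandering.Instance.abs_input_le h2 a).trans (by exact_mod_cast hX₁)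
  · rw [Int.abs_eq_natAbs]
    omega
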